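/- Let $n\ge 2$, and let $D_n$ be the group of permutations of $\{-n,\dots,-1,1,\dots,n\}$ generated by $S=\{s_{1'},s_1,\dots,s_{n-1}\}$, where $s_i=(-i-1,\,-i)(i,\,i+1)$ and $s_{1'}=(-2,\,1)(-1,\,2)$. For $J\subseteq S$ let $W_J=\langle J\rangle$, and let $\mathcal X_J\in\mathbb Z[D_n]$ be the sum of all elements that have minimal length (with respect to $S$) in their left coset $wW_J$. Let $\mathcal Z$ be the subring of $\mathbb Z[D_n]$ generated by all $\mathcal X_J$. For a prime $p$, the $p$-modular descent algebra is the $\mathbb F_p$-algebra $\Sigma(D_n,p)=\mathcal Z/p\mathcal Z$. A composition $\kappa=[\kappa_1,\dots,\kappa_k]$ of $m\ge 0$ is a list of positive integers (its components) with sum $m$; $[\ ]$ is the composition of $0$. Let $\mathcal C(n)$ be the disjoint union of the set $\mathcal C_{<n}$ of compositions of all $m\le n-2$, the set $\mathcal C_1$ of compositions of $n$ with $\kappa_1=1$, the set $\mathcal C_n$ of compositions of $n$ with $\kappa_1\ge 2$, and a second copy $\mathcal C_n'=\{\kappa^\vee : \kappa\in\mathcal C_n\}$ of the latter, where $\kappa^\vee$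 has the same components as $\kappa$. To $\kappa\in\mathcal C(n)$ associate the following subset $J_\kappa\subseteq S$: * if $\kappa\in\mathcal C_{<n}$ is a composition of $m$: $\{s_{n-m+\kappa_1+\dots+\kappa_j} : 0\le j\le k-1\}$; * if $\kappa\in\mathcal C_1$ or $\kappa\in\mathcal C_n$: $\{s_{1'}\}\cup\{s_{\kappa_1+\dots+\kappa_j} : 1\le j\le k-1\}$; * if $\kappa\in\mathcal C_n'$: $\{s_1\}\cup\{s_{\kappa_1+\dots+\kappa_j} : 1\le j\le k-1\}$. Put $B_\kappa=\mathcal X_{S\setminus J_\kappa}$, and let $\overline B_\kappa$ be its image in $\Sigma(D_n,p)$. Write $\kappa\approx\nu$ if the components of $\nu$ are a reordering of those of $\kappa$, except when one of $\kappa,\nu$ is in $\mathcal C_n$, the other is in $\mathcal C_n'$, and all components are even. **Theorem.** The $B_\kappa$, $\kappa\in\mathcal C(n)$, span $\mathcal Z$ over $\mathbb Z$. The (Jacobson) radical of $\Sigma(D_n,p)$ is the $\mathbb F_p$-span of the following elements. 1. If $p\ne 2$: all $\overline B_\kappa-\overline B_\nu$ with $\kappa\approx\nu$, together with all $\overline B_\kappa$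 such that some integer occurs at least $p$ times among the components of $\kappa$. 2. If $p=2$ and $n$ is even: all $\overline B_\kappa$ with $\kappa\ne[\ ]$. 3. If $p=2$ and $n$ is odd: all $\overline B_\kappa$ with $\kappa\notin\{[\ ],[n],[n]^\vee\}$, together with $\overline B_{[n]}-\overline B_{[n]^\vee}$. -/

import Mathlib

namespace TypeD

/-- The set `{-n, …, -1, 1, …, n}`. -/
abbrev SignedPoint (n : ℕ) : Type := {z : ℤ // z ≠ 0 ∧ -(n : ℤ) ≤ z ∧ z ≤ n}

instance (n : ℕ) : Finite (SignedPoint n) :=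
  ((Set.finite_Icc (-(n : ℤ)) n).subset fun _ hz => ⟨hz.2.1, hz.2.2⟩).to_subtype

/-- The Coxeter generators, indexed by `Fin n`: the index `0` stands for the generator
`s_{1'} = (-2, 1)(-1, 2)`, and an index `i ∈ {1, …, n - 1}` for
`s_i = (-i - 1, -i)(i, i + 1)`. (For `n ≤ 1` there is no `s_{1'}`; the value is then `1`.) -/
def simpleReflection (n : ℕ) (i : Fin n) : Equiv.Perm (SignedPoint n) :=
  if _h : (i : ℕ) = 0 then
    if _hn : 2 ≤ n then
      Equiv.swap ⟨-2, by omega⟩ ⟨1, by omega⟩ * Equiv.swap ⟨-1, by omega⟩ ⟨2, by omega⟩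
    else 1
  else
    Equiv.swap ⟨-(i : ℤ) - 1, by omega⟩ ⟨-(i : ℤ), by omega⟩ *
      Equiv.swap ⟨(i : ℤ), by omega⟩ ⟨(i : ℤ) + 1, by omega⟩

/-- The Coxeter group `D_n`, as a group of permutations of `{-n, …, -1, 1, …, n}`. -/
def coxeterGroup (n : ℕ) : Subgroup (Equiv.Perm (SignedPoint n)) :=
  Subgroup.closure (Set.range (simpleReflection n))

instance (n : ℕ) : Finite (coxeterGroup n) := by
  unfold coxeterGroup; infer_instance

/-- The generators as elements of `D_n`. -/
def gen (n : ℕ) (i : Fin n) : coxeterGroup n :=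
  ⟨simpleReflection n i, Subgroup.subset_closure ⟨i, rfl⟩⟩

/-- The Coxeter length: the least length of a word in the generators that represents `w`. -/
noncomputable def length {n : ℕ} (w : coxeterGroup n) : ℕ :=
  sInf {k : ℕ | ∃ l : List (Fin n), l.length = k ∧ (l.map (gen n)).prod = w}

/-- The subgroup `W_J` generated by the generators with index in `J`. -/
def parabolic {n : ℕ} (J : Set (Fin n)) : Subgroup (coxeterGroup n) :=
  Subgroup.closure (gen n '' J)

/-- `X_J`: the elements of minimal length in their left coset `w W_J`. -/
def minReps {n : ℕ} (J : Set (Fin n)) : Set (coxeterGroup n) :=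
  {w | ∀ u ∈ parabolic J, length w ≤ length (w * u)}

/-- The formal sum of the elements of `X_J`, in the integral group ring of `D_n`. -/
noncomputable def repSum {n : ℕ} (J : Set (Fin n)) : MonoidAlgebra ℤ (coxeterGroup n) :=
  ∑ w ∈ (Set.toFinite (minReps J)).toFinset, MonoidAlgebra.of ℤ (coxeterGroup n) w

/-- The integral descent ring of `D_n`, as the subring of the group ring generated by the sums
`repSum J`. By a theorem of Solomon it is just their `ℤ`-span; the main theorem asserts this as
well, and no definition relies on it. -/
noncomputable def descentRing (n : ℕ) : Subring (MonoidAlgebra ℤ (coxeterGroup n)) :=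
  Subring.closure (Set.range fun J : Set (Fin n) => repSum J)

/-- The ideal of all multiples of `p` in the integral descent ring. -/
def multiples (n p : ℕ) : Ideal (descentRing n) where
  carrier := {x | ∃ y, x = p • y}
  zero_mem' := ⟨0, by simp⟩
  add_mem' := by
    rintro _ _ ⟨a, rfl⟩ ⟨b, rfl⟩
    exact ⟨a + b, by simp⟩
  smul_mem' := by
    rintro c _ ⟨a, rfl⟩
    exact ⟨c * a, by rw [smul_eq_mul, mul_smul_comm]⟩

instance (n p : ℕ) : (multiples n p).IsTwoSided where
  mul_mem_of_left := by
    rintro _ b ⟨a, rfl⟩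
    exact ⟨a * b, by rw [smul_mul_assoc]⟩

/-- The `p`-modular descent algebra `Σ(D_n, p)`. -/
abbrev ModularDescentAlgebra (n p : ℕ) : Type := descentRing n ⧸ multiples n p

/-- `Σ(D_n, p)` is a vector space over `𝔽_p`. -/
noncomputable instance (n p : ℕ) : Module (ZMod p) (ModularDescentAlgebra n p) :=
  AddCommGroup.zmodModule (n := p) fun x => by
    obtain ⟨y, rfl⟩ := Ideal.Quotient.mk_surjective x
    have h : Ideal.Quotient.mk (multiples n p) (p • y) = 0 :=
      Ideal.Quotient.eq_zero_iff_mem.mpr ⟨y, rfl⟩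
    rw [nsmul_eq_mul, map_mul, map_natCast] at h
    rwa [nsmul_eq_mul]

/-- The multiset `𝒞(n)`, a disjoint union of four sets of compositions:
* `below`: the compositions of the integers `m ≤ n - 2`;
* `one`: the compositions of `n` with first component `1`;
* `top`: the compositions of `n` with first component at least `2`;
* `dual`: a second copy of the preceding set, whose members are written `κ^∨`. -/
inductive DComposition (n : ℕ) : Type
  | below (m : ℕ) (hm : m + 2 ≤ n) (c : Composition m)
  | one (c : Composition n) (h : ∃ a ∈ c.blocks.head?, a = 1)
  | top (c : Composition n) (h : ∃ a ∈ c.blocks.head?, 2 ≤ a)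
  | dual (c : Composition n) (h : ∃ a ∈ c.blocks.head?, 2 ≤ a)

namespace DComposition

/-- The list of components. -/
def components {n : ℕ} : DComposition n → List ℕ
  | below _ _ c => c.blocks
  | one c _ => c.blocks
  | top c _ => c.blocks
  | dual c _ => c.blocks

/-- Membership in the first copy `𝒞_n`. -/
def IsTop {n : ℕ} : DComposition n → Prop
  | top _ _ => True
  | _ => False

/-- Membership in the second copy `𝒞_n'`. -/
def IsDual {n : ℕ} : DComposition n → Prop
  | dual _ _ => True
  | _ => False

/-- The subset of the generators that corresponds to a member of `𝒞(n)`; recall that the index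
`0` stands for `s_{1'}`, and that `c.sizeUpTo j` is the sum of the first `j` components. -/
def subset {n : ℕ} : DComposition n → Set (Fin n)
  | below m _ c => {i | ∃ j < c.length, (i : ℕ) = (n - m) + c.sizeUpTo j}
  | one c _ => {i | (i : ℕ) = 0 ∨ ∃ j, 1 ≤ j ∧ j < c.length ∧ (i : ℕ) = c.sizeUpTo j}
  | top c _ => {i | (i : ℕ) = 0 ∨ ∃ j, 1 ≤ j ∧ j < c.length ∧ (i : ℕ) = c.sizeUpTo j}
  | dual c _ => {i | (i : ℕ) = 1 ∨ ∃ j, 1 ≤ j ∧ j < c.length ∧ (i : ℕ) = c.sizeUpTo j}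

/-- The relation `κ ≈ ν`. -/
def Equivalent {n : ℕ} (κ ν : DComposition n) : Prop :=
  κ.components.Perm ν.components ∧
    ¬ (κ.IsTop ∧ ν.IsDual ∧ ∀ a ∈ κ.components, Even a) ∧
    ¬ (κ.IsDual ∧ ν.IsTop ∧ ∀ a ∈ κ.components, Even a)

/-- `κ` has a component of multiplicity `p` or more. -/
def HasMultiplicityAtLeast {n : ℕ} (p : ℕ) (κ : DComposition n) : Prop :=
  ∃ a ∈ κ.components, p ≤ κ.components.count a

/-- The empty composition `[ ]`. -/
def empty {n : ℕ} (hn : 2 ≤ n) : DComposition n :=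
  below 0 (by omega) (Composition.ones 0)

/-- The composition `[n]`. -/
def single {n : ℕ} (hn : 2 ≤ n) : DComposition n :=
  top (Composition.single n (by omega)) ⟨n, by simp, hn⟩

/-- The composition `[n]^∨`. -/
def singleDual {n : ℕ} (hn : 2 ≤ n) : DComposition n :=
  dual (Composition.single n (by omega)) ⟨n, by simp, hn⟩

end DComposition

/-- `B_κ`, the sum `𝒳_{J^c}` for the subset `J` that corresponds to `κ`. -/
noncomputable def B {n : ℕ} (κ : DComposition n) : descentRing n :=
  ⟨repSum κ.subsetᶜ, Subring.subset_closure ⟨κ.subsetᶜ, rfl⟩⟩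

/-- The image of `B_κ` in `Σ(D_n, p)`. -/
noncomputable def Bbar {n : ℕ} (p : ℕ) (κ : DComposition n) : ModularDescentAlgebra n p :=
  Ideal.Quotient.mk (multiples n p) (B κ)

/-- The radical of `Σ(D_n, p)`, that is, its Jacobson radical. -/
noncomputable def radical (n p : ℕ) : Ideal (ModularDescentAlgebra n p) :=
  Ring.jacobson (ModularDescentAlgebra n p)

end TypeD

open TypeD

namespace TypeD

/-! Faces of the Coxeter complex are modelled by odd integer functions `v` on the signed points, on
which the group acts by `v ∘ w`. If `v` is dominant and fixed by exactly the generators in `K`, then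
the minimal representatives of the cosets of W_K correspond to the members of the orbit of `v`. In
this model Solomon's theorem (`repSum_mul_repSum`) says that 𝒳_K 𝒳_J is the sum, over those `u` in
the orbit of `v` that increase weakly along `J`, of the 𝒳_I, where `I` consists of the generators in
`J` that fix `u`. So the 𝒳_J span 𝒵, and left multiplication is triangular with respect to
inclusion. The diagonal entry at `J`, the number of members of the orbit that W_J fixes, is a ring
homomorphism to ℤ. Modulo `p`, an element killed by all these characters is nilpotent, and the
radical is their common kernel (`IsTriangular.mem_jacobson_iff`, `mem_radical_iff`).

What remains is counting modulo `p`. An orbit is determined by the sizes of its level sets, which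
are the components of κ, and by the sign of the product of the coordinates, which separates 𝒞_n from
𝒞_n' (`mem_orbit_iff`). The character of B_κ at ν counts the vectors of type κ that factor through
the vector of ν (`character_Bbar`). Relabelling the values of vectors commutes with the group. It
shows that κ ≈ ν have the same characters: where the product signs differ, an odd component allows a
sign change of one value to repair this. A relabelling of order `p` that fixes no vector makes the
count divisible by `p`; it can be a cyclic permutation of `p` values of equal multiplicity or, for
`p = 2`, a change of signs.

Conversely, for odd `p`, the count at ν = κ is the order of a group of permutations of values, and
by Cauchy's theorem `p` divides it only if `p` components are equal (`HasParts.exists_le_count`). If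
ν has no more components than κ, the count is zero unless κ ≈ ν
(`DComposition.equivalent_of_card_fixed_ne_zero`), so elimination by the number of components
exhausts the radical. For `p = 2` the characters at [ ] and, if `n` is odd, at [n] suffice. -/

instance (n : ℕ) : InvolutiveNeg (SignedPoint n) where
  neg a := ⟨-a.1, by have := a.2; omega⟩
  neg_neg a := Subtype.ext (neg_neg a.1)

noncomputable instance (n : ℕ) : Fintype (SignedPoint n) := Fintype.ofFinite _

noncomputable instance (n : ℕ) : Fintype (coxeterGroup n) := Fintype.ofFinite _

/-! ### Simple reflections and the order of the signed points -/

section Simple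

variable {n : ℕ}

@[simp]
theorem coe_neg (a : SignedPoint n) : ((-a : SignedPoint n) : ℤ) = -(a : ℤ) := rfl

variable [hn : Fact (2 ≤ n)]

/-- The lower member of the pair `lo i < hi i` that the `i`-th simple reflection interchanges. -/
def lo (i : Fin n) : SignedPoint n :=
  ⟨if (i : ℕ) = 0 then -1 else (i : ℤ), by have := hn.out; have := i.2; split_ifs <;> omega⟩

/-- The upper member of the pair `lo i < hi i` that the `i`-th simple reflection interchanges. -/
def hi (i : Fin n) : SignedPoint n :=
  ⟨if (i : ℕ) = 0 then 2 else (i : ℤ) + 1, by have := hn.out; have := i.2; split_ifs <;> omega⟩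

theorem coe_lo (i : Fin n) : ((lo i : SignedPoint n) : ℤ) = if (i : ℕ) = 0 then -1 else (i : ℤ) :=
  rfl

theorem coe_hi (i : Fin n) :
    ((hi i : SignedPoint n) : ℤ) = if (i : ℕ) = 0 then 2 else (i : ℤ) + 1 := rfl

theorem lo_lt_hi (i : Fin n) : lo i < hi i := by
  rw [← Subtype.coe_lt_coe, coe_lo, coe_hi]
  split_ifs <;> omega

theorem simpleReflection_eq (i : Fin n) :
    simpleReflection n i = Equiv.swap (-hi i) (-lo i) * Equiv.swap (lo i) (hi i) := by
  have h2 := hn.out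
  unfold simpleReflection
  split_ifs with h
  · rw [Equiv.swap_comm (-hi i)]
    rw [show (lo i) = ⟨-1, by omega⟩ from Subtype.ext (by simp [coe_lo, h]),
      show (hi i) = ⟨2, by omega⟩ from Subtype.ext (by simp [coe_hi, h]), Equiv.swap_comm]
    rfl
  · congr 2
    · exact Subtype.ext (by simp [coe_hi, h]; ring)
    · exact Subtype.ext (by simp [coe_lo, h])
    · exact Subtype.ext (by simp [coe_lo, h])
    · exact Subtype.ext (by simp [coe_hi, h])

theorem coe_simpleReflection_apply (i : Fin n) (a : SignedPoint n) :
    ((simpleReflection n i a : SignedPoint n) : ℤ) =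
      if (a : ℤ) = lo i then (hi i : ℤ) else if (a : ℤ) = hi i then (lo i : ℤ)
      else if (a : ℤ) = -lo i then -(hi i : ℤ) else if (a : ℤ) = -hi i then -(lo i : ℤ)
      else (a : ℤ) := by
  have h0 := coe_lo i
  have h1 := coe_hi i
  have e : ∀ x y : SignedPoint n, x = y ↔ (x : ℤ) = y := fun x y => Subtype.ext_iff
  have ha := a.2
  rw [simpleReflection_eq, Equiv.Perm.mul_apply, Equiv.swap_apply_def, Equiv.swap_apply_def]
  simp only [e, apply_ite (fun x : SignedPoint n => (x : ℤ)), coe_neg]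
  split_ifs at * <;> omega

theorem simpleReflection_lo (i : Fin n) : simpleReflection n i (lo i) = hi i :=
  Subtype.ext (by rw [coe_simpleReflection_apply, if_pos rfl])

theorem simpleReflection_hi (i : Fin n) : simpleReflection n i (hi i) = lo i :=
  Subtype.ext (by
    have := lo_lt_hi i
    rw [← Subtype.coe_lt_coe] at this
    rw [coe_simpleReflection_apply, if_neg (by omega), if_pos rfl])

theorem simpleReflection_neg (i : Fin n) (a : SignedPoint n) :
    simpleReflection n i (-a) = -simpleReflection n i a := by
  apply Subtype.ext
  have h0 := coe_lo i
  have h1 := coe_hi i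
  have ha := a.2
  rw [coe_neg, coe_simpleReflection_apply, coe_simpleReflection_apply, coe_neg]
  split_ifs at * <;> omega

theorem simpleReflection_simpleReflection (i : Fin n) (a : SignedPoint n) :
    simpleReflection n i (simpleReflection n i a) = a := by
  apply Subtype.ext
  have h0 := coe_lo i
  have h1 := coe_hi i
  have ha := a.2
  have := coe_simpleReflection_apply i a
  rw [coe_simpleReflection_apply i (simpleReflection n i a)]
  split_ifs at * <;> omega

/-- A simple reflection preserves the order of any two points that are not antipodal, except for
those that it interchanges. -/
theorem simpleReflection_lt (i : Fin n) {a b : SignedPoint n} (hab : a < b) (hne : b ≠ -a)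
    (h1 : ¬ (a = lo i ∧ b = hi i)) (h2 : ¬ (a = -hi i ∧ b = -lo i)) :
    simpleReflection n i a < simpleReflection n i b := by
  have h3 := coe_lo i
  have h4 := coe_hi i
  have ha := a.2
  have hb := b.2
  have e : ∀ x y : SignedPoint n, x = y ↔ (x : ℤ) = y := fun x y => Subtype.ext_iff
  rw [← Subtype.coe_lt_coe] at hab ⊢
  rw [coe_simpleReflection_apply, coe_simpleReflection_apply]
  simp only [e, Ne, coe_neg] at h1 h2 hne
  split_ifs at * <;> omega

/-- Every order relation between points that are not antipodal follows by transitivity from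
those between `lo i` and `hi i`, and their negatives. -/
theorem rel_of_lt (r : SignedPoint n → SignedPoint n → Prop) (ht : ∀ a b c, r a b → r b c → r a c)
    (h : ∀ i, r (lo i) (hi i)) (h' : ∀ i, r (-hi i) (-lo i)) {a b : SignedPoint n} (hab : a < b)
    (hne : b ≠ -a) : r a b := by
  have h2 := hn.out
  have step : ∀ k : ℕ, ∀ x y : SignedPoint n, 0 < (x : ℤ) → (y : ℤ) = x + k + 1 → r x y := by
    intro k
    induction k with
    | zero =>
      intro x y hx hy
      have hy' := y.2
      have := h ⟨(x : ℤ).toNat, by omega⟩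
      convert this using 1
      · apply Subtype.ext; rw [coe_lo]; simp only; split_ifs <;> omega
      · apply Subtype.ext; rw [coe_hi]; simp only; split_ifs <;> omega
    | succ k ih =>
      intro x y hx hy
      have hy' := y.2
      refine ht x ⟨x + k + 1, by omega⟩ y (ih _ _ hx rfl) ?_
      have := h ⟨((x : ℤ) + k + 1).toNat, by omega⟩
      convert this using 1
      · apply Subtype.ext; rw [coe_lo]; simp only; split_ifs <;> omega
      · apply Subtype.ext; rw [coe_hi]; simp only; push_cast at hy; split_ifs <;> omega
  have step' : ∀ k : ℕ, ∀ x y : SignedPoint n, (y : ℤ) < 0 → (y : ℤ) = x + k + 1 → r x y := by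
    intro k
    induction k with
    | zero =>
      intro x y hx hy
      have hy' := x.2
      have := h' ⟨(-(y : ℤ)).toNat, by omega⟩
      convert this using 1
      · apply Subtype.ext; rw [coe_neg, coe_hi]; simp only; split_ifs <;> omega
      · apply Subtype.ext; rw [coe_neg, coe_lo]; simp only; split_ifs <;> omega
    | succ k ih =>
      intro x y hx hy
      have hy' := x.2
      push_cast at hy
      refine ht x ⟨y - 1, by have := y.2; omega⟩ y (ih _ _ (by simp only; omega)
        (by simp only; omega)) ?_
      have := h' ⟨(-(y : ℤ)).toNat, by omega⟩
      convert this using 1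
      · apply Subtype.ext; rw [coe_neg, coe_hi]; simp only; split_ifs <;> omega
      · apply Subtype.ext; rw [coe_neg, coe_lo]; simp only; split_ifs <;> omega
  have pos : ∀ x y : SignedPoint n, 0 < (x : ℤ) → x < y → r x y := by
    intro x y hx hxy
    rw [← Subtype.coe_lt_coe] at hxy
    exact step ((y : ℤ) - x - 1).toNat x y hx (by omega)
  have neg : ∀ x y : SignedPoint n, (y : ℤ) < 0 → x < y → r x y := by
    intro x y hx hxy
    rw [← Subtype.coe_lt_coe] at hxy
    exact step' ((y : ℤ) - x - 1).toNat x y hx (by omega)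
  -- Only the pairs of index 0 lead from negative to positive points: -1 < 2 and its mirror image -2
  -- < 1. No chain joins -1 to 1, which is why antipodal points are excluded.
  have hz : ∀ x y : SignedPoint n, (x : ℤ) = -1 → (y : ℤ) = 2 → r x y := by
    intro x y hx hy
    have := h ⟨0, by omega⟩
    convert this using 1
    · exact Subtype.ext (by rw [coe_lo]; simp [hx])
    · exact Subtype.ext (by rw [coe_hi]; simp [hy])
  have hz' : ∀ x y : SignedPoint n, (x : ℤ) = -2 → (y : ℤ) = 1 → r x y := by
    intro x y hx hy
    have := h' ⟨0, by omega⟩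
    convert this using 1
    · exact Subtype.ext (by rw [coe_neg, coe_hi]; simp [hx])
    · exact Subtype.ext (by rw [coe_neg, coe_lo]; simp [hy])
  have ha := a.2
  have hb := b.2
  rw [Ne, Subtype.ext_iff, coe_neg] at hne
  have hab' := hab
  rw [← Subtype.coe_lt_coe] at hab'
  by_cases h3 : 0 < (a : ℤ)
  · exact pos a b h3 hab
  by_cases h4 : (b : ℤ) < 0
  · exact neg a b h4 hab
  by_cases h5 : (b : ℤ) = 1
  · have h6 : r ⟨-2, by omega⟩ b := hz' _ _ rfl h5
    by_cases h7 : (a : ℤ) = -2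
    · exact hz' a b h7 h5
    · exact ht _ _ _ (neg a ⟨-2, by omega⟩ (by simp only; omega)
        (by rw [← Subtype.coe_lt_coe]; simp only; omega)) h6
  · have h6 : r ⟨-1, by omega⟩ b := by
      by_cases h7 : (b : ℤ) = 2
      · exact hz _ b rfl h7
      · exact ht _ ⟨2, by omega⟩ _ (hz _ _ rfl rfl) (pos ⟨2, by omega⟩ b (by simp)
          (by rw [← Subtype.coe_lt_coe]; simp only; omega))
    by_cases h7 : (a : ℤ) = -1
    · rwa [show a = ⟨-1, by omega⟩ from Subtype.ext h7]
    · exact ht _ _ _ (neg a ⟨-1, by omega⟩ (by simp only; omega)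
        (by rw [← Subtype.coe_lt_coe]; simp only; omega)) h6

end Simple

/-! ### Odd vectors, inversions and the product sign -/

section Vectors

variable {n : ℕ}

/-- A vector of `ℤ ^ n`, seen as an odd function on the signed points. -/
def IsOdd (v : SignedPoint n → ℤ) : Prop := ∀ a, v (-a) = -v a

/-- The pairs `a < b` of points that are not antipodal. Each positive root gives two of them. -/
noncomputable def rootPairs (n : ℕ) : Finset (SignedPoint n × SignedPoint n) :=
  Finset.univ.filter fun e => e.1 < e.2 ∧ e.2 ≠ -e.1

theorem mem_rootPairs {e : SignedPoint n × SignedPoint n} :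
    e ∈ rootPairs n ↔ e.1 < e.2 ∧ e.2 ≠ -e.1 := by
  simp [rootPairs]

/-- The number of pairs whose order a vector reverses. -/
noncomputable def invCount (v : SignedPoint n → ℤ) : ℕ :=
  ((rootPairs n).filter fun e => v e.2 < v e.1).card

/-- The vector of images of the points under a permutation. -/
def permVector (w : Equiv.Perm (SignedPoint n)) : SignedPoint n → ℤ := fun a => (w a : ℤ)

theorem isOdd_permVector {w : Equiv.Perm (SignedPoint n)} (hw : ∀ a, w (-a) = -w a) :
    IsOdd (permVector w) := fun a => by simp [permVector, hw]

/-- The product of the signs of the coordinates. -/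
noncomputable def posSign (v : SignedPoint n → ℤ) : ℤ :=
  ∏ a ∈ Finset.univ.filter (fun a : SignedPoint n => 0 < (a : ℤ)), Int.sign (v a)

/-- Reindexing by the absolute value of `w a` splits off the sign of `w a` in each factor. Together
with `posSign_coxeter` this makes the product sign an invariant of orbits, the one that
distinguishes type D from type B. -/
theorem posSign_comp {v : SignedPoint n → ℤ} (hv : IsOdd v) {w : Equiv.Perm (SignedPoint n)}
    (hw : ∀ a, w (-a) = -w a) : posSign (v ∘ w) = posSign (permVector w) * posSign v := by
  have hw' : ∀ a, w.symm (-a) = -w.symm a := fun a => by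
    rw [Equiv.symm_apply_eq, hw, Equiv.apply_symm_apply]
  have e : posSign v = ∏ a ∈ Finset.univ.filter (fun a : SignedPoint n => 0 < (a : ℤ)),
      Int.sign (v (if 0 < ((w a : SignedPoint n) : ℤ) then w a else -w a)) := by
    unfold posSign
    refine Finset.prod_nbij'
      (fun b => if 0 < ((w.symm b : SignedPoint n) : ℤ) then w.symm b else -w.symm b)
      (fun a => if 0 < ((w a : SignedPoint n) : ℤ) then w a else -w a) ?_ ?_ ?_ ?_ ?_
    · intro a _
      have := (w.symm a).2
      rw [Finset.mem_filter]
      refine ⟨Finset.mem_univ _, ?_⟩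
      split_ifs
      · assumption
      · rw [coe_neg]; omega
    · intro a _
      have := (w a).2
      rw [Finset.mem_filter]
      refine ⟨Finset.mem_univ _, ?_⟩
      split_ifs
      · assumption
      · rw [coe_neg]; omega
    · intro a ha
      have ha := (Finset.mem_filter.mp ha).2
      by_cases h1 : 0 < ((w.symm a : SignedPoint n) : ℤ) <;> simp [h1, ha, hw, ha.le]
    · intro a ha
      have ha := (Finset.mem_filter.mp ha).2
      by_cases h1 : 0 < ((w a : SignedPoint n) : ℤ) <;> simp [h1, ha, hw', not_lt.mpr ha.le]
    · intro a ha
      have ha := (Finset.mem_filter.mp ha).2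
      by_cases h1 : 0 < ((w.symm a : SignedPoint n) : ℤ) <;> simp [h1, ha, hw, not_lt.mpr ha.le]
  rw [e]
  unfold posSign
  rw [← Finset.prod_mul_distrib]
  refine Finset.prod_congr rfl fun a _ => ?_
  simp only [Function.comp, permVector]
  have := (w a).2
  split_ifs with h
  · rw [Int.sign_eq_one_of_pos h, one_mul]
  · rw [Int.sign_eq_neg_one_of_neg (show ((w a : SignedPoint n) : ℤ) < 0 by omega), hv,
      Int.sign_neg]
    ring

variable [hn : Fact (2 ≤ n)]

theorem neg_hi_lt_neg_lo (i : Fin n) : -hi i < -lo i := by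
  have := lo_lt_hi i
  rw [← Subtype.coe_lt_coe] at this ⊢
  simp only [coe_neg]
  omega

theorem hi_ne_neg_lo (i : Fin n) : hi i ≠ -lo i := by
  rw [Ne, Subtype.ext_iff, coe_neg, coe_lo, coe_hi]
  split_ifs <;> omega

/-- The reflection permutes all root pairs except its own two, so only these can matter. By oddness
they are inverted together, whence the steps of 2; a tie changes nothing. -/
theorem invCount_comp_simpleReflection {v : SignedPoint n → ℤ} (hv : IsOdd v) (i : Fin n) :
    invCount (v ∘ simpleReflection n i) + (if v (hi i) < v (lo i) then 2 else 0) =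
      invCount v + (if v (lo i) < v (hi i) then 2 else 0) := by
  have h0 := lo_lt_hi i
  have h0' := h0
  rw [← Subtype.coe_lt_coe] at h0'
  set S := rootPairs n \ {(lo i, hi i), (-hi i, -lo i)} with hS
  have hne : (lo i, hi i) ≠ (-hi i, -lo i) := by
    intro h
    have := hi_ne_neg_lo i
    exact this (Prod.ext_iff.mp h).2
  have hsub : ({(lo i, hi i), (-hi i, -lo i)} : Finset _) ⊆ rootPairs n := by
    intro e he
    simp only [Finset.mem_insert, Finset.mem_singleton] at he
    rw [mem_rootPairs]
    rcases he with rfl | rfl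
    · exact ⟨h0, hi_ne_neg_lo i⟩
    · refine ⟨neg_hi_lt_neg_lo i, ?_⟩
      simp only [neg_neg]
      exact (hi_ne_neg_lo i).symm
  have key : ∀ u : SignedPoint n → ℤ, invCount u =
      (∑ e ∈ S, if u e.2 < u e.1 then 1 else 0) +
        ((if u (hi i) < u (lo i) then 1 else 0) + (if u (-lo i) < u (-hi i) then 1 else 0)) := by
    intro u
    rw [invCount, Finset.card_filter, ← Finset.sum_sdiff hsub, Finset.sum_pair hne]
  have hmem : ∀ e ∈ S, (simpleReflection n i e.1, simpleReflection n i e.2) ∈ S := by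
    intro e he
    simp only [hS, Finset.mem_sdiff, mem_rootPairs, Finset.mem_insert, Finset.mem_singleton,
      not_or, Prod.ext_iff] at he ⊢
    obtain ⟨⟨h1, h2⟩, h3, h4⟩ := he
    refine ⟨⟨simpleReflection_lt i h1 h2 h3 h4, ?_⟩, ?_, ?_⟩
    · rw [← simpleReflection_neg]
      exact fun h => h2 ((simpleReflection n i).injective h)
    · rintro ⟨h5, h6⟩
      rw [← simpleReflection_hi] at h5
      rw [← simpleReflection_lo] at h6
      have h5 := (simpleReflection n i).injective h5
      have h6 := (simpleReflection n i).injective h6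
      rw [h5, h6] at h1
      exact lt_asymm h0 h1
    · rintro ⟨h5, h6⟩
      rw [← simpleReflection_lo, ← simpleReflection_neg] at h5
      rw [← simpleReflection_hi, ← simpleReflection_neg] at h6
      have h5 := (simpleReflection n i).injective h5
      have h6 := (simpleReflection n i).injective h6
      rw [h5, h6] at h1
      exact lt_asymm (neg_hi_lt_neg_lo i) h1
  have hsum : (∑ e ∈ S, if (v ∘ simpleReflection n i) e.2 < (v ∘ simpleReflection n i) e.1
      then 1 else 0) = ∑ e ∈ S, if v e.2 < v e.1 then 1 else 0 := by
    refine Finset.sum_nbij' (fun e => (simpleReflection n i e.1, simpleReflection n i e.2))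
      (fun e => (simpleReflection n i e.1, simpleReflection n i e.2)) hmem hmem ?_ ?_ ?_
    · intro e _; simp [simpleReflection_simpleReflection]
    · intro e _; simp [simpleReflection_simpleReflection]
    · intro e _; rfl
  rw [key v, key, hsum]
  simp only [Function.comp, simpleReflection_neg, simpleReflection_lo, simpleReflection_hi, hv _]
  split_ifs <;> omega

/-- The generator of index 0 makes exactly two positive points negative, namely 1 and 2; the others
make none negative. -/
theorem posSign_simpleReflection (i : Fin n) : posSign (permVector (simpleReflection n i)) = 1 := by
  have h2 := hn.out
  unfold posSign permVector
  have e : ∀ a ∈ Finset.univ.filter fun a : SignedPoint n => 0 < (a : ℤ),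
      Int.sign ((simpleReflection n i a : SignedPoint n) : ℤ) =
        if (i : ℕ) = 0 ∧ (a : ℤ) ≤ 2 then -1 else 1 := by
    intro a ha
    simp only [Finset.mem_filter, Finset.mem_univ, true_and] at ha
    rw [coe_simpleReflection_apply, coe_lo, coe_hi]
    by_cases hi : (i : ℕ) = 0
    · simp only [hi, if_true, true_and]
      by_cases h1 : (a : ℤ) = 1
      · simp [h1]
      · by_cases h3 : (a : ℤ) = 2
        · simp [h3]
        · rw [if_neg (by omega), if_neg (by omega), if_neg (by omega), if_neg (by omega),
            if_neg (by omega), Int.sign_eq_one_of_pos ha]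
    · simp only [hi, if_false, false_and]
      apply Int.sign_eq_one_of_pos
      split_ifs <;> omega
  rw [Finset.prod_congr rfl e, Finset.prod_ite, Finset.prod_const, Finset.prod_const_one, mul_one]
  by_cases hi : (i : ℕ) = 0
  · have : ((Finset.univ.filter fun a : SignedPoint n => 0 < (a : ℤ)).filter
        fun a : SignedPoint n => (i : ℕ) = 0 ∧ (a : ℤ) ≤ 2) =
        {(⟨1, by omega⟩ : SignedPoint n), (⟨2, by omega⟩ : SignedPoint n)} := by
      ext a
      simp only [Finset.mem_filter, Finset.mem_univ, true_and, hi, Finset.mem_insert,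
        Finset.mem_singleton, Subtype.ext_iff]
      omega
    rw [this, Finset.card_pair (by simp [Subtype.ext_iff])]
    norm_num
  · simp [hi]

end Vectors

/-! ### Dominant vectors, orbits and the length function -/

section Group

variable {n : ℕ} [hn : Fact (2 ≤ n)]

theorem exists_word (w : coxeterGroup n) : ∃ l : List (Fin n), (l.map (gen n)).prod = w := by
  obtain ⟨w, hw⟩ := w
  induction hw using Subgroup.closure_induction with
  | mem x hx =>
    obtain ⟨i, rfl⟩ := hx
    exact ⟨[i], by simp [gen]⟩
  | one => exact ⟨[], rfl⟩
  | mul x y hx hy h1 h2 =>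
    obtain ⟨l, hl⟩ := h1
    obtain ⟨m, hm⟩ := h2
    exact ⟨l ++ m, by rw [List.map_append, List.prod_append, hl, hm]; rfl⟩
  | inv x hx h1 =>
    obtain ⟨l, hl⟩ := h1
    have hg : ∀ i : Fin n, (gen n i)⁻¹ = gen n i := fun i => by
      rw [inv_eq_iff_mul_eq_one]
      exact Subtype.ext (Equiv.ext fun a => simpleReflection_simpleReflection i a)
    refine ⟨l.reverse, ?_⟩
    have : (l.map (gen n)).map (fun x => x⁻¹) = l.map (gen n) := by
      rw [List.map_map]
      exact List.map_congr_left fun i _ => hg i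
    rw [show (⟨x⁻¹, _⟩ : coxeterGroup n) = (⟨x, hx⟩ : coxeterGroup n)⁻¹ from rfl, ← hl,
      List.prod_inv_reverse, this, List.map_reverse]

/-- Induction along words in the generators. -/
theorem coxeter_induction {q : coxeterGroup n → Prop} (h1 : q 1)
    (h2 : ∀ w i, q w → q (w * gen n i)) (w : coxeterGroup n) : q w := by
  obtain ⟨l, rfl⟩ := exists_word w
  induction l using List.reverseRecOn with
  | nil => exact h1
  | append_singleton l i ih => simpa using h2 _ i ih

theorem apply_neg (w : coxeterGroup n) (a : SignedPoint n) : w.1 (-a) = -w.1 a := by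
  revert a
  induction w using coxeter_induction with
  | h1 => intro a; rfl
  | h2 w i ih =>
    intro a
    change w.1 (simpleReflection n i (-a)) = -w.1 (simpleReflection n i a)
    rw [simpleReflection_neg, ih]

theorem IsOdd.comp {v : SignedPoint n → ℤ} (hv : IsOdd v) (w : coxeterGroup n) :
    IsOdd (v ∘ w.1) := fun a => by simp [apply_neg, hv _]

theorem isOdd_coxeter (w : coxeterGroup n) : IsOdd (permVector w.1) :=
  isOdd_permVector (apply_neg w)

theorem posSign_coxeter (w : coxeterGroup n) : posSign (permVector w.1) = 1 := by
  induction w using coxeter_induction with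
  | h1 =>
    refine Finset.prod_eq_one fun a ha => ?_
    simp only [Finset.mem_filter, Finset.mem_univ, true_and] at ha
    exact Int.sign_eq_one_of_pos ha
  | h2 w i ih =>
    change posSign (permVector w.1 ∘ simpleReflection n i) = 1
    rw [posSign_comp (isOdd_coxeter w) (simpleReflection_neg i), posSign_simpleReflection, ih,
      one_mul]

/-- A vector in the fundamental chamber. -/
def IsDominant (v : SignedPoint n → ℤ) : Prop := ∀ i, v (lo i) ≤ v (hi i)

theorem IsDominant.le {v : SignedPoint n → ℤ} (hd : IsDominant v) (hv : IsOdd v)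
    {a b : SignedPoint n} (hab : a < b) (hne : b ≠ -a) : v a ≤ v b :=
  rel_of_lt (fun x y => v x ≤ v y) (fun _ _ _ => le_trans) hd
    (fun i => by rw [hv, hv]; exact neg_le_neg (hd i)) hab hne

/-- A member of the orbit with the fewest inversions is dominant, since any descent could be removed
by its simple reflection. -/
theorem exists_dominant {v : SignedPoint n → ℤ} (hv : IsOdd v) :
    ∃ w : coxeterGroup n, IsDominant (v ∘ w.1) := by
  obtain ⟨w, hw⟩ := Finite.exists_min fun w : coxeterGroup n => invCount (v ∘ w.1)
  refine ⟨w, fun i => ?_⟩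
  by_contra h
  push Not at h
  have h1 := invCount_comp_simpleReflection (hv.comp w) i
  have h2 : invCount (v ∘ w.1) ≤ invCount ((v ∘ w.1) ∘ simpleReflection n i) := hw (w * gen n i)
  rw [if_pos h, if_neg (not_lt.mpr h.le)] at h1
  omega

theorem IsDominant.abs_le {v : SignedPoint n → ℤ} (hd : IsDominant v) (hv : IsOdd v)
    {a b : SignedPoint n} (ha : 0 < (a : ℤ)) (hab : a < b) : |v a| ≤ v b := by
  have hab' := hab
  rw [← Subtype.coe_lt_coe] at hab'
  rw [abs_le', ← hv]
  refine ⟨hd.le hv hab fun h => ?_, hd.le hv ?_ fun h => ?_⟩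
  · rw [Subtype.ext_iff, coe_neg] at h
    omega
  · rw [← Subtype.coe_lt_coe, coe_neg]
    omega
  · rw [neg_neg] at h
    exact hab.ne' h

theorem card_filter_abs {v : SignedPoint n → ℤ} (hv : IsOdd v) (q : ℤ → Prop) [DecidablePred q] :
    (Finset.univ.filter fun a : SignedPoint n => q |v a|).card =
      2 * (Finset.univ.filter fun a : SignedPoint n => 0 < (a : ℤ) ∧ q |v a|).card := by
  have e : (Finset.univ.filter fun a : SignedPoint n => q |v a|) =
      (Finset.univ.filter fun a : SignedPoint n => 0 < (a : ℤ) ∧ q |v a|) ∪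
        (Finset.univ.filter fun a : SignedPoint n => (a : ℤ) < 0 ∧ q |v a|) := by
    ext a
    have := a.2
    simp only [Finset.mem_union, Finset.mem_filter, Finset.mem_univ, true_and]
    constructor
    · intro h
      rcases lt_or_gt_of_ne a.2.1 with h' | h'
      · exact Or.inr ⟨h', h⟩
      · exact Or.inl ⟨h', h⟩
    · rintro (h | h) <;> exact h.2
  rw [e, Finset.card_union_of_disjoint, two_mul]
  · congr 1
    refine Finset.card_nbij' (fun a => -a) (fun a => -a) ?_ ?_ ?_ ?_
    · intro a ha
      simp only [Finset.coe_filter, Finset.mem_univ, true_and, Set.mem_ofPred_eq] at ha ⊢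
      rw [coe_neg, hv, abs_neg]
      exact ⟨by omega, ha.2⟩
    · intro a ha
      simp only [Finset.coe_filter, Finset.mem_univ, true_and, Set.mem_ofPred_eq] at ha ⊢
      rw [coe_neg, hv, abs_neg]
      exact ⟨by omega, ha.2⟩
    · intro a _; simp
    · intro a _; simp
  · rw [Finset.disjoint_left]
    intro a ha hb
    simp only [Finset.mem_filter, Finset.mem_univ, true_and] at ha hb
    omega

/-- Dominant vectors are determined by the multiset of their absolute values and the sign of the
product of their coordinates. -/
theorem IsDominant.eq {u v : SignedPoint n → ℤ} (hu : IsOdd u) (hv : IsOdd v) (du : IsDominant u)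
    (dv : IsDominant v) (h : ∃ π : Equiv.Perm (SignedPoint n), u = v ∘ π)
    (hs : posSign u = posSign v) : u = v := by
  classical
  have h2 := hn.out
  obtain ⟨π, hπ⟩ := h
  -- On the positive points `|x|` is increasing, so its superlevel sets are upper sets of a chain.
  -- Such sets are nested, hence equal once they have the same cardinality.
  have upper : ∀ x : SignedPoint n → ℤ, IsOdd x → IsDominant x → ∀ t : ℤ,
      IsUpperSet {a : SignedPoint n | 0 < (a : ℤ) ∧ t ≤ |x a|} := by
    intro x hx dx t a b hab ha
    rcases hab.eq_or_lt with rfl | hab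
    · exact ha
    · have hab' := hab
      rw [← Subtype.coe_lt_coe] at hab'
      exact ⟨ha.1.trans hab', ha.2.trans ((dx.abs_le hx ha.1 hab).trans (le_abs_self _))⟩
  have habs : ∀ a : SignedPoint n, 0 < (a : ℤ) → |u a| = |v a| := by
    have hcard : ∀ t : ℤ, (Finset.univ.filter fun a : SignedPoint n => 0 < (a : ℤ) ∧ t ≤ |u a|).card
        = (Finset.univ.filter fun a : SignedPoint n => 0 < (a : ℤ) ∧ t ≤ |v a|).card := by
      intro t
      have h1 := card_filter_abs hu (fun z => t ≤ z)
      have h3 := card_filter_abs hv (fun z => t ≤ z)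
      have h4 : (Finset.univ.filter fun a : SignedPoint n => t ≤ |u a|).card =
          (Finset.univ.filter fun a : SignedPoint n => t ≤ |v a|).card := by
        refine Finset.card_equiv π fun a => ?_
        simp [hπ]
      omega
    have hset : ∀ t : ℤ, (Finset.univ.filter fun a : SignedPoint n => 0 < (a : ℤ) ∧ t ≤ |u a|) =
        Finset.univ.filter fun a : SignedPoint n => 0 < (a : ℤ) ∧ t ≤ |v a| := by
      intro t
      rcases (upper u hu du t).total (upper v hv dv t) with h | h
      · refine Finset.eq_of_subset_of_card_le (fun a ha => ?_) (hcard t).ge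
        simpa using h (by simpa using ha)
      · refine (Finset.eq_of_subset_of_card_le (fun a ha => ?_) (hcard t).le).symm
        simpa using h (by simpa using ha)
    intro a ha
    have h3 := fun t => congrArg (a ∈ ·) (hset t)
    simp only [Finset.mem_filter, Finset.mem_univ, true_and, ha, eq_iff_iff] at h3
    exact le_antisymm ((h3 _).mp le_rfl) ((h3 _).mpr le_rfl)
  have hpos : ∀ a : SignedPoint n, 0 < (a : ℤ) → u a = v a := by
    have hone : ∀ a : SignedPoint n, 0 < (a : ℤ) → (a : ℤ) ≠ 1 →
        (⟨1, by omega⟩ : SignedPoint n) < a := by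
      intro a ha h1
      rw [← Subtype.coe_lt_coe]
      simp only
      omega
    intro a ha
    by_cases h1 : (a : ℤ) = 1
    · have ha1 : a = ⟨1, by omega⟩ := Subtype.ext h1
      -- Among the positive points only 1 can carry a negative value of a dominant vector. If that
      -- value is not zero, its sign is the sign of the whole product.
      have hp : ∀ x : SignedPoint n → ℤ, IsOdd x → IsDominant x → x a ≠ 0 →
          posSign x = Int.sign (x a) := by
        intro x hx dx hx0
        unfold posSign
        refine Finset.prod_eq_single a (fun b hb hba => ?_) (fun h => ?_)
        · simp only [Finset.mem_filter, Finset.mem_univ, true_and] at hb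
          apply Int.sign_eq_one_of_pos
          have hb1 : (b : ℤ) ≠ 1 := fun h => hba (by rw [ha1]; exact Subtype.ext h)
          have := dx.abs_le hx ha (b := b) (by rw [ha1]; exact hone b hb hb1)
          exact lt_of_lt_of_le (abs_pos.mpr hx0) this
        · simp [ha] at h
      have h3 := habs a ha
      by_cases hu0 : u a = 0
      · rw [hu0, abs_zero, eq_comm, abs_eq_zero] at h3
        rw [hu0, h3]
      · have hv0 : v a ≠ 0 := by
          rw [← abs_ne_zero, ← h3]
          exact abs_ne_zero.mpr hu0
        rw [hp u hu du hu0, hp v hv dv hv0] at hs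
        rw [← Int.sign_mul_abs (u a), ← Int.sign_mul_abs (v a), hs, h3]
    · have h3 : ∀ x : SignedPoint n → ℤ, IsOdd x → IsDominant x → x a = |x a| := by
        intro x hx dx
        have := dx.abs_le hx (a := ⟨1, by omega⟩) (by simp) (hone a ha h1)
        exact (abs_of_nonneg ((abs_nonneg _).trans this)).symm
      rw [h3 u hu du, h3 v hv dv, habs a ha]
  funext a
  rcases lt_or_gt_of_ne a.2.1 with h' | h'
  · have := hpos (-a) (by rw [coe_neg]; omega)
    rw [hu, hv] at this
    exact neg_injective this
  · exact hpos a h'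

/-- The orbit of a vector. -/
noncomputable def orbit (v : SignedPoint n → ℤ) : Finset (SignedPoint n → ℤ) :=
  open Classical in Finset.univ.image fun w : coxeterGroup n => v ∘ w.1

theorem mem_orbit {v u : SignedPoint n → ℤ} :
    u ∈ orbit v ↔ ∃ w : coxeterGroup n, v ∘ w.1 = u := by
  simp [orbit]

/-- Both vectors can be moved to dominant ones, and these are compared by `IsDominant.eq`.
Membership in an orbit becomes a matter of counting values and of one sign, which is 0 as soon as a
coordinate vanishes. -/
theorem mem_orbit_iff {v u : SignedPoint n → ℤ} (hv : IsOdd v) :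
    u ∈ orbit v ↔
      IsOdd u ∧ (∃ π : Equiv.Perm (SignedPoint n), u = v ∘ π) ∧ posSign u = posSign v := by
  rw [mem_orbit]
  have hs : ∀ {x : SignedPoint n → ℤ} (_ : IsOdd x) (w : coxeterGroup n),
      posSign (x ∘ w.1) = posSign x := by
    intro x hx w
    rw [posSign_comp hx (apply_neg w), posSign_coxeter, one_mul]
  constructor
  · rintro ⟨w, rfl⟩
    exact ⟨hv.comp w, ⟨w.1, rfl⟩, hs hv w⟩
  · rintro ⟨hu, ⟨π, hπ⟩, hsign⟩
    obtain ⟨x, hx⟩ := exists_dominant hv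
    obtain ⟨y, hy⟩ := exists_dominant hu
    have : u ∘ y.1 = v ∘ x.1 := by
      refine IsDominant.eq (hu.comp y) (hv.comp x) hy hx ⟨x.1⁻¹ * π * y.1, ?_⟩ ?_
      · rw [hπ]
        funext a
        simp
      · rw [hs hu, hs hv, hsign]
    refine ⟨x * y⁻¹, ?_⟩
    funext a
    have h := congrFun this (y.1.symm a)
    simp only [Function.comp, Equiv.apply_symm_apply] at h
    exact h.symm

/-- The vector of `w` is dominant and has the values and the product sign of the identity. -/
theorem eq_one_of_lt {w : coxeterGroup n} (h : ∀ i, w.1 (lo i) < w.1 (hi i)) : w = 1 := by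
  have h1 : permVector w.1 = permVector (1 : coxeterGroup n).1 := by
    refine IsDominant.eq (isOdd_coxeter w) (isOdd_coxeter 1) (fun i => (h i).le)
      (fun i => (lo_lt_hi i).le) ⟨w.1, rfl⟩ ?_
    rw [posSign_coxeter, posSign_coxeter]
  exact Subtype.ext (Equiv.ext fun a => Subtype.ext (congrFun h1 a))

theorem invCount_permVector_one : invCount (permVector (1 : coxeterGroup n).1) = 0 := by
  rw [invCount, Finset.card_eq_zero, Finset.filter_eq_empty_iff]
  intro e he
  rw [mem_rootPairs] at he
  exact not_lt.mpr he.1.le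

theorem invCount_mul_gen (w : coxeterGroup n) (i : Fin n) :
    invCount (permVector (w * gen n i).1) + (if w.1 (hi i) < w.1 (lo i) then 2 else 0) =
      invCount (permVector w.1) + (if w.1 (lo i) < w.1 (hi i) then 2 else 0) :=
  invCount_comp_simpleReflection (isOdd_coxeter w) i

theorem exists_word_two_mul_length (w : coxeterGroup n) :
    ∃ l : List (Fin n), (l.map (gen n)).prod = w ∧ 2 * l.length = invCount (permVector w.1) := by
  induction h : invCount (permVector w.1) using Nat.strong_induction_on generalizing w with
  | _ k ih =>
    subst h
    by_cases hw : ∀ i, w.1 (lo i) < w.1 (hi i)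
    · rw [eq_one_of_lt hw]
      exact ⟨[], rfl, invCount_permVector_one.symm⟩
    · push Not at hw
      obtain ⟨i, hi⟩ := hw
      have hlt := lt_of_le_of_ne hi fun h => (lo_lt_hi i).ne' (w.1.injective h)
      have h1 := invCount_mul_gen w i
      rw [if_pos hlt, if_neg (not_lt.mpr hi)] at h1
      obtain ⟨l, hl, hl'⟩ := ih _ (by omega) (w * gen n i) rfl
      refine ⟨l ++ [i], ?_, ?_⟩
      · rw [List.map_append, List.prod_append, hl]
        simp only [List.map_cons, List.map_nil, List.prod_singleton, mul_assoc]
        rw [show gen n i * gen n i = 1 from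
          Subtype.ext (Equiv.ext fun a => simpleReflection_simpleReflection i a), mul_one]
      · rw [List.length_append, List.length_singleton]
        omega

/-- Removing descents one by one yields a word with half as many letters as there are inverted
pairs. No word is shorter, since one letter changes the number of inverted pairs by at most 2. -/
theorem two_mul_length (w : coxeterGroup n) : 2 * length w = invCount (permVector w.1) := by
  obtain ⟨l, hl, hl'⟩ := exists_word_two_mul_length w
  have h1 : ∀ l : List (Fin n), invCount (permVector (l.map (gen n)).prod.1) ≤ 2 * l.length := by
    intro l
    induction l using List.reverseRecOn with
    | nil => exact invCount_permVector_one.le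
    | append_singleton l i ih =>
      have := invCount_mul_gen (l.map (gen n)).prod i
      rw [List.map_append, List.prod_append, List.length_append]
      simp only [List.map_cons, List.map_nil, List.prod_singleton, List.length_singleton]
      split_ifs at this <;> omega
  have h2 : length w ≤ l.length := Nat.sInf_le ⟨l, rfl, hl⟩
  obtain ⟨m, hm, hm'⟩ : length w ∈ {k | ∃ l : List (Fin n), l.length = k ∧ (l.map (gen n)).prod = w} :=
    Nat.sInf_mem ⟨_, l, rfl, hl⟩
  have h3 := h1 m
  rw [hm'] at h3
  omega

end Group

/-! ### Face vectors and minimal coset representatives -/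

section Faces

variable {n : ℕ}

/-- The number of members of `K` below `x`. -/
noncomputable def cutCount (K : Set (Fin n)) (x : ℤ) : ℕ :=
  open Classical in (Finset.univ.filter fun k : Fin n => k ∈ K ∧ (k : ℤ) < x).card

theorem cutCount_succ (K : Set (Fin n)) (i : Fin n) [Decidable (i ∈ K)] :
    cutCount K ((i : ℤ) + 1) = cutCount K i + if i ∈ K then 1 else 0 := by
  classical
  unfold cutCount
  split_ifs with h
  · rw [← Finset.card_insert_of_notMem (a := i) (by simp)]
    congr 1
    ext k
    simp only [Finset.mem_filter, Finset.mem_univ, true_and, Finset.mem_insert]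
    constructor
    · rintro ⟨h1, h2⟩
      by_cases h3 : k = i
      · exact Or.inl h3
      · rw [Fin.ext_iff] at h3
        exact Or.inr ⟨h1, by omega⟩
    · rintro (rfl | ⟨h1, h2⟩)
      · exact ⟨h, by omega⟩
      · exact ⟨h1, by omega⟩
  · rw [add_zero]
    congr 1
    ext k
    simp only [Finset.mem_filter, Finset.mem_univ, true_and]
    constructor
    · rintro ⟨h1, h2⟩
      have h3 : k ≠ i := fun h3 => h (h3 ▸ h1)
      rw [Ne, Fin.ext_iff] at h3
      exact ⟨h1, by omega⟩
    · rintro ⟨h1, h2⟩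
      exact ⟨h1, by omega⟩

theorem cutCount_zero (K : Set (Fin n)) : cutCount K 0 = 0 := by
  classical
  rw [cutCount, Finset.card_eq_zero, Finset.filter_eq_empty_iff]
  intro k _ h
  omega

/-- The coordinate `x` of `faceVector K`. -/
noncomputable def faceCoordinate (K : Set (Fin n)) (x : ℤ) : ℤ :=
  open Classical in
    -- If `s_{1'}` is to fix the vector and `s_1` is not, then the coordinates at 1 and 2 must be
    -- opposite and nonzero. The coordinate at 2 is 1 in this case.
    if x = 1 ∧ (∀ i ∈ K, (i : ℕ) ≠ 0) ∧ ∃ i ∈ K, (i : ℕ) = 1 then -1 else cutCount K x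

/-- A dominant vector that is fixed by exactly those generators whose index is not in `K`. -/
noncomputable def faceVector (K : Set (Fin n)) (a : SignedPoint n) : ℤ :=
  if 0 < (a : ℤ) then faceCoordinate K a else -faceCoordinate K (-(a : ℤ))

theorem faceVector_of_pos (K : Set (Fin n)) {a : SignedPoint n} (ha : 0 < (a : ℤ)) :
    faceVector K a = faceCoordinate K a := if_pos ha

theorem isOdd_faceVector (K : Set (Fin n)) : IsOdd (faceVector K) := by
  intro a
  have := a.2
  unfold faceVector
  rw [coe_neg]
  split_ifs <;> first | omega | simp

variable [hn : Fact (2 ≤ n)]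

/-- `v` is a dominant vector, fixed by exactly the generators with index in `J`. -/
structure IsFaceVector (v : SignedPoint n → ℤ) (J : Set (Fin n)) : Prop where
  odd : IsOdd v
  dominant : IsDominant v
  eq_iff : ∀ i, v (lo i) = v (hi i) ↔ i ∈ J

theorem isFaceVector_faceVector (K : Set (Fin n)) : IsFaceVector (faceVector K) Kᶜ := by
  classical
  have h2 := hn.out
  have key : ∀ i, faceVector K (lo i) ≤ faceVector K (hi i) ∧
      (faceVector K (lo i) = faceVector K (hi i) ↔ i ∉ K) := by
    intro i
    have hhi : 0 < ((hi i : SignedPoint n) : ℤ) := by rw [coe_hi]; split_ifs <;> omega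
    rw [faceVector_of_pos K hhi]
    have hz : ∀ j : Fin n, (j : ℕ) = 0 → j = ⟨0, by omega⟩ := fun j hj => Fin.ext hj
    have ho : ∀ j : Fin n, (j : ℕ) = 1 → j = ⟨1, by omega⟩ := fun j hj => Fin.ext hj
    have c1 : cutCount K 1 = if (⟨0, by omega⟩ : Fin n) ∈ K then 1 else 0 := by
      have := cutCount_succ K ⟨0, by omega⟩
      simpa [cutCount_zero] using this
    have e0 : (∀ i ∈ K, (i : ℕ) ≠ 0) ↔ (⟨0, by omega⟩ : Fin n) ∉ K :=
      ⟨fun h h' => h _ h' rfl, fun h j hj hj0 => h (hz j hj0 ▸ hj)⟩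
    have e1 : (∃ i ∈ K, (i : ℕ) = 1) ↔ (⟨1, by omega⟩ : Fin n) ∈ K :=
      ⟨fun ⟨j, hj, hj0⟩ => ho j hj0 ▸ hj, fun h => ⟨_, h, rfl⟩⟩
    have c2 : cutCount K 2 = cutCount K 1 + if (⟨1, by omega⟩ : Fin n) ∈ K then 1 else 0 := by
      have := cutCount_succ K ⟨1, by omega⟩
      simpa using this
    have f1 : faceCoordinate K 1 = if (⟨0, by omega⟩ : Fin n) ∈ K then 1
        else if (⟨1, by omega⟩ : Fin n) ∈ K then -1 else 0 := by
      simp only [faceCoordinate, e0, e1, c1, true_and]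
      split_ifs <;> simp_all
    have f2 : ∀ x : ℤ, x ≠ 1 → faceCoordinate K x = cutCount K x := fun x hx => by
      simp only [faceCoordinate, hx, false_and, if_false]
    by_cases hi0 : (i : ℕ) = 0
    · have hi' := hz i hi0
      have hl : ((lo i : SignedPoint n) : ℤ) = -1 := by rw [coe_lo, if_pos hi0]
      have hh : ((hi i : SignedPoint n) : ℤ) = 2 := by rw [coe_hi, if_pos hi0]
      rw [faceVector, hl, hh, if_neg (by omega), neg_neg, f1, f2 2 (by omega), c2, c1, hi']
      by_cases h3 : (⟨0, by omega⟩ : Fin n) ∈ K <;> by_cases h4 : (⟨1, by omega⟩ : Fin n) ∈ K <;>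
        simp [h3, h4]
    · have hl : ((lo i : SignedPoint n) : ℤ) = (i : ℤ) := by rw [coe_lo, if_neg hi0]
      have hh : ((hi i : SignedPoint n) : ℤ) = (i : ℤ) + 1 := by rw [coe_hi, if_neg hi0]
      have hlpos : 0 < ((lo i : SignedPoint n) : ℤ) := by omega
      rw [faceVector_of_pos K hlpos, hl, hh]
      by_cases hi1 : (i : ℕ) = 1
      · have hi' := ho i hi1
        rw [hi1, Nat.cast_one, f1, f2 _ (by omega), one_add_one_eq_two, c2, c1, hi']
        by_cases h3 : (⟨0, by omega⟩ : Fin n) ∈ K <;> by_cases h4 : (⟨1, by omega⟩ : Fin n) ∈ K <;>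
          simp [h3, h4]
      · rw [f2 _ (by omega), f2 _ (by omega), cutCount_succ]
        by_cases h : i ∈ K <;> simp [h]
  exact ⟨isOdd_faceVector K, fun i => (key i).1, fun i => (key i).2⟩

namespace IsFaceVector

variable {v : SignedPoint n → ℤ} {J : Set (Fin n)}

theorem exists_vector (J : Set (Fin n)) : ∃ v : SignedPoint n → ℤ, IsFaceVector v J :=
  ⟨faceVector Jᶜ, by simpa using isFaceVector_faceVector Jᶜ⟩

theorem le (hv : IsFaceVector v J) {a b : SignedPoint n} (hab : a < b) (hne : b ≠ -a) :
    v a ≤ v b := hv.dominant.le hv.odd hab hne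

theorem lt_of_lt (hv : IsFaceVector v J) {a b : SignedPoint n} (hab : v a < v b) (hne : b ≠ -a) :
    a < b := by
  by_contra h
  rcases (not_lt.mp h).eq_or_lt with rfl | h
  · exact lt_irrefl _ hab
  · exact absurd (hv.le h fun h => hne (by rw [h, neg_neg])) (not_le.mpr hab)

/-- An element that has no descent in `J` preserves the order of pairs on which `v` is constant. -/
theorem lt_or (hv : IsFaceVector v J) {w : coxeterGroup n}
    (hw : ∀ i ∈ J, w.1 (lo i) < w.1 (hi i)) {a b : SignedPoint n} (hab : a < b) (hne : b ≠ -a) :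
    v a < v b ∨ v a = v b ∧ w.1 a < w.1 b := by
  refine rel_of_lt (fun a b => v a < v b ∨ v a = v b ∧ w.1 a < w.1 b) ?_ ?_ ?_ hab hne
  · rintro a b c (h1 | ⟨h1, h1'⟩) (h2 | ⟨h2, h2'⟩)
    · exact Or.inl (h1.trans h2)
    · exact Or.inl (h2 ▸ h1)
    · exact Or.inl (h1 ▸ h2)
    · exact Or.inr ⟨h1.trans h2, h1'.trans h2'⟩
  · intro i
    rcases (hv.dominant i).lt_or_eq with h | h
    · exact Or.inl h
    · exact Or.inr ⟨h, hw i ((hv.eq_iff i).mp h)⟩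
  · intro i
    simp only [hv.odd _, apply_neg]
    rcases (hv.dominant i).lt_or_eq with h | h
    · exact Or.inl (neg_lt_neg h)
    · refine Or.inr ⟨by rw [h], ?_⟩
      have := hw i ((hv.eq_iff i).mp h)
      rw [← Subtype.coe_lt_coe] at this ⊢
      simp only [coe_neg]
      omega

theorem comp_gen (hv : IsFaceVector v J) {i : Fin n} (hiJ : i ∈ J) :
    v ∘ (gen n i).1 = v := by
  have h := (hv.eq_iff i).mpr hiJ
  funext a
  change v (simpleReflection n i a) = v a
  have e : ∀ x y : SignedPoint n, (x : ℤ) = y → x = y := fun x y => Subtype.ext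
  have ha := coe_simpleReflection_apply i a
  split_ifs at ha with h1 h2 h3 h4
  · rw [e _ _ ha, e _ _ h1, h]
  · rw [e _ _ ha, e _ _ h2, h]
  · rw [e _ (-hi i) ha, e _ (-lo i) h3, hv.odd, hv.odd, h]
  · rw [e _ (-lo i) ha, e _ (-hi i) h4, hv.odd, hv.odd, h]
  · rw [e _ _ ha]

theorem comp_parabolic (hv : IsFaceVector v J) {u : coxeterGroup n} (hu : u ∈ parabolic J) :
    v ∘ u.1 = v := by
  induction hu using Subgroup.closure_induction with
  | mem x hx =>
    obtain ⟨i, hiJ, rfl⟩ := hx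
    exact hv.comp_gen hiJ
  | one => rfl
  | mul x y hx hy h1 h2 =>
    change (v ∘ x.1) ∘ y.1 = v
    rw [h1, h2]
  | inv x hx h1 =>
    funext a
    have h := congrFun h1 (x.1.symm a)
    simp only [Function.comp, Equiv.apply_symm_apply] at h
    exact h.symm

end IsFaceVector

theorem mem_minReps_iff {J : Set (Fin n)} {w : coxeterGroup n} :
    w ∈ minReps J ↔ ∀ i ∈ J, w.1 (lo i) < w.1 (hi i) := by
  constructor
  · intro hw i hiJ
    by_contra h
    have hlt := lt_of_le_of_ne (not_lt.mp h) fun h => (lo_lt_hi i).ne' (w.1.injective h)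
    have h1 := invCount_mul_gen w i
    rw [if_pos hlt, if_neg h, ← two_mul_length, ← two_mul_length] at h1
    have h2 : length w ≤ length (w * gen n i) := hw _ (Subgroup.subset_closure ⟨i, hiJ, rfl⟩)
    omega
  · intro hw u hu
    obtain ⟨v, hv⟩ := IsFaceVector.exists_vector J
    have hu' := hv.comp_parabolic ((parabolic J).inv_mem hu)
    have h : invCount (permVector w.1) ≤ invCount (permVector (w * u).1) := by
      -- On a pair inverted by `w` the face vector `v` increases strictly, by `lt_or`. Since `u⁻¹`
      -- preserves `v`, it keeps the order of such a pair and maps it to a pair inverted by `w * u`.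
      refine Finset.card_le_card_of_injOn (fun e => ((u⁻¹).1 e.1, (u⁻¹).1 e.2)) ?_ ?_
      · intro e he
        simp only [Finset.coe_filter, mem_rootPairs, Set.mem_ofPred_eq] at he ⊢
        obtain ⟨⟨h1, h2⟩, h3⟩ := he
        have h4 : v e.1 < v e.2 := by
          rcases hv.lt_or hw h1 h2 with h4 | ⟨_, h4⟩
          · exact h4
          · exact absurd h3 (not_lt.mpr h4.le)
        have h5 : (u⁻¹).1 e.2 ≠ -(u⁻¹).1 e.1 := by
          rw [← apply_neg]
          exact fun h => h2 ((u⁻¹).1.injective h)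
        refine ⟨⟨hv.lt_of_lt ?_ h5, h5⟩, ?_⟩
        · have e1 := congrFun hu' e.1
          have e2 := congrFun hu' e.2
          simp only [Function.comp] at e1 e2
          rw [e1, e2]
          exact h4
        · have h6 : ∀ a, permVector (w * u).1 ((u⁻¹).1 a) = permVector w.1 a := fun a => by
            simp [permVector]
          rw [h6, h6]
          exact h3
      · intro e _ f _ hef
        simp only [Prod.mk.injEq, EmbeddingLike.apply_eq_iff_eq] at hef
        exact Prod.ext hef.1 hef.2
    rw [← two_mul_length, ← two_mul_length] at h
    omega

namespace IsFaceVector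

variable {v : SignedPoint n → ℤ} {J : Set (Fin n)}

/-- Every member of the orbit comes from a minimal coset representative. -/
theorem exists_minRep (hv : IsFaceVector v J) {u : SignedPoint n → ℤ} (hu : u ∈ orbit v) :
    ∃ w ∈ minReps J, u ∘ w.1 = v := by
  rw [mem_orbit] at hu
  obtain ⟨x, rfl⟩ := hu
  have : Nonempty {w : coxeterGroup n // (v ∘ x.1) ∘ w.1 = v} :=
    ⟨x⁻¹, by funext a; simp⟩
  obtain ⟨⟨w, hw'⟩, hw⟩ := Finite.exists_min
    fun w : {w : coxeterGroup n // (v ∘ x.1) ∘ w.1 = v} => length w.1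
  refine ⟨w, fun u hu => hw ⟨w * u, ?_⟩, hw'⟩
  change ((v ∘ x.1) ∘ w.1) ∘ u.1 = v
  rw [hw', hv.comp_parabolic hu]

/-- If `u ∘ w = v` with a minimal coset representative `w`, then the order that `w` transports
is the lexicographic one for `u`. -/
theorem inv_lt (hv : IsFaceVector v J) {u : SignedPoint n → ℤ} {w : coxeterGroup n}
    (hw : w ∈ minReps J) (hu : u ∘ w.1 = v) {a b : SignedPoint n} (hne : b ≠ -a)
    (hab : u a < u b ∨ u a = u b ∧ a < b) : w.1.symm a < w.1.symm b := by
  rw [mem_minReps_iff] at hw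
  have h1 : ∀ c, v (w.1.symm c) = u c := fun c => by rw [← hu]; simp
  have h2 : w.1.symm b ≠ -w.1.symm a := by
    intro h
    apply hne
    have h3 := congrArg w.1 h
    rwa [apply_neg, Equiv.apply_symm_apply, Equiv.apply_symm_apply] at h3
  by_contra h
  rcases (not_lt.mp h).eq_or_lt with h | h
  · rw [w.1.symm.injective h] at hab
    rcases hab with h | ⟨_, h⟩ <;> exact lt_irrefl _ h
  · have h3 := hv.lt_or hw h fun h => h2 (by rw [h, neg_neg])
    rw [h1, h1, Equiv.apply_symm_apply, Equiv.apply_symm_apply] at h3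
    rcases hab with h4 | ⟨h4, h5⟩ <;> rcases h3 with h6 | ⟨h6, h7⟩
    · exact lt_asymm h4 h6
    · exact h4.ne' h6
    · exact h6.ne' h4
    · exact lt_asymm h5 h7

/-- Both elements transport the same order, the lexicographic one given by `u` and the natural
order. Hence `w⁻¹ * x` increases on every simple pair. -/
theorem minRep_unique (hv : IsFaceVector v J) {u : SignedPoint n → ℤ} {w x : coxeterGroup n}
    (hw : w ∈ minReps J) (hx : x ∈ minReps J) (hwu : u ∘ w.1 = v) (hxu : u ∘ x.1 = v) : w = x := by
  have hx' := mem_minReps_iff.mp hx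
  have : w⁻¹ * x = 1 := by
    refine eq_one_of_lt fun i => ?_
    refine hv.inv_lt hw hwu (a := x.1 (lo i)) (b := x.1 (hi i)) ?_ ?_
    · rw [← apply_neg]
      exact fun h => hi_ne_neg_lo i (x.1.injective h)
    · have h1 := hv.lt_or hx' (lo_lt_hi i) (hi_ne_neg_lo i)
      rwa [← hxu] at h1
  exact inv_mul_eq_one.mp this

end IsFaceVector

end Faces

/-! ### Solomon's product rule -/

section Solomon

variable {n : ℕ} [hn : Fact (2 ≤ n)]

/-- **Solomon's theorem** for `D_n`: the product of two coset sums is a sum of coset sums. -/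
theorem repSum_mul_repSum {v : SignedPoint n → ℤ} {K : Set (Fin n)} (hv : IsFaceVector v K)
    (J : Set (Fin n)) [DecidablePred fun u : SignedPoint n → ℤ => ∀ i ∈ J, u (lo i) ≤ u (hi i)] :
    repSum K * repSum J = ∑ u ∈ (orbit v).filter (fun u => ∀ i ∈ J, u (lo i) ≤ u (hi i)),
      repSum {i | i ∈ J ∧ u (lo i) = u (hi i)} := by
  classical
  unfold repSum
  rw [Finset.sum_mul_sum, ← Finset.sum_product', Finset.sum_sigma']
  simp only [← map_mul]
  have hmem : ∀ (J : Set (Fin n)) (w : coxeterGroup n),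
      w ∈ (Set.toFinite (minReps J)).toFinset ↔ w ∈ minReps J := fun J w => Set.Finite.mem_toFinset _
  -- In the other direction, `u` and `y` determine the first factor `x` as the minimal
  -- representative with `(u ∘ y⁻¹) ∘ x = v`, and the second factor is then `x⁻¹ * y`.
  refine Finset.sum_bij (fun x _ => ⟨v ∘ x.2.1, x.1 * x.2⟩) ?_ ?_ ?_ ?_
  · rintro ⟨x, w⟩ hxw
    rw [Finset.mem_product, hmem, hmem] at hxw
    obtain ⟨hx, hw⟩ := hxw
    rw [mem_minReps_iff] at hx hw
    simp only [Finset.mem_sigma, Finset.mem_filter, hmem]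
    have hne : ∀ i, w.1 (hi i) ≠ -w.1 (lo i) := fun i h => by
      rw [← apply_neg] at h
      exact hi_ne_neg_lo i (w.1.injective h)
    refine ⟨⟨mem_orbit.mpr ⟨w, rfl⟩, fun i hiJ => hv.le (hw i hiJ) (hne i)⟩, ?_⟩
    rw [mem_minReps_iff]
    rintro i ⟨hiJ, hi'⟩
    rcases hv.lt_or hx (hw i hiJ) (hne i) with h | h
    · exact absurd hi' h.ne
    · exact h.2
  · rintro ⟨x, w⟩ hxw ⟨x', w'⟩ hxw' h
    rw [Finset.mem_product, hmem, hmem] at hxw hxw'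
    simp only [Sigma.mk.injEq] at h
    obtain ⟨h1, h2⟩ := h
    have h2 : x * w = x' * w' := eq_of_heq h2
    have hxx : x = x' := by
      refine hv.minRep_unique (u := (v ∘ w.1) ∘ ((x * w)⁻¹).1) hxw.1 hxw'.1 ?_ ?_
      · funext a
        simp
      · rw [h1, h2]
        funext a
        simp
    subst hxx
    rw [mul_right_injective x h2]
  · rintro ⟨u, y⟩ huy
    simp only [Finset.mem_sigma, Finset.mem_filter, hmem] at huy
    obtain ⟨⟨hu, hle⟩, hy⟩ := huy
    rw [mem_minReps_iff] at hy
    obtain ⟨z, rfl⟩ := mem_orbit.mp hu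
    obtain ⟨x, hx, hxu⟩ := hv.exists_minRep (u := (v ∘ z.1) ∘ (y⁻¹).1)
      (mem_orbit.mpr ⟨z * y⁻¹, rfl⟩)
    refine ⟨(x, x⁻¹ * y), ?_, ?_⟩
    · rw [Finset.mem_product, hmem, hmem]
      refine ⟨hx, mem_minReps_iff.mpr fun i hiJ => ?_⟩
      refine hv.inv_lt hx hxu (a := y.1 (lo i)) (b := y.1 (hi i)) ?_ ?_
      · rw [← apply_neg]
        exact fun h => hi_ne_neg_lo i (y.1.injective h)
      · have h1 : ∀ a, ((v ∘ z.1) ∘ (y⁻¹).1) (y.1 a) = (v ∘ z.1) a := fun a => by simp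
        rw [h1, h1]
        rcases (hle i hiJ).lt_or_eq with h | h
        · exact Or.inl h
        · exact Or.inr ⟨h, hy i ⟨hiJ, h⟩⟩
    · have h1 : v ∘ (x⁻¹ * y).1 = v ∘ z.1 := by
        funext a
        have h2 := congrFun hxu ((x⁻¹ * y).1 a)
        simpa using h2.symm
      simp only [Sigma.mk.injEq]
      exact ⟨h1, by rw [mul_inv_cancel_left]⟩
  · intro x _
    rfl

end Solomon

/-! ### Rings with triangular left multiplication, and their radical -/

section Triangular

variable {R ι : Type*} [Ring R] [PartialOrder ι] (b : Module.Basis ι ℤ R)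

/-- Left multiplications are triangular with respect to the basis `b`. -/
def IsTriangular : Prop := ∀ i j, b i * b j ∈ Submodule.span ℤ (b '' Set.Iic j)

variable {b}

theorem repr_eq_zero_of_mem_span {j : ι} {u : R} (hu : u ∈ Submodule.span ℤ (b '' Set.Iio j)) :
    b.repr u j = 0 := by
  rw [Module.Basis.mem_span_image] at hu
  by_contra h
  exact lt_irrefl j (hu (Finsupp.mem_support_iff.mpr h))

theorem IsTriangular.mul_mem (hb : IsTriangular b) (x : R) (j : ι) :
    x * b j ∈ Submodule.span ℤ (b '' Set.Iic j) := by
  have hx := b.mem_span x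
  induction hx using Submodule.span_induction with
  | mem x hx =>
    obtain ⟨i, rfl⟩ := hx
    exact hb i j
  | zero => rw [zero_mul]; exact zero_mem _
  | add x y _ _ h1 h2 => rw [add_mul]; exact add_mem h1 h2
  | smul a x _ h => rw [smul_mul_assoc]; exact Submodule.smul_mem _ _ h

theorem IsTriangular.mul_mem_Iio (hb : IsTriangular b) (x : R) {j : ι} {u : R}
    (hu : u ∈ Submodule.span ℤ (b '' Set.Iio j)) : x * u ∈ Submodule.span ℤ (b '' Set.Iio j) := by
  induction hu using Submodule.span_induction with
  | mem u hu =>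
    obtain ⟨i, hi, rfl⟩ := hu
    exact Submodule.span_mono (Set.image_mono (Set.Iic_subset_Iio.mpr hi)) (hb.mul_mem x i)
  | zero => rw [mul_zero]; exact zero_mem _
  | add x y _ _ h1 h2 => rw [mul_add]; exact add_mem h1 h2
  | smul a x _ h => rw [mul_smul_comm]; exact Submodule.smul_mem _ _ h

theorem IsTriangular.mul_sub_mem (hb : IsTriangular b) (x : R) (j : ι) :
    x * b j - b.repr (x * b j) j • b j ∈ Submodule.span ℤ (b '' Set.Iio j) := by
  have h := hb.mul_mem x j
  rw [← Set.Iio_insert, Set.image_insert_eq, Submodule.mem_span_insert] at h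
  obtain ⟨a, z, hz, h⟩ := h
  have : b.repr (x * b j) j = a := by
    rw [h, map_add, map_smul, Finsupp.add_apply, repr_eq_zero_of_mem_span hz]
    simp
  rwa [this, h, add_sub_cancel_left]

/-- The diagonal entries of left multiplications form ring homomorphisms. -/
noncomputable def IsTriangular.diagonal (hb : IsTriangular b) (j : ι) : R →+* ℤ where
  toFun x := b.repr (x * b j) j
  map_one' := by simp
  map_zero' := by simp
  map_add' x y := by simp [add_mul]
  -- Modulo the span of the lower basis elements, `b j` is an eigenvector of every left
  -- multiplication, so the eigenvalues multiply.
  map_mul' x y := by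
    have h := hb.mul_mem_Iio x (hb.mul_sub_mem y j)
    have h' := repr_eq_zero_of_mem_span h
    rw [mul_sub, mul_smul_comm, map_sub, map_smul, Finsupp.sub_apply, Finsupp.smul_apply,
      sub_eq_zero, ← mul_assoc] at h'
    rw [h', smul_eq_mul, mul_comm]

theorem IsTriangular.diagonal_apply (hb : IsTriangular b) (j : ι) (x : R) :
    hb.diagonal j x = b.repr (x * b j) j := rfl

theorem IsTriangular.diagonal_eq (hb : IsTriangular b) {j : ι} {x : R} {a : ℤ}
    (h : x * b j - a • b j ∈ Submodule.span ℤ (b '' Set.Iio j)) : hb.diagonal j x = a := by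
  have h' := repr_eq_zero_of_mem_span h
  rw [map_sub, map_smul, Finsupp.sub_apply, Finsupp.smul_apply, sub_eq_zero] at h'
  rw [diagonal_apply, h']
  simp

variable {A : Type*} [Ring A] {p : ℕ}

/-- In `A`, multiplication by `f x` sends the image of each `b j` into the span of the images of
strictly lower basis elements. By well-founded induction some power kills each of them, and so some
power kills 1. -/
theorem IsTriangular.isNilpotent [WellFoundedLT ι] (hb : IsTriangular b) (f : R →+* A)
    (hp : (p : A) = 0) {x : R} (hx : ∀ j, (p : ℤ) ∣ hb.diagonal j x) : IsNilpotent (f x) := by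
  have key : ∀ S : Set ι, (∀ j ∈ S, ∃ k : ℕ, f x ^ k * f (b j) = 0) →
      ∀ u ∈ Submodule.span ℤ (b '' S), ∃ k : ℕ, f x ^ k * f u = 0 := by
    intro S hS u hu
    induction hu using Submodule.span_induction with
    | mem u hu =>
      obtain ⟨j, hj, rfl⟩ := hu
      exact hS j hj
    | zero => exact ⟨0, by simp⟩
    | add y z _ _ h1 h2 =>
      obtain ⟨k, hk⟩ := h1
      obtain ⟨l, hl⟩ := h2
      refine ⟨k + l, ?_⟩
      rw [map_add, mul_add, pow_add, mul_assoc _ _ (f z), hl,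
        (Commute.pow_pow_self (f x) k l).eq, mul_assoc, hk]
      simp
    | smul a y _ h =>
      obtain ⟨k, hk⟩ := h
      exact ⟨k, by rw [map_zsmul, mul_smul_comm, hk, smul_zero]⟩
  have h : ∀ j, ∃ k : ℕ, f x ^ k * f (b j) = 0 := by
    intro j
    induction j using WellFoundedLT.induction with
    | _ j ih =>
      obtain ⟨k, hk⟩ := key _ ih _ (hb.mul_sub_mem x j)
      obtain ⟨c, hc⟩ := hx j
      refine ⟨k + 1, ?_⟩
      rw [← hb.diagonal_apply, hc, map_sub, map_zsmul, mul_smul] at hk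
      have h0 : (p : ℤ) • c • f (b j) = 0 := by
        rw [zsmul_eq_mul, Int.cast_natCast, hp, zero_mul]
      rwa [h0, sub_zero, map_mul, ← mul_assoc, ← pow_succ] at hk
  obtain ⟨k, hk⟩ := key Set.univ (fun j _ => h j) 1 (by rw [Set.image_univ]; exact b.mem_span 1)
  exact ⟨k, by rwa [map_one, mul_one] at hk⟩

/-- The radical of a triangular algebra is the common kernel of its diagonal characters. -/
theorem IsTriangular.mem_jacobson_iff [WellFoundedLT ι] [Fact p.Prime] (hb : IsTriangular b)
    {f : R →+* A} (hf : Function.Surjective f) (hp : (p : A) = 0) (χ : ι → A →+* ZMod p)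
    (hχ : ∀ j x, χ j (f x) = (hb.diagonal j x : ZMod p)) {a : A} :
    a ∈ Ring.jacobson A ↔ ∀ j, χ j a = 0 := by
  constructor
  · intro ha j
    rw [Ring.jacobson_eq_sInf_isMaximal] at ha
    have : (RingHom.ker (χ j)).IsMaximal :=
      RingHom.ker_isMaximal_of_surjective _ (ZMod.ringHom_surjective _)
    exact (Submodule.mem_sInf.mp ha) _ this
  · intro ha
    rw [← Ideal.jacobson_bot, Ideal.mem_jacobson_iff]
    -- The common kernel of the characters contains every left multiple `y * a`. Each of these is
    -- therefore nilpotent, and `y * a + 1` is a unit.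
    intro y
    obtain ⟨x, hx⟩ := hf (y * a)
    have hnil : IsNilpotent (y * a) := by
      rw [← hx]
      refine hb.isNilpotent f hp fun j => ?_
      rw [← ZMod.intCast_zmod_eq_zero_iff_dvd, ← hχ, hx, map_mul, ha, mul_zero]
    obtain ⟨z, hz⟩ := (hnil.isUnit_add_one).exists_left_inv
    refine ⟨z, ?_⟩
    rw [mul_add, mul_one, ← mul_assoc] at hz
    rw [hz, sub_self]
    exact zero_mem _

end Triangular

/-! ### The basis of coset sums and the characters of the descent ring -/

section Basis

variable {n : ℕ} [hn : Fact (2 ≤ n)]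

theorem coeff_repSum (J : Set (Fin n)) (w : coxeterGroup n) [Decidable (w ∈ minReps J)] :
    (repSum J).coeff w = if w ∈ minReps J then 1 else 0 := by
  classical
  rw [repSum, MonoidAlgebra.coeff_sum, Finsupp.finsetSum_apply]
  simp only [MonoidAlgebra.of_apply, MonoidAlgebra.coeff_single, Finsupp.single_apply]
  rw [Finset.sum_ite_eq']
  simp

/-- There is a group element with any given set of ascents. -/
theorem exists_ascents (J : Set (Fin n)) :
    ∃ w : coxeterGroup n, ∀ i, w.1 (lo i) < w.1 (hi i) ↔ i ∈ J := by
  obtain ⟨v, hv⟩ := IsFaceVector.exists_vector Jᶜ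
  -- The face vector decides first and ties are broken by the reversed order, which creates the
  -- descents outside `J`. The factor `2 * n + 1` exceeds the difference of any two points.
  set u : SignedPoint n → ℤ := fun a => (2 * n + 1) * v a - a with hu
  have hodd : IsOdd u := fun a => by simp only [hu, hv.odd a, coe_neg]; ring
  obtain ⟨w, hw⟩ := exists_dominant hodd
  have key : ∀ a b : SignedPoint n, b ≠ -a → u a < u b → w.1.symm a < w.1.symm b := by
    intro a b hne hab
    by_contra h
    rcases (not_lt.mp h).eq_or_lt with h | h
    · rw [w.1.symm.injective h] at hab
      exact lt_irrefl _ hab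
    · have h3 := hw.le (hodd.comp w) h fun h4 => hne (by
        have h5 := congrArg w.1 h4
        rw [apply_neg, Equiv.apply_symm_apply, Equiv.apply_symm_apply] at h5
        rw [h5, neg_neg])
      simp only [Function.comp, Equiv.apply_symm_apply] at h3
      exact absurd hab (not_lt.mpr h3)
  refine ⟨w⁻¹, fun i => ?_⟩
  change w.1.symm (lo i) < w.1.symm (hi i) ↔ _
  have hlt := lo_lt_hi i
  rw [← Subtype.coe_lt_coe] at hlt
  have h1 := (lo i).2
  have h2 := (hi i).2
  constructor
  · intro h
    by_contra hiJ
    have h3 := (hv.eq_iff i).mpr hiJ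
    refine lt_asymm h (key _ _ (fun h => hi_ne_neg_lo i (by rw [h, neg_neg])) ?_)
    simp only [hu, h3]
    omega
  · intro hiJ
    have h3 : v (lo i) < v (hi i) :=
      lt_of_le_of_ne (hv.dominant i) fun h => (hv.eq_iff i).mp h hiJ
    refine key _ _ (hi_ne_neg_lo i) ?_
    simp only [hu]
    nlinarith

/-- The coset sums as elements of the descent ring. -/
noncomputable def rep (J : Set (Fin n)) : descentRing n :=
  ⟨repSum J, Subring.subset_closure ⟨J, rfl⟩⟩

/-- At an element whose set of ascents is exactly `L`, the coefficient of a combination is the sum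
of its coefficients over all subsets of `L`. Induction along inclusion then shows that all of them
vanish. -/
theorem linearIndependent_rep : LinearIndependent ℤ (rep : Set (Fin n) → descentRing n) := by
  classical
  rw [Fintype.linearIndependent_iff]
  intro c hc'
  have hc : ∑ J, c J • repSum J = (0 : MonoidAlgebra ℤ (coxeterGroup n)) := by
    have h := congrArg (descentRing n).subtype hc'
    rw [map_sum, map_zero] at h
    rw [← h]
    exact Finset.sum_congr rfl fun J _ => (map_zsmul (descentRing n).subtype (c J) (rep J)).symm
  have h : ∀ L : Set (Fin n), ∑ J : Set (Fin n), (if J ≤ L then c J else 0) = 0 := by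
    intro L
    obtain ⟨w, hw⟩ := exists_ascents L
    have h1 := congrArg (fun x => x.coeff w) hc
    simp only [MonoidAlgebra.coeff_sum, Finsupp.finsetSum_apply, MonoidAlgebra.coeff_smul_apply,
      coeff_repSum, mem_minReps_iff, hw, MonoidAlgebra.coeff_zero, Finsupp.coe_zero,
      Pi.zero_apply, smul_eq_mul, mul_ite, mul_one, mul_zero] at h1
    refine (Finset.sum_congr rfl fun J _ => ?_).trans h1
    congr 1
  intro J
  induction J using WellFoundedLT.induction with
  | _ J ih =>
    rw [← h J, Finset.sum_eq_single J]
    · simp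
    · intro I _ hI
      split_ifs with h2
      · exact ih I (lt_of_le_of_ne h2 hI)
      · rfl
    · simp

theorem rep_univ : rep (Set.univ : Set (Fin n)) = 1 := by
  classical
  apply Subtype.ext
  have : (Set.toFinite (minReps (Set.univ : Set (Fin n)))).toFinset = {1} := by
    ext w
    rw [Set.Finite.mem_toFinset, mem_minReps_iff, Finset.mem_singleton]
    constructor
    · exact fun h => eq_one_of_lt fun i => h i trivial
    · rintro rfl i _
      exact lo_lt_hi i
  change repSum Set.univ = 1
  rw [repSum, this, Finset.sum_singleton, map_one]

/-- The number of vectors in the orbit of `v` that are fixed by the generators in `J`. -/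
noncomputable def fixCount (v : SignedPoint n → ℤ) (J : Set (Fin n)) : ℕ :=
  open Classical in
    ((orbit v).filter fun u : SignedPoint n → ℤ => ∀ i ∈ J, u (lo i) = u (hi i)).card

/-- In Solomon's sum each vector fixed by all of `J` contributes `rep J`; any other contributes the
coset sum of a proper subset. -/
theorem rep_mul_rep_sub_mem {v : SignedPoint n → ℤ} {K : Set (Fin n)} (hv : IsFaceVector v K)
    (J : Set (Fin n)) :
    rep K * rep J - (fixCount v J : ℤ) • rep J ∈ Submodule.span ℤ (rep '' Set.Iio J) := by
  classical
  have h : rep K * rep J = ∑ u ∈ (orbit v).filter (fun u => ∀ i ∈ J, u (lo i) ≤ u (hi i)),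
      rep {i | i ∈ J ∧ u (lo i) = u (hi i)} := by
    apply Subtype.ext
    rw [AddSubmonoidClass.coe_finsetSum]
    exact repSum_mul_repSum hv J
  rw [h, ← Finset.sum_filter_add_sum_filter_not _ (fun u => ∀ i ∈ J, u (lo i) = u (hi i)),
    Finset.filter_filter, Finset.filter_filter]
  have h1 : ((orbit v).filter fun u => (∀ i ∈ J, u (lo i) ≤ u (hi i)) ∧
      ∀ i ∈ J, u (lo i) = u (hi i)) = (orbit v).filter fun u => ∀ i ∈ J, u (lo i) = u (hi i) := by
    refine Finset.filter_congr fun u _ => ?_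
    exact ⟨fun h => h.2, fun h => ⟨fun i hi => (h i hi).le, h⟩⟩
  have h2 : ∑ u ∈ (orbit v).filter (fun u => ∀ i ∈ J, u (lo i) = u (hi i)),
      rep {i | i ∈ J ∧ u (lo i) = u (hi i)} = (fixCount v J : ℤ) • rep J := by
    rw [Finset.sum_congr rfl (g := fun _ => rep J), Finset.sum_const, fixCount, natCast_zsmul]
    intro u hu
    congr 1
    ext i
    exact ⟨fun h => h.1, fun h => ⟨h, (Finset.mem_filter.mp hu).2 i h⟩⟩
  rw [h1, h2, add_sub_cancel_left]
  refine Submodule.sum_mem _ fun u hu => Submodule.subset_span ⟨_, ?_, rfl⟩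
  have hu' := (Finset.mem_filter.mp hu).2.2
  have hle : {i | i ∈ J ∧ u (lo i) = u (hi i)} ≤ J := fun i hi => hi.1
  refine lt_of_le_of_ne hle fun h => hu' fun i hi => ?_
  rw [← h] at hi
  exact hi.2

theorem rep_mul_rep_mem (K J : Set (Fin n)) :
    rep K * rep J ∈ Submodule.span ℤ (rep '' Set.Iic J) := by
  obtain ⟨v, hv⟩ := IsFaceVector.exists_vector K
  rw [← sub_add_cancel (rep K * rep J) ((fixCount v J : ℤ) • rep J)]
  exact add_mem (Submodule.span_mono (Set.image_mono Set.Iio_subset_Iic_self)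
    (rep_mul_rep_sub_mem hv J))
    (Submodule.smul_mem _ _ (Submodule.subset_span ⟨J, Set.mem_Iic.mpr le_rfl, rfl⟩))

/-- The coset sums span the descent ring. -/
theorem span_rep : Submodule.span ℤ (Set.range (rep : Set (Fin n) → descentRing n)) = ⊤ := by
  rw [eq_top_iff]
  rintro ⟨x, hx⟩ -
  have hmul : ∀ x ∈ Submodule.span ℤ (Set.range (rep : Set (Fin n) → descentRing n)),
      ∀ y ∈ Submodule.span ℤ (Set.range (rep : Set (Fin n) → descentRing n)),
      x * y ∈ Submodule.span ℤ (Set.range (rep : Set (Fin n) → descentRing n)) := by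
    intro x hx y hy
    induction hx, hy using Submodule.span_induction₂ with
    | mem_mem x y hx hy =>
      obtain ⟨K, rfl⟩ := hx
      obtain ⟨J, rfl⟩ := hy
      exact Submodule.span_mono (Set.image_subset_range _ _) (rep_mul_rep_mem K J)
    | zero_left => rw [zero_mul]; exact zero_mem _
    | zero_right => rw [mul_zero]; exact zero_mem _
    | add_left x y z _ _ _ h1 h2 => rw [add_mul]; exact add_mem h1 h2
    | add_right x y z _ _ _ h1 h2 => rw [mul_add]; exact add_mem h1 h2
    | smul_left a x y _ _ h => rw [smul_mul_assoc]; exact Submodule.smul_mem _ _ h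
    | smul_right a x y _ _ h => rw [mul_smul_comm]; exact Submodule.smul_mem _ _ h
  induction hx using Subring.closure_induction with
  | mem x hx =>
    obtain ⟨J, rfl⟩ := hx
    exact Submodule.subset_span ⟨J, rfl⟩
  | zero => exact zero_mem _
  | one => exact Submodule.subset_span ⟨Set.univ, rep_univ⟩
  | add x y hx hy h1 h2 => exact add_mem h1 h2
  | neg x hx h => exact neg_mem h
  | mul x y hx hy h1 h2 =>
    have h := hmul ⟨x, hx⟩ h1 ⟨y, hy⟩ h2
    have e : (⟨x, hx⟩ * ⟨y, hy⟩ : descentRing n) = ⟨x * y, mul_mem hx hy⟩ :=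
      Subtype.ext (Subring.coe_mul (descentRing n) _ _)
    rwa [e] at h

/-- The basis of the descent ring that consists of the coset sums. -/
noncomputable def descentBasis (n : ℕ) [Fact (2 ≤ n)] :
    Module.Basis (Set (Fin n)) ℤ (descentRing n) :=
  Module.Basis.mk linearIndependent_rep span_rep.ge

theorem coe_descentBasis : ⇑(descentBasis n) = rep := Module.Basis.coe_mk _ _

theorem isTriangular_descentBasis : IsTriangular (descentBasis n) := by
  intro K J
  rw [coe_descentBasis]
  exact rep_mul_rep_mem K J

theorem diagonal_rep {v : SignedPoint n → ℤ} {K : Set (Fin n)} (hv : IsFaceVector v K)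
    (J : Set (Fin n)) : isTriangular_descentBasis.diagonal J (rep K) = fixCount v J := by
  apply isTriangular_descentBasis.diagonal_eq
  rw [coe_descentBasis]
  exact rep_mul_rep_sub_mem hv J

variable (p : ℕ) [Fact p.Prime]

noncomputable instance : SMul (ZMod p) (ModularDescentAlgebra n p) :=
  (inferInstance : Module (ZMod p) (ModularDescentAlgebra n p)).toSMul

theorem natCast_modularDescentAlgebra : (p : ModularDescentAlgebra n p) = 0 := by
  rw [← map_natCast (Ideal.Quotient.mk (multiples n p)), Ideal.Quotient.eq_zero_iff_mem]
  exact ⟨1, by rw [nsmul_eq_mul, mul_one]⟩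

/-- The reduction modulo `p` of the diagonal characters. -/
noncomputable def character (J : Set (Fin n)) : ModularDescentAlgebra n p →+* ZMod p :=
  Ideal.Quotient.lift (multiples n p)
    ((Int.castRingHom (ZMod p)).comp (isTriangular_descentBasis.diagonal J)) (by
      rintro _ ⟨y, rfl⟩
      simp)

theorem character_mk (J : Set (Fin n)) (x : descentRing n) :
    character p J (Ideal.Quotient.mk (multiples n p) x) =
      (isTriangular_descentBasis.diagonal J x : ZMod p) := rfl

theorem mem_radical_iff {x : ModularDescentAlgebra n p} :
    x ∈ radical n p ↔ ∀ J, character p J x = 0 :=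
  isTriangular_descentBasis.mem_jacobson_iff Ideal.Quotient.mk_surjective
    (natCast_modularDescentAlgebra p) (character p) (fun J x => character_mk p J x)

theorem character_smul (J : Set (Fin n)) (c : ZMod p) (x : ModularDescentAlgebra n p) :
    character p J (c • x) = c * character p J x :=
  ((character p J).toAddMonoidHom.toZModLinearMap p).map_smul c x

end Basis

/-! ### Level sets of odd vectors -/

section Fibres

variable {n : ℕ}

/-- The number of points at which `v` takes the value `t`. -/
noncomputable def fib (v : SignedPoint n → ℤ) (t : ℤ) : ℕ :=
  (Finset.univ.filter fun a => v a = t).card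

theorem IsOdd.fib_neg {v : SignedPoint n → ℤ} (hv : IsOdd v) (t : ℤ) : fib v (-t) = fib v t := by
  refine Finset.card_equiv (Equiv.neg _) fun a => ?_
  simp only [Finset.mem_filter, Finset.mem_univ, true_and, Equiv.neg_apply, hv a]
  omega

theorem IsOdd.fib_natAbs {v : SignedPoint n → ℤ} (hv : IsOdd v) (t : ℤ) :
    fib v t.natAbs = fib v t := by
  rcases Int.natAbs_eq t with h | h
  · rw [← h]
  · conv_rhs => rw [h, hv.fib_neg]

/-- Fibres over negative values are controlled by oddness, and the fibre over 0 is the complement of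
all the others. -/
theorem IsOdd.exists_perm {u v : SignedPoint n → ℤ} (hu : IsOdd u) (hv : IsOdd v)
    (h : ∀ t : ℕ, 0 < t → fib u t = fib v t) :
    ∃ π : Equiv.Perm (SignedPoint n), u = v ∘ π := by
  classical
  have h' : ∀ t : ℤ, t ≠ 0 → fib u t = fib v t := fun t ht => by
    rw [← hu.fib_natAbs, ← hv.fib_natAbs, h _ (Int.natAbs_pos.mpr ht)]
  have hsum : ∀ x : SignedPoint n → ℤ, ∀ S : Finset ℤ, Finset.univ.image x ⊆ S →
      (Finset.univ.filter fun a => x a ≠ 0).card = ∑ t ∈ S.erase 0, fib x t := by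
    intro x S hS
    rw [Finset.card_eq_sum_card_fiberwise (f := x) (t := S.erase 0)]
    · refine Finset.sum_congr rfl fun t ht => ?_
      rw [fib, Finset.filter_filter]
      congr 1
      refine Finset.filter_congr fun a _ => ?_
      exact ⟨fun h => h.2, fun h => ⟨h ▸ Finset.ne_of_mem_erase ht, h⟩⟩
    · intro a ha
      simp only [Finset.coe_filter, Finset.mem_univ, true_and, Set.mem_ofPred_eq] at ha
      rw [Finset.mem_coe, Finset.mem_erase]
      exact ⟨ha, hS (Finset.mem_image_of_mem _ (Finset.mem_univ _))⟩
  have h0 : fib u 0 = fib v 0 := by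
    have h1 := hsum u (Finset.univ.image u ∪ Finset.univ.image v) Finset.subset_union_left
    have h2 := hsum v (Finset.univ.image u ∪ Finset.univ.image v) Finset.subset_union_right
    rw [Finset.sum_congr rfl fun t ht => h' t (Finset.ne_of_mem_erase ht), ← h2] at h1
    have h3 := Finset.card_filter_add_card_filter_not (s := Finset.univ) fun a => u a = 0
    have h4 := Finset.card_filter_add_card_filter_not (s := Finset.univ) fun a => v a = 0
    unfold fib
    simp only [ne_eq] at h1
    omega
  have e : ∀ t, Nonempty ({a // u a = t} ≃ {a // v a = t}) := fun t => by
    rw [← Fintype.card_eq, Fintype.card_subtype, Fintype.card_subtype]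
    by_cases ht : t = 0
    · subst ht; exact h0
    · exact h' t ht
  refine ⟨Equiv.ofFiberEquiv fun t => (e t).some, ?_⟩
  funext a
  exact (Equiv.ofFiberEquiv_map _ a).symm

theorem IsOdd.eq_zero {v : SignedPoint n → ℤ} (hv : IsOdd v) {a : SignedPoint n}
    (h : v a = v (-a)) : v a = 0 := by
  rw [hv] at h
  omega

theorem posSign_ne_zero {v : SignedPoint n → ℤ} (hv : IsOdd v) (h : posSign v ≠ 0)
    (a : SignedPoint n) : v a ≠ 0 := by
  unfold posSign at h
  rw [Finset.prod_ne_zero_iff] at h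
  have hpos : ∀ a : SignedPoint n, 0 < (a : ℤ) → v a ≠ 0 := fun a ha h0 =>
    h a (by simpa using ha) (by rw [h0, Int.sign_zero])
  rcases lt_or_gt_of_ne a.2.1 with h' | h'
  · have := hpos (-a) (by rw [coe_neg]; omega)
    rwa [hv, neg_ne_zero] at this
  · exact hpos a h'

/-- Of two antipodal points at which `|v|` is `t`, exactly one is positive, and at exactly one the
value is `t` itself. -/
theorem IsOdd.card_pos_filter {v : SignedPoint n → ℤ} (hv : IsOdd v) {t : ℕ} (ht : 0 < t) :
    (Finset.univ.filter fun a : SignedPoint n => 0 < (a : ℤ) ∧ (v a).natAbs = t).card =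
      fib v t := by
  refine Finset.card_nbij' (fun a => if 0 < v a then a else -a)
    (fun a => if 0 < (a : ℤ) then a else -a) ?_ ?_ ?_ ?_
  · intro a ha
    simp only [Finset.coe_filter, Finset.mem_univ, true_and, Set.mem_ofPred_eq] at ha ⊢
    split_ifs
    · omega
    · rw [hv]; omega
  · intro a ha
    have := a.2
    simp only [Finset.coe_filter, Finset.mem_univ, true_and, Set.mem_ofPred_eq] at ha ⊢
    split_ifs with h1
    · exact ⟨h1, by omega⟩
    · rw [hv, coe_neg]
      omega
  · intro a ha
    simp only [Finset.coe_filter, Finset.mem_univ, true_and, Set.mem_ofPred_eq] at ha ⊢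
    by_cases h1 : 0 < v a <;> simp [h1, ha.1, ha.1.le]
  · intro a ha
    simp only [Finset.coe_filter, Finset.mem_univ, true_and, Set.mem_ofPred_eq] at ha ⊢
    by_cases h1 : 0 < (a : ℤ)
    · simp [h1, ha, ht]
    · simp [h1, hv a, ha]

end Fibres

/-! ### Relabelling the values of a vector -/

section Relabel

/-- The odd function that sends `t > 0` to `ε t * σ t`. -/
def relabel (σ : Equiv.Perm ℕ) (ε : ℕ → ℤ) (z : ℤ) : ℤ := ε z.natAbs * (z.sign * σ z.natAbs)

variable {σ : Equiv.Perm ℕ} {ε : ℕ → ℤ}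

theorem relabel_neg (z : ℤ) : relabel σ ε (-z) = -relabel σ ε z := by
  simp [relabel]

theorem natAbs_relabel (h0 : σ 0 = 0) (hε : ∀ t, IsUnit (ε t)) (z : ℤ) :
    (relabel σ ε z).natAbs = σ z.natAbs := by
  unfold relabel
  rw [Int.natAbs_mul, Int.natAbs_mul, Int.natAbs_natCast, Int.isUnit_iff_natAbs_eq.mp (hε _),
    one_mul]
  by_cases hz : z = 0
  · simp [hz, h0]
  · rw [Int.natAbs_sign_of_ne_zero hz, one_mul]

theorem sign_relabel (h0 : σ 0 = 0) (hε : ∀ t, IsUnit (ε t)) (z : ℤ) :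
    (relabel σ ε z).sign = ε z.natAbs * z.sign := by
  unfold relabel
  by_cases hz : z = 0
  · simp [hz]
  · have h1 : 0 < σ z.natAbs := by
      rw [Nat.pos_iff_ne_zero]
      intro h
      rw [← h0] at h
      exact hz (Int.natAbs_eq_zero.mp (σ.injective h))
    rw [Int.sign_mul, Int.sign_mul, Int.sign_eq_one_of_pos (by exact_mod_cast h1 : (0:ℤ) < σ z.natAbs),
      Int.sign_sign, mul_one]
    rcases Int.isUnit_iff.mp (hε z.natAbs) with h | h <;> rw [h] <;> rfl

theorem relabel_injective (h0 : σ 0 = 0) (hε : ∀ t, IsUnit (ε t)) :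
    Function.Injective (relabel σ ε) := by
  intro y z h
  have h1 := congrArg Int.natAbs h
  have h2 := congrArg Int.sign h
  rw [natAbs_relabel h0 hε, natAbs_relabel h0 hε] at h1
  have h1 := σ.injective h1
  rw [sign_relabel h0 hε, sign_relabel h0 hε, h1] at h2
  have h2 := (hε _).mul_left_cancel h2
  rw [← Int.sign_mul_natAbs y, ← Int.sign_mul_natAbs z, h1, h2]

theorem relabel_iterate {σ : Equiv.Perm ℕ} (h0 : σ 0 = 0) (k : ℕ) (z : ℤ) :
    (relabel σ 1)^[k] z = relabel (σ ^ k) 1 z := by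
  induction k with
  | zero => simp [relabel, Int.sign_mul_abs]
  | succ k ih =>
    have h0' : (σ ^ k) 0 = 0 := Equiv.Perm.pow_apply_eq_self_of_apply_eq_self h0 k
    have h1 : ∀ t : ℕ, IsUnit ((1 : ℕ → ℤ) t) := fun _ => isUnit_one
    rw [Function.iterate_succ_apply', ih, relabel, natAbs_relabel h0' h1, sign_relabel h0' h1,
      pow_succ']
    simp [relabel]

theorem relabel_one_involutive (hε : ∀ t, IsUnit (ε t)) (z : ℤ) :
    relabel 1 ε (relabel 1 ε z) = z := by
  have h0 : (1 : Equiv.Perm ℕ) 0 = 0 := rfl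
  rw [relabel, natAbs_relabel h0 hε, sign_relabel h0 hε]
  simp only [Equiv.Perm.coe_one, id]
  rw [mul_assoc, Int.sign_mul_natAbs, ← mul_assoc, Int.isUnit_mul_self (hε _), one_mul]

/-- The sign function that is negative at `t` only. -/
def flip (t : ℕ) (s : ℕ) : ℤ := if s = t then -1 else 1

theorem isUnit_flip (t s : ℕ) : IsUnit (flip t s) := by
  unfold flip
  split_ifs
  · exact isUnit_one.neg
  · exact isUnit_one

variable {n : ℕ}

theorem IsOdd.relabel {v : SignedPoint n → ℤ} (hv : IsOdd v) (σ : Equiv.Perm ℕ) (ε : ℕ → ℤ) :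
    IsOdd (relabel σ ε ∘ v) := fun a => by
  rw [Function.comp, hv, relabel_neg]
  rfl

theorem IsOdd.fib_relabel {v : SignedPoint n → ℤ} (hv : IsOdd v) (h0 : σ 0 = 0)
    (hε : ∀ t, IsUnit (ε t)) {t : ℕ} (ht : 0 < t) : fib (TypeD.relabel σ ε ∘ v) (σ t) = fib v t := by
  have h1 : 0 < σ t := by
    rw [Nat.pos_iff_ne_zero]
    intro h
    rw [← h0] at h
    exact ht.ne' (σ.injective h)
  rw [← (hv.relabel σ ε).card_pos_filter h1, ← hv.card_pos_filter ht]
  congr 1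
  refine Finset.filter_congr fun a _ => ?_
  rw [Function.comp, natAbs_relabel h0 hε, EmbeddingLike.apply_eq_iff_eq]

theorem posSign_relabel (v : SignedPoint n → ℤ) (h0 : σ 0 = 0) (hε : ∀ t, IsUnit (ε t)) :
    posSign (relabel σ ε ∘ v) =
      (∏ a ∈ Finset.univ.filter (fun a : SignedPoint n => 0 < (a : ℤ)), ε (v a).natAbs) *
        posSign v := by
  unfold posSign
  rw [← Finset.prod_mul_distrib]
  exact Finset.prod_congr rfl fun a _ => sign_relabel h0 hε _

theorem IsOdd.prod_flip {v : SignedPoint n → ℤ} (hv : IsOdd v) {t : ℕ} (ht : 0 < t) :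
    ∏ a ∈ Finset.univ.filter (fun a : SignedPoint n => 0 < (a : ℤ)), flip t (v a).natAbs =
      (-1) ^ fib v t := by
  unfold flip
  rw [Finset.prod_ite, Finset.prod_const, Finset.prod_const_one, mul_one, Finset.filter_filter,
    hv.card_pos_filter ht]

variable [hn : Fact (2 ≤ n)]

/-- Relabelling composes on the side opposite to the group action, so by `comp_mem_orbit` one
relabelled vector in the orbit of `v` brings the whole orbit of `u` along. Fibre sizes and the
product sign are all that has to match. -/
theorem relabel_comp_mem_orbit {u v : SignedPoint n → ℤ} (hu : IsOdd u) (hv : IsOdd v)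
    (h0 : σ 0 = 0) (hε : ∀ t, IsUnit (ε t)) (hσ : ∀ t : ℕ, 0 < t → fib u t = fib v (σ t))
    (hs : (∏ a ∈ Finset.univ.filter (fun a : SignedPoint n => 0 < (a : ℤ)), ε (u a).natAbs) *
      posSign u = posSign v) : relabel σ ε ∘ u ∈ orbit v := by
  rw [mem_orbit_iff hv]
  refine ⟨hu.relabel σ ε, (hu.relabel σ ε).exists_perm hv fun t ht => ?_, ?_⟩
  · obtain ⟨s, rfl⟩ := σ.surjective t
    have hs : 0 < s := by
      rw [Nat.pos_iff_ne_zero]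
      rintro rfl
      exact ht.ne' h0
    rw [hu.fib_relabel h0 hε hs, hσ s hs]
  · rw [posSign_relabel u h0 hε, hs]

end Relabel

/-! ### Counting the vectors of an orbit that factor through another vector -/

section FixedVectors

variable {n : ℕ} [hn : Fact (2 ≤ n)]

/-- The members of the orbit of `v` that factor through `w`. -/
noncomputable def fixed (v w : SignedPoint n → ℤ) : Finset (SignedPoint n → ℤ) :=
  open Classical in (orbit v).filter fun u => ∀ a b, w a = w b → u a = u b

theorem mem_fixed {u v w : SignedPoint n → ℤ} :
    u ∈ fixed v w ↔ u ∈ orbit v ∧ ∀ a b, w a = w b → u a = u b := by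
  simp [fixed]

/-- Chains of simple pairs carry the equality of `u` to any two points on one level of `w` that are
not antipodal. Antipodal points on one level lie on level 0, and they are linked through the third
zero that `h0` supplies. -/
theorem fixCount_eq {w : SignedPoint n → ℤ} {J : Set (Fin n)} (hw : IsFaceVector w J)
    (h0 : ∀ a, w a = 0 → ∃ b, b ≠ a ∧ b ≠ -a ∧ w b = 0) {v : SignedPoint n → ℤ} (hv : IsOdd v) :
    fixCount v J = (fixed v w).card := by
  classical
  unfold fixCount fixed
  congr 1
  refine Finset.filter_congr fun u hu => ?_
  constructor
  · intro h
    have hodd : IsOdd u := ((mem_orbit_iff hv).mp hu).1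
    have key : ∀ a b : SignedPoint n, a < b → b ≠ -a → w a = w b → u a = u b := by
      intro a b hab hne hw'
      have := rel_of_lt (fun x y => w x < w y ∨ w x = w y ∧ u x = u y) ?_ ?_ ?_ hab hne
      · rcases this with h1 | h1
        · exact absurd hw' h1.ne
        · exact h1.2
      · rintro a b c (h1 | ⟨h1, h1'⟩) (h2 | ⟨h2, h2'⟩)
        · exact Or.inl (h1.trans h2)
        · exact Or.inl (h2 ▸ h1)
        · exact Or.inl (h1 ▸ h2)
        · exact Or.inr ⟨h1.trans h2, h1'.trans h2'⟩
      · intro i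
        rcases (hw.dominant i).lt_or_eq with h1 | h1
        · exact Or.inl h1
        · exact Or.inr ⟨h1, h i ((hw.eq_iff i).mp h1)⟩
      · intro i
        simp only [hw.odd _, hodd _]
        rcases (hw.dominant i).lt_or_eq with h1 | h1
        · exact Or.inl (neg_lt_neg h1)
        · exact Or.inr ⟨by rw [h1], by rw [h i ((hw.eq_iff i).mp h1)]⟩
    have key' : ∀ a b : SignedPoint n, b ≠ -a → w a = w b → u a = u b := by
      intro a b hne hw'
      rcases lt_trichotomy a b with h1 | rfl | h1
      · exact key a b h1 hne hw'
      · rfl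
      · exact (key b a h1 (fun h => hne (by rw [h, neg_neg])) hw'.symm).symm
    intro a b hab
    by_cases hne : b = -a
    · subst hne
      have ha := hw.odd.eq_zero hab
      obtain ⟨c, hc1, hc2, hc⟩ := h0 a ha
      have h1 := key' a c hc2 (ha.trans hc.symm)
      have h2 := key' (-a) c (by rwa [neg_neg]) (hab ▸ ha.trans hc.symm)
      rw [h1, h2]
    · exact key' a b hne hab
  · exact fun h i hi => h _ _ ((hw.eq_iff i).mpr hi)

theorem comp_mem_orbit {h : ℤ → ℤ} {u v v' : SignedPoint n → ℤ} (hv : h ∘ v ∈ orbit v')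
    (hu : u ∈ orbit v) : h ∘ u ∈ orbit v' := by
  obtain ⟨x, hx⟩ := mem_orbit.mp hv
  obtain ⟨y, rfl⟩ := mem_orbit.mp hu
  refine mem_orbit.mpr ⟨x * y, ?_⟩
  change (v' ∘ x.1) ∘ y.1 = _
  rw [hx]
  rfl

theorem card_fixed_le {h : ℤ → ℤ} (hinj : Function.Injective h) {v v' : SignedPoint n → ℤ}
    (hv : h ∘ v ∈ orbit v') (w : SignedPoint n → ℤ) : (fixed v w).card ≤ (fixed v' w).card := by
  refine Finset.card_le_card_of_injOn (h ∘ ·) ?_ ?_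
  · intro u hu
    rw [Finset.mem_coe, mem_fixed] at hu ⊢
    exact ⟨comp_mem_orbit hv hu.1, fun a b hab => congrArg h (hu.2 a b hab)⟩
  · exact (hinj.comp_left).injOn

/-- A relabelling of order `p` without fixed vectors forces divisibility by `p`. -/
theorem dvd_card_fixed {p : ℕ} [Fact p.Prime] {h : ℤ → ℤ} (hp : ∀ z, h^[p] z = z)
    {v : SignedPoint n → ℤ} (hv : h ∘ v ∈ orbit v) {a : SignedPoint n} (ha : h (v a) ≠ v a)
    (w : SignedPoint n → ℤ) : p ∣ (fixed v w).card := by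
  classical
  let f : Function.End {u // u ∈ fixed v w} := fun u => ⟨h ∘ u.1, by
    have hu := mem_fixed.mp u.2
    exact mem_fixed.mpr ⟨comp_mem_orbit hv hu.1, fun a b hab => congrArg h (hu.2 a b hab)⟩⟩
  have hf : ∀ k : ℕ, ∀ u, ((f ^ k) u).1 = h^[k] ∘ u.1 := by
    intro k
    induction k with
    | zero => intro u; rfl
    | succ k ih =>
      intro u
      rw [pow_succ]
      exact ih (f u)
  have hfp : f ^ p ^ 1 = 1 := by
    funext u
    apply Subtype.ext
    rw [pow_one, hf]
    funext a
    exact hp _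
  have := Equiv.Perm.card_fixedPoints_modEq hfp
  -- Every member of the orbit takes the value `v a`, which `h` moves, so `f` has no fixed point.
  have hempty : Fintype.card f.fixedPoints = 0 := by
    rw [Fintype.card_eq_zero_iff]
    refine ⟨fun ⟨u, hu⟩ => ?_⟩
    have hu' : h ∘ u.1 = u.1 := congrArg Subtype.val hu
    obtain ⟨x, hx⟩ := mem_orbit.mp (mem_fixed.mp u.2).1
    have h1 := congrFun hu' (x.1.symm a)
    rw [← hx] at h1
    simp only [Function.comp, Equiv.apply_symm_apply] at h1
    exact ha h1
  rw [hempty, Fintype.card_coe] at this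
  exact (Nat.modEq_zero_iff_dvd).mp this

/-- The signs of `u` and `w` at a point differ by a factor that depends only on `|w|`. Each absolute
value of `w` occurs an even number of times among the positive points, so these factors cancel. -/
theorem posSign_eq_of_factor {u w : SignedPoint n → ℤ} (hu : IsOdd u) (hw : IsOdd w)
    (h : ∀ a b, w a = w b → u a = u b) (hu0 : posSign u ≠ 0) (hw0 : posSign w ≠ 0)
    (heven : ∀ t : ℕ, 0 < t → Even (fib w t)) : posSign u = posSign w := by
  classical
  -- The choice of the point is immaterial because `u` factors through `w`. The default 1 only
  -- serves to make `η t ^ 2 = 1` hold for every `t`.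
  let η : ℕ → ℤ := fun t => if h : ∃ b, w b = t then (u h.choose).sign else 1
  have hη : ∀ t, η t ^ 2 = 1 := by
    intro t
    simp only [η]
    split_ifs with h
    · rw [← sq_abs, Int.abs_sign_of_ne_zero (posSign_ne_zero hu hu0 h.choose), one_pow]
    · rfl
  have hηeq : ∀ b : SignedPoint n, 0 < w b → η (w b).natAbs = (u b).sign := by
    intro b hb
    have hex : ∃ c, w c = (w b).natAbs := ⟨b, by omega⟩
    simp only [η]
    rw [dif_pos hex, h hex.choose b (by rw [hex.choose_spec]; omega)]
  have hsign : ∀ a, (u a).sign = η (w a).natAbs * (w a).sign := by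
    intro a
    rcases lt_trichotomy (w a) 0 with h1 | h1 | h1
    · have := hηeq (-a) (by rw [hw]; omega)
      rw [hw, hu, Int.natAbs_neg, Int.sign_neg] at this
      rw [this, Int.sign_eq_neg_one_of_neg h1]
      ring
    · exact absurd h1 (posSign_ne_zero hw hw0 a)
    · rw [hηeq a h1, Int.sign_eq_one_of_pos h1, mul_one]
  have h1 : posSign u = (∏ a ∈ Finset.univ.filter (fun a : SignedPoint n => 0 < (a : ℤ)),
      η (w a).natAbs) * posSign w := by
    unfold posSign
    rw [← Finset.prod_mul_distrib]
    exact Finset.prod_congr rfl fun a _ => hsign a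
  rw [h1, Finset.prod_comp η fun a => (w a).natAbs, Finset.prod_eq_one, one_mul]
  intro t ht
  obtain ⟨a, ha, rfl⟩ := Finset.mem_image.mp ht
  have ht : 0 < (w a).natAbs := Int.natAbs_pos.mpr (posSign_ne_zero hw hw0 a)
  rw [Finset.filter_filter, hw.card_pos_filter ht]
  obtain ⟨k, hk⟩ := heven _ ht
  rw [hk, ← two_mul, pow_mul, hη, one_pow]

end FixedVectors

/-! ### Vectors with prescribed multiplicities -/

section Parts

variable {n : ℕ}

/-- The nonzero absolute values of the coordinates of `v` are `1, …, l.length`, and their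
multiplicities are given by the list `l`. -/
structure HasParts (v : SignedPoint n → ℤ) (l : List ℕ) : Prop where
  odd : IsOdd v
  pos : ∀ x ∈ l, 0 < x
  natAbs_le : ∀ a, (v a).natAbs ≤ l.length
  fib_eq : ∀ j : Fin l.length, fib v ((j : ℕ) + 1 : ℕ) = l.get j

namespace HasParts

variable {v : SignedPoint n → ℤ} {l : List ℕ}

theorem exists_eq (hv : HasParts v l) (j : Fin l.length) : ∃ a, v a = ((j : ℕ) + 1 : ℕ) := by
  have h : 0 < fib v ((j : ℕ) + 1 : ℕ) := by
    rw [hv.fib_eq]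
    exact hv.pos _ (List.get_mem _ _)
  obtain ⟨a, ha⟩ := Finset.card_pos.mp h
  exact ⟨a, (Finset.mem_filter.mp ha).2⟩

theorem fib_eq_zero (hv : HasParts v l) {t : ℕ} (ht : l.length < t) : fib v t = 0 := by
  rw [fib, Finset.card_eq_zero, Finset.filter_eq_empty_iff]
  intro a _ ha
  have := hv.natAbs_le a
  omega

/-- The position of a nonzero value. -/
theorem exists_natAbs_eq (hv : HasParts v l) {a : SignedPoint n} (ha : v a ≠ 0) :
    ∃ j : Fin l.length, (v a).natAbs = (j : ℕ) + 1 := by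
  have := hv.natAbs_le a
  have h0 := Int.natAbs_pos.mpr ha
  exact ⟨⟨(v a).natAbs - 1, by omega⟩, by simp only; omega⟩

theorem fib_apply (hv : HasParts v l) {a : SignedPoint n} {j : Fin l.length}
    (h : (v a).natAbs = (j : ℕ) + 1) : fib v (v a) = l.get j := by
  rw [← hv.odd.fib_natAbs, h, hv.fib_eq]

end HasParts

/-- The embedding `j ↦ j + 1`. -/
def succEmbedding (k : ℕ) : Fin k ↪ ℕ := ⟨fun j => (j : ℕ) + 1, fun i j h => Fin.ext (by simpa using h)⟩

theorem succEmbedding_apply (k : ℕ) (j : Fin k) : succEmbedding k j = (j : ℕ) + 1 := rfl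

theorem zero_notMem_range_succEmbedding (k : ℕ) : 0 ∉ Set.range (succEmbedding k) := by
  rintro ⟨j, hj⟩
  exact Nat.succ_ne_zero _ hj

theorem card_get_eq (l : List ℕ) (c : ℕ) :
    (Finset.univ.filter fun j : Fin l.length => l.get j = c).card = l.count c := by
  have h : (Finset.univ : Finset (Fin l.length)).val.map l.get = (l : Multiset ℕ) := by
    rw [Fin.univ_val_map, List.ofFn_get]
  rw [← Multiset.coe_count, ← h, Multiset.count_map]
  simp only [eq_comm]
  rfl

theorem perm_of_get {l l' : List ℕ} (τ : Fin l.length ≃ Fin l'.length)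
    (h : ∀ j, l.get j = l'.get (τ j)) : l.Perm l' := by
  rw [← Multiset.coe_eq_coe]
  have e : ∀ l : List ℕ, (l : Multiset ℕ) = (Finset.univ : Finset (Fin l.length)).val.map l.get :=
    fun l => by rw [Fin.univ_val_map, List.ofFn_get]
  rw [e l, e l', show l.get = l'.get ∘ τ from funext h, ← Multiset.map_map]
  congr 1
  exact Multiset.map_univ_val_equiv τ

theorem exists_equiv_of_perm {l l' : List ℕ} (h : l.Perm l') :
    ∃ τ : Fin l.length ≃ Fin l'.length, ∀ j, l.get j = l'.get (τ j) := by
  have e : ∀ c, Nonempty ({j // l.get j = c} ≃ {j // l'.get j = c}) := fun c => by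
    rw [← Fintype.card_eq, Fintype.card_subtype, Fintype.card_subtype, card_get_eq, card_get_eq,
      h.count_eq]
  exact ⟨Equiv.ofFiberEquiv fun c => (e c).some,
    fun j => (Equiv.ofFiberEquiv_map (fun c => (e c).some) j).symm⟩

variable [hn : Fact (2 ≤ n)]

/-- Labels with equal multiplicities are matched; 0 and all labels beyond the number of parts stay
in place. -/
theorem HasParts.exists_relabel {u v : SignedPoint n → ℤ} {l l' : List ℕ} (hu : HasParts u l)
    (hv : HasParts v l') (h : l.Perm l') :
    ∃ σ : Equiv.Perm ℕ, σ 0 = 0 ∧ ∀ t : ℕ, 0 < t → fib u t = fib v (σ t) := by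
  obtain ⟨τ, hτ⟩ := exists_equiv_of_perm h
  have hl := h.length_eq
  refine ⟨Equiv.Perm.viaEmbedding (τ.trans (finCongr hl.symm)) (succEmbedding l.length),
    Equiv.Perm.viaEmbedding_apply_of_notMem _ _ _ (zero_notMem_range_succEmbedding _), ?_⟩
  intro t ht
  by_cases h1 : t ≤ l.length
  · obtain ⟨j, rfl⟩ : ∃ j : Fin l.length, t = succEmbedding _ j :=
      ⟨⟨t - 1, by omega⟩, (Nat.sub_add_cancel ht).symm⟩
    rw [Equiv.Perm.viaEmbedding_apply]
    rw [succEmbedding_apply, succEmbedding_apply, hu.fib_eq, hτ, ← hv.fib_eq]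
    rfl
  · rw [Equiv.Perm.viaEmbedding_apply_of_notMem]
    · rw [hu.fib_eq_zero (by omega), hv.fib_eq_zero (by omega)]
    · rintro ⟨j, rfl⟩
      have := j.2
      rw [succEmbedding_apply] at h1
      omega

/-- A relabelling that matches the parts injects one set into the other. If the product signs are
opposite, it also changes the sign of one value of odd multiplicity. -/
theorem HasParts.card_fixed_le {u v : SignedPoint n → ℤ} {l l' : List ℕ} (hu : HasParts u l)
    (hv : HasParts v l') (h : l.Perm l')
    (hs : posSign u = posSign v ∨ posSign v = -posSign u ∧ ∃ x ∈ l, ¬ Even x)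
    (w : SignedPoint n → ℤ) : (fixed u w).card ≤ (fixed v w).card := by
  obtain ⟨σ, h0, hσ⟩ := hu.exists_relabel hv h
  rcases hs with hs | ⟨hs, x, hx, hodd⟩
  · have h1 : ∀ t : ℕ, IsUnit ((1 : ℕ → ℤ) t) := fun _ => isUnit_one
    exact TypeD.card_fixed_le (relabel_injective h0 h1)
      (relabel_comp_mem_orbit hu.odd hv.odd h0 h1 hσ (by simp [hs])) w
  · obtain ⟨j, rfl⟩ := List.mem_iff_get.mp hx
    refine TypeD.card_fixed_le (relabel_injective h0 (isUnit_flip ((j : ℕ) + 1)))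
      (relabel_comp_mem_orbit hu.odd hv.odd h0 (isUnit_flip ((j : ℕ) + 1)) hσ ?_) w
    rw [hu.odd.prod_flip (Nat.succ_pos _), hu.fib_eq, (Nat.not_even_iff_odd.mp hodd).neg_one_pow,
      hs, neg_one_mul]

/-- A part of multiplicity at least `p` makes the number of fixed vectors divisible by `p`. -/
theorem HasParts.dvd_card_fixed {v : SignedPoint n → ℤ} {l : List ℕ} (hv : HasParts v l) {p : ℕ}
    [hp : Fact p.Prime] {c : ℕ} (hc : p ≤ l.count c) (w : SignedPoint n → ℤ) :
    p ∣ (fixed v w).card := by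
  have hemb : Nonempty (ZMod p ↪ {j : Fin l.length // l.get j = c}) := by
    apply Function.Embedding.nonempty_of_card_le
    rw [ZMod.card, Fintype.card_subtype, card_get_eq]
    exact hc
  obtain ⟨e⟩ := hemb
  -- Indexing `p` labels of multiplicity `c` by `ZMod p` turns the translation by 1 into a
  -- relabelling of order `p` that preserves the fibre sizes.
  set ι : ZMod p ↪ ℕ := (e.trans (Function.Embedding.subtype _)).trans (succEmbedding l.length)
    with hι
  have hιpos : ∀ i, fib v (ι i) = c := fun i => (hv.fib_eq (e i).1).trans (e i).2
  have hex : ∀ i, ∃ a, v a = ι i := fun i => hv.exists_eq (e i).1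
  set σ : Equiv.Perm ℕ := Equiv.Perm.viaEmbeddingHom ι (Equiv.addRight 1) with hσ
  have hσι : ∀ i, σ (ι i) = ι (i + 1) := fun i => Equiv.Perm.viaEmbedding_apply _ _ _
  have hσ' : ∀ t, t ∉ Set.range ι → σ t = t := fun t ht =>
    Equiv.Perm.viaEmbedding_apply_of_notMem _ _ _ ht
  have h0 : σ 0 = 0 := hσ' 0 (by
    rintro ⟨i, hi⟩
    exact Nat.succ_ne_zero _ hi)
  have h1 : ∀ t : ℕ, IsUnit ((1 : ℕ → ℤ) t) := fun _ => isUnit_one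
  have hσp : σ ^ p = 1 := by
    have h2 : ∀ (k : ℕ) (x : ZMod p), ((Equiv.addRight (1 : ZMod p) : Equiv.Perm (ZMod p)) ^ k) x =
        x + k := by
      intro k
      induction k with
      | zero => simp
      | succ k ih =>
        intro x
        rw [pow_succ', Equiv.Perm.mul_apply, ih, Nat.cast_succ, ← add_assoc]
        rfl
    have h3 : (Equiv.addRight (1 : ZMod p) : Equiv.Perm (ZMod p)) ^ p = 1 :=
      Equiv.ext fun x => by rw [h2]; simp
    rw [hσ, ← map_pow, h3, map_one]
  obtain ⟨a, ha⟩ := hex 0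
  refine TypeD.dvd_card_fixed (h := relabel σ 1) (a := a) (fun z => ?_)
    (relabel_comp_mem_orbit hv.odd hv.odd h0 h1 (fun t ht => ?_) (by simp)) ?_ w
  · rw [relabel_iterate h0, hσp]
    simp [relabel, Int.sign_mul_abs]
  · by_cases htr : t ∈ Set.range ι
    · obtain ⟨i, rfl⟩ := htr
      rw [hσι, hιpos, hιpos]
    · rw [hσ' t htr]
  · intro h
    have h2 := congrArg Int.natAbs h
    rw [natAbs_relabel h0 h1, ha, Int.natAbs_natCast, hσι, zero_add] at h2
    exact one_ne_zero (ι.injective h2)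

/-- Vectors fixed by many generators. -/
theorem HasParts.perm_of_mem_fixed {u v w : SignedPoint n → ℤ} {l l' : List ℕ}
    (hv : HasParts v l) (hw : HasParts w l') (hu : u ∈ fixed v w) (hl : l'.length ≤ l.length) :
    l.Perm l' := by
  obtain ⟨huv, hfac⟩ := mem_fixed.mp hu
  have hodd : IsOdd u := ((mem_orbit_iff hv.odd).mp huv).1
  have hfib : ∀ t, fib u t = fib v t := by
    obtain ⟨x, rfl⟩ := mem_orbit.mp huv
    intro t
    exact Finset.card_equiv x.1 fun a => by simp
  have hex : ∀ j : Fin l.length, ∃ a, u a = ((j : ℕ) + 1 : ℕ) := by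
    intro j
    obtain ⟨x, rfl⟩ := mem_orbit.mp huv
    obtain ⟨a, ha⟩ := hv.exists_eq j
    exact ⟨x.1.symm a, by simp [ha]⟩
  choose a ha using hex
  have hw0 : ∀ j, w (a j) ≠ 0 := fun j h => by
    have h1 := hfac (a j) (-a j) (by rw [hw.odd, h, neg_zero])
    have := hodd.eq_zero h1
    have := ha j
    omega
  -- As `u` is odd and factors through `w`, its absolute value is a function of that of `w`. So `τ`,
  -- which picks a level of `w` inside each level of `u`, is injective; the bound on the lengths
  -- makes it bijective, and then the levels coincide.
  choose τ hτ using fun j => hw.exists_natAbs_eq (hw0 j)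
  have hpm : ∀ b j, (w b).natAbs = (w (a j)).natAbs → u b = ((j : ℕ) + 1 : ℕ) ∧ w b = w (a j) ∨
      u b = -((j : ℕ) + 1 : ℕ) := by
    intro b j h
    rcases Int.natAbs_eq_natAbs_iff.mp h with h | h
    · exact Or.inl ⟨by rw [hfac b (a j) h, ha], h⟩
    · right
      rw [hfac b (-a j) (by rw [h, hw.odd]), hodd, ha]
  have hinj : Function.Injective τ := by
    intro i j hij
    have h := hpm (a i) j (by rw [hτ, hτ, hij])
    rw [ha] at h
    apply Fin.ext
    omega
  have hlen : l.length = l'.length :=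
    le_antisymm (by simpa using Fintype.card_le_of_injective τ hinj) hl
  have hbij : Function.Bijective τ :=
    (Fintype.bijective_iff_injective_and_card τ).mpr ⟨hinj, by simpa using hlen⟩
  refine perm_of_get (Equiv.ofBijective τ hbij) fun j => ?_
  rw [Equiv.ofBijective_apply, ← hw.fib_apply (hτ j), ← hv.fib_eq, ← hfib]
  unfold fib
  congr 1
  refine Finset.filter_congr fun b _ => ⟨fun hb => ?_, fun hb => by rw [hfac b (a j) hb, ha]⟩
  have hb0 : w b ≠ 0 := fun h => by
    have h1 := hodd.eq_zero (hfac b (-b) (by rw [hw.odd, h, neg_zero]))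
    omega
  obtain ⟨i', hi'⟩ := hw.exists_natAbs_eq hb0
  obtain ⟨i, rfl⟩ := hbij.2 i'
  rcases hpm b i (by rw [hi', hτ]) with h | h
  · have : i = j := Fin.ext (by omega)
    rw [h.2, this]
  · omega

/-- The permutations of the values of `v` that arise from the Coxeter group. -/
def valueGroup (v : SignedPoint n → ℤ) : Subgroup (Equiv.Perm (Set.range v)) where
  carrier := {π | ∃ w : coxeterGroup n, ∀ a, (π ⟨v a, a, rfl⟩ : ℤ) = v (w.1 a)}
  one_mem' := ⟨1, fun _ => rfl⟩
  mul_mem' := by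
    rintro π ρ ⟨x, hx⟩ ⟨y, hy⟩
    refine ⟨x * y, fun a => ?_⟩
    have h : ρ ⟨v a, a, rfl⟩ = ⟨v (y.1 a), y.1 a, rfl⟩ := Subtype.ext (hy a)
    rw [Equiv.Perm.mul_apply, h, hx]
    rfl
  inv_mem' := by
    rintro π ⟨x, hx⟩
    refine ⟨x⁻¹, fun a => ?_⟩
    have h : π ⟨v ((x⁻¹).1 a), _, rfl⟩ = ⟨v a, a, rfl⟩ := Subtype.ext (by rw [hx]; simp)
    rw [← h, Equiv.Perm.inv_def, Equiv.symm_apply_apply]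

/-- A member of the orbit that factors through `v` induces a map on the values of `v`. This map is
surjective because every value is taken, and on a finite set that makes it a permutation. -/
theorem card_valueGroup (v : SignedPoint n → ℤ) : Nat.card (valueGroup v) = (fixed v v).card := by
  classical
  have hval : ∀ (π : valueGroup v), (fun a => (π.1 ⟨v a, a, rfl⟩ : ℤ)) ∈ fixed v v := by
    rintro ⟨π, x, hx⟩
    refine mem_fixed.mpr ⟨mem_orbit.mpr ⟨x, funext fun a => (hx a).symm⟩, fun a b hab => ?_⟩
    simp only [hab]
  rw [← Fintype.card_coe, ← Nat.card_eq_fintype_card]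
  refine Nat.card_congr (Equiv.ofBijective (fun π => ⟨_, hval π⟩) ⟨?_, ?_⟩)
  · intro π ρ h
    apply Subtype.ext
    ext ⟨_, a, rfl⟩
    exact congrFun (congrArg Subtype.val h) a
  · rintro ⟨u, hu⟩
    obtain ⟨hu, hfac⟩ := mem_fixed.mp hu
    obtain ⟨x, rfl⟩ := mem_orbit.mp hu
    let g : Set.range v → Set.range v := fun r => ⟨v (x.1 r.2.choose), _, rfl⟩
    have hg : ∀ a, g ⟨v a, a, rfl⟩ = ⟨v (x.1 a), _, rfl⟩ := fun a => by
      have h : ∃ b, v b = v a := ⟨a, rfl⟩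
      exact Subtype.ext (hfac _ _ h.choose_spec)
    have hsurj : Function.Surjective g := by
      rintro ⟨_, b, rfl⟩
      refine ⟨⟨v (x.1.symm b), _, rfl⟩, ?_⟩
      rw [hg]
      simp
    refine ⟨⟨Equiv.ofBijective g ⟨Finite.injective_iff_surjective.mpr hsurj, hsurj⟩, x,
      fun a => congrArg Subtype.val (hg a)⟩, ?_⟩
    apply Subtype.ext
    funext a
    exact congrArg Subtype.val (hg a)

/-- If every multiplicity is less than the odd prime `p`, then the number of vectors in the orbit of
`v` that factor through `v` is prime to `p`. -/
theorem HasParts.exists_le_count {v : SignedPoint n → ℤ} {l : List ℕ} (hv : HasParts v l) {p : ℕ}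
    [hp : Fact p.Prime] (hp2 : p ≠ 2) (h : p ∣ (fixed v v).card) : ∃ c ∈ l, p ≤ l.count c := by
  classical
  rw [← card_valueGroup] at h
  obtain ⟨⟨π, hπ⟩, hord⟩ := exists_prime_orderOf_dvd_card' p h
  rw [Subgroup.orderOf_mk] at hord
  have hπp : π ^ p = 1 := hord ▸ pow_orderOf_eq_one π
  have hneg : ∀ r : Set.range v, -(r : ℤ) ∈ Set.range v := by
    rintro ⟨_, a, rfl⟩
    exact ⟨-a, hv.odd a⟩
  have hodd : ∀ ρ ∈ valueGroup v, ∀ r : Set.range v, (ρ ⟨-r, hneg r⟩ : ℤ) = -(ρ r : ℤ) := by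
    rintro ρ ⟨x, hx⟩ ⟨_, a, rfl⟩
    have h1 := hx (-a)
    simp only [hv.odd a] at h1
    rw [h1, hx, apply_neg, hv.odd]
  have hfib : ∀ ρ ∈ valueGroup v, ∀ r : Set.range v, fib v (ρ r) = fib v r := by
    rintro ρ ⟨x, hx⟩ ⟨_, a, rfl⟩
    refine (Finset.card_equiv x.1 fun b => ?_).symm
    simp only [Finset.mem_filter, Finset.mem_univ, true_and]
    rw [← hx, Subtype.coe_inj, EmbeddingLike.apply_eq_iff_eq]
    exact Subtype.mk_eq_mk.symm
  have hpow : ∀ k : ℕ, π ^ k ∈ valueGroup v := fun k => pow_mem hπ k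
  have hne : π ≠ 1 := by
    rintro rfl
    rw [orderOf_one] at hord
    exact hp.out.one_lt.ne hord
  obtain ⟨r, hr⟩ : ∃ r, π r ≠ r := by
    by_contra! h1
    exact hne (Equiv.ext h1)
  have hzero : ∀ ρ ∈ valueGroup v, (ρ r : ℤ) = 0 → (r : ℤ) = 0 := by
    intro ρ hρ h0
    have h1 := hodd ρ hρ r
    have h2 : ρ ⟨-r, hneg r⟩ = ρ r := Subtype.ext (by omega)
    have h3 := congrArg Subtype.val (ρ.injective h2)
    simp only at h3
    omega
  have hr0 : (r : ℤ) ≠ 0 := by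
    intro h0
    have h1 := hodd π hπ r
    have h2 : (⟨-r, hneg r⟩ : Set.range v) = r := Subtype.ext (by simp only; omega)
    rw [h2] at h1
    exact hr (Subtype.ext (by omega))
  -- If `π ^ k` sent `r` to `r` or `-r`, then `π ^ (2 * k)` would fix `r`, as `π` commutes with
  -- negation. Since `p` is odd, `2 * k` is prime to `p`, and `π` itself would fix `r`. So the `p`
  -- values in the cycle of `r` have distinct absolute values, all of the same multiplicity.
  have hper : ∀ k : ℕ, k < p → 0 < k → ((π ^ k) r : ℤ).natAbs ≠ (r : ℤ).natAbs := by
    intro k hk hk0 h1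
    have h2 : (π ^ (2 * k)) r = r := by
      rw [two_mul, pow_add, Equiv.Perm.mul_apply]
      rcases Int.natAbs_eq_natAbs_iff.mp h1 with h2 | h2
      · rw [Subtype.ext h2, Subtype.ext h2]
      · have h3 : (π ^ k) r = ⟨-r, hneg r⟩ := Subtype.ext h2
        rw [h3]
        exact Subtype.ext (by rw [hodd _ (hpow k), h3, neg_neg])
    have e : ∀ m : ℕ, Function.IsPeriodicPt π m r ↔ (π ^ m) r = r := fun m => by
      rw [Function.IsPeriodicPt, Function.IsFixedPt, Equiv.Perm.iterate_eq_pow]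
    have h3 : Function.IsPeriodicPt π p r := (e p).mpr (by rw [hπp]; rfl)
    have h4 := h3.gcd ((e _).mpr h2)
    have h5 : Nat.gcd p (2 * k) = 1 := by
      rw [← Nat.coprime_iff_gcd_eq_one]
      refine Nat.Coprime.mul_right ?_ ?_
      · exact (Nat.coprime_primes hp.out Nat.prime_two).mpr hp2
      · exact (Nat.coprime_of_lt_prime hk0.ne' hk hp.out)
    rw [h5] at h4
    exact hr h4
  have hinj : ∀ i k : ℕ, i < k → k < p →
      ((π ^ i) r : ℤ).natAbs ≠ ((π ^ k) r : ℤ).natAbs := by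
    intro i k hik hk h1
    refine hper (k - i) (by omega) (by omega) ?_
    have h2 : (π ^ k) r = (π ^ i) ((π ^ (k - i)) r) := by
      rw [← Equiv.Perm.mul_apply, ← pow_add, Nat.add_sub_cancel' hik.le]
    rw [h2] at h1
    rcases Int.natAbs_eq_natAbs_iff.mp h1 with h3 | h3
    · rw [← (π ^ i).injective (Subtype.ext h3)]
    · rw [← hodd _ (hpow i)] at h3
      have h4 := congrArg Subtype.val ((π ^ i).injective (Subtype.ext h3))
      rw [h4, Int.natAbs_neg]
  have hpos : ∀ k : ℕ, ∃ j : Fin l.length, ((π ^ k) r : ℤ).natAbs = (j : ℕ) + 1 ∧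
      l.get j = fib v r := by
    intro k
    obtain ⟨a, ha⟩ := ((π ^ k) r).2
    obtain ⟨j, hj⟩ := hv.exists_natAbs_eq (a := a) (by
      rw [ha]
      exact fun h0 => hr0 (hzero _ (hpow k) h0))
    exact ⟨j, by rw [← ha, hj], by rw [← hv.fib_apply hj, ha, hfib _ (hpow k)]⟩
  choose j hj hj' using hpos
  refine ⟨fib v r, hj' 0 ▸ List.get_mem _ _, ?_⟩
  rw [← card_get_eq, ← Finset.card_range p]
  refine Finset.card_le_card_of_injOn j (fun k _ => by simpa using hj' k) ?_
  intro i hi k hk hik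
  rw [Finset.coe_range, Set.mem_Iio] at hi hk
  have h1 : ((π ^ i) r : ℤ).natAbs = ((π ^ k) r : ℤ).natAbs := by rw [hj, hj, hik]
  rcases lt_trichotomy i k with h2 | h2 | h2
  · exact absurd h1 (hinj i k h2 hk)
  · exact h2
  · exact absurd h1.symm (hinj k i h2 hi)

/-- Parity of the number of fixed vectors. -/
theorem HasParts.even_card_fixed {v : SignedPoint n → ℤ} {l : List ℕ} (hv : HasParts v l)
    (hl : l ≠ []) (h : posSign v = 0 ∨ l.length ≠ 1 ∨ ∃ x ∈ l, Even x)
    (w : SignedPoint n → ℤ) : 2 ∣ (fixed v w).card := by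
  have h0 : (1 : Equiv.Perm ℕ) 0 = 0 := rfl
  -- A change of signs that respects the product sign is an involution of the orbit, and it fixes no
  -- vector as soon as it affects a value that occurs.
  have key : ∀ ε : ℕ → ℤ, (∀ t, IsUnit (ε t)) → (∃ j : Fin l.length, ε ((j : ℕ) + 1) = -1) →
      (∏ a ∈ Finset.univ.filter (fun a : SignedPoint n => 0 < (a : ℤ)), ε (v a).natAbs) *
        posSign v = posSign v → 2 ∣ (fixed v w).card := by
    rintro ε hε ⟨j, hj⟩ hs
    obtain ⟨a, ha⟩ := hv.exists_eq j
    refine TypeD.dvd_card_fixed (p := 2) (h := relabel 1 ε) (a := a)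
      (fun z => relabel_one_involutive hε z)
      (relabel_comp_mem_orbit hv.odd hv.odd h0 hε (fun t _ => rfl) hs) ?_ w
    intro h1
    have h2 := congrArg Int.sign h1
    rw [sign_relabel h0 hε, ha, Int.natAbs_natCast, hj,
      Int.sign_eq_one_of_pos (by positivity)] at h2
    omega
  -- A single value can change its sign if its multiplicity is even, or if a zero coordinate makes
  -- the product sign irrelevant.
  have single : ∀ j : Fin l.length, posSign v = 0 ∨ Even (l.get j) → 2 ∣ (fixed v w).card := by
    intro j hj
    refine key (flip ((j : ℕ) + 1)) (isUnit_flip _) ⟨j, if_pos rfl⟩ ?_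
    rcases hj with hj | hj
    · rw [hj, mul_zero]
    · rw [hv.odd.prod_flip (Nat.succ_pos _), hv.fib_eq, hj.neg_one_pow, one_mul]
  have hlen : 0 < l.length := List.length_pos_iff.mpr hl
  rcases h with h | h | ⟨x, hx, hx'⟩
  · exact single ⟨0, hlen⟩ (Or.inl h)
  · by_cases hi : Even (l.get ⟨0, hlen⟩)
    · exact single _ (Or.inr hi)
    by_cases hj : Even (l.get ⟨1, by omega⟩)
    · exact single _ (Or.inr hj)
    -- Two values of odd multiplicity change sign together, and their effects on the product sign
    -- cancel.
    refine key (fun t => flip 1 t * flip 2 t) (fun t => (isUnit_flip _ _).mul (isUnit_flip _ _))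
      ⟨⟨0, hlen⟩, by simp [flip]⟩ ?_
    have e1 := hv.fib_eq ⟨0, hlen⟩
    have e2 := hv.fib_eq ⟨1, by omega⟩
    rw [Finset.prod_mul_distrib, hv.odd.prod_flip one_pos, hv.odd.prod_flip two_pos]
    simp only [zero_add, one_add_one_eq_two] at e1 e2
    rw [e1, e2, (Nat.not_even_iff_odd.mp hi).neg_one_pow, (Nat.not_even_iff_odd.mp hj).neg_one_pow]
    ring
  · obtain ⟨j, rfl⟩ := List.mem_iff_get.mp hx
    exact single j (Or.inr hx')

/-- A vector with coordinates `± 1`, an odd number of them. -/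
theorem HasParts.card_fixed_self_eq_one {v : SignedPoint n → ℤ} {m : ℕ} (hv : HasParts v [m])
    (hs : posSign v ≠ 0) (hm : Odd m) : (fixed v v).card = 1 := by
  rw [Finset.card_eq_one]
  refine ⟨v, Finset.eq_singleton_iff_unique_mem.mpr
    ⟨mem_fixed.mpr ⟨mem_orbit.mpr ⟨1, rfl⟩, fun _ _ h => h⟩, fun u hu => ?_⟩⟩
  obtain ⟨hu, hfac⟩ := mem_fixed.mp hu
  obtain ⟨hodd, -, hsu⟩ := (mem_orbit_iff hv.odd).mp hu
  obtain ⟨x, rfl⟩ := mem_orbit.mp hu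
  have hone : ∀ a, (v a).natAbs = 1 := fun a => by
    have h1 := hv.natAbs_le a
    have h2 := posSign_ne_zero hv.odd hs a
    rw [List.length_singleton] at h1
    omega
  obtain ⟨a, ha⟩ := hv.exists_eq ⟨0, by simp⟩
  simp only [zero_add, Nat.cast_one] at ha
  -- An odd vector that factors through `v`, whose values are 1 and -1, is determined by its value
  -- at one point. The multiple `-v` is excluded because an odd number of sign changes reverses the
  -- product sign.
  have hval : ∀ c : ℤ, v (x.1 a) = c → v ∘ x.1 = fun b => c * v b := by
    intro c hc
    funext b
    rcases Int.natAbs_eq_natAbs_iff.mp ((hone b).trans (hone a).symm) with h1 | h1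
    · rw [hfac b a h1, h1, ha, mul_one]
      exact hc
    · rw [hfac b (-a) (by rw [h1, hv.odd]), hodd, h1, ha]
      simp only [Function.comp, hc]
      ring
  have h1 := hone (x.1 a)
  rcases Int.natAbs_eq (v (x.1 a)) with h2 | h2
  · rw [hval 1 (by rw [h2, h1]; rfl)]
    simp
  · exfalso
    have h3 := hval (-1) (by rw [h2, h1]; rfl)
    have h4 : v ∘ x.1 = relabel 1 (flip 1) ∘ v := by
      rw [h3]
      funext b
      have := hone b
      simp only [Function.comp, relabel, this, flip, if_true]
      rw [Equiv.Perm.coe_one, id, Nat.cast_one, mul_one]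
      congr 1
      rw [← Int.sign_mul_natAbs (v b), this]
      simp
    rw [h4, posSign_relabel v rfl (isUnit_flip 1), hv.odd.prod_flip one_pos] at hsu
    have h5 := hv.fib_eq ⟨0, by simp⟩
    simp only [zero_add, List.get_eq_getElem, List.getElem_cons_zero] at h5
    rw [h5, hm.neg_one_pow] at hsu
    omega

end Parts

/-! ### Blocks of compositions and their partial sums -/

section Levels

variable {m : ℕ} (c : Composition m)

/-- The generator of index 0, listed separately for compositions of `n`, is the empty partial sum.
This makes the description of the subsets uniform. -/
theorem exists_sizeUpTo_iff (hm : 0 < m) (i : ℕ) :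
    (i = 0 ∨ ∃ j, 1 ≤ j ∧ j < c.length ∧ i = c.sizeUpTo j) ↔ ∃ j < c.length, c.sizeUpTo j = i := by
  constructor
  · rintro (rfl | ⟨j, _, h2, rfl⟩)
    · exact ⟨0, c.length_pos_of_pos hm, c.sizeUpTo_zero⟩
    · exact ⟨j, h2, rfl⟩
  · rintro ⟨j, hj, rfl⟩
    rcases Nat.eq_zero_or_pos j with rfl | h
    · exact Or.inl c.sizeUpTo_zero
    · exact Or.inr ⟨j, h, hj, rfl⟩

theorem head?_blocks (hm : 0 < m) : c.blocks.head? = some (c.sizeUpTo 1) := by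
  have h := c.blocks_sum
  unfold Composition.sizeUpTo
  cases hb : c.blocks with
  | nil => rw [hb, List.sum_nil] at h; omega
  | cons a l => simp

theorem sizeUpTo_lt {i j : ℕ} (hij : i < j) (hj : j ≤ c.length) :
    c.sizeUpTo i < c.sizeUpTo j :=
  (c.sizeUpTo_strict_mono (by omega)).trans_le (c.monotone_sizeUpTo hij)

/-- The index (starting with `1`) of the block that contains the position `x`, if the blocks of `c`
follow a block of size `k` with index `0`. -/
def level (k : ℕ) (x : ℤ) : ℕ :=
  ((Finset.range c.length).filter fun j => ((k + c.sizeUpTo j : ℕ) : ℤ) < x).card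

theorem level_le (k : ℕ) (x : ℤ) : level c k x ≤ c.length :=
  (Finset.card_filter_le _ _).trans (Finset.card_range _).le

theorem lt_level_iff (k : ℕ) (x : ℤ) {j : ℕ} (hj : j < c.length) :
    j < level c k x ↔ ((k + c.sizeUpTo j : ℕ) : ℤ) < x := by
  constructor
  · intro h
    by_contra h1
    have h2 : ((Finset.range c.length).filter fun j => ((k + c.sizeUpTo j : ℕ) : ℤ) < x) ⊆
        Finset.range j := by
      intro i hi
      rw [Finset.mem_filter] at hi
      rw [Finset.mem_range]
      by_contra h3
      have := c.monotone_sizeUpTo (not_lt.mp h3)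
      omega
    have := Finset.card_le_card h2
    rw [Finset.card_range] at this
    exact absurd h (not_lt.mpr this)
  · intro h
    have h2 : Finset.range (j + 1) ⊆
        ((Finset.range c.length).filter fun j => ((k + c.sizeUpTo j : ℕ) : ℤ) < x) := by
      intro i hi
      rw [Finset.mem_range] at hi
      rw [Finset.mem_filter, Finset.mem_range]
      have := c.monotone_sizeUpTo (Nat.lt_succ_iff.mp hi)
      exact ⟨by omega, by omega⟩
    have := Finset.card_le_card h2
    rw [Finset.card_range] at this
    exact this

theorem level_eq_iff {k : ℕ} {x : ℤ} (hx : x ≤ k + m) {j : ℕ} (hj : j < c.length) :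
    level c k x = j + 1 ↔
      ((k + c.sizeUpTo j : ℕ) : ℤ) < x ∧ x ≤ ((k + c.sizeUpTo (j + 1) : ℕ) : ℤ) := by
  rw [← lt_level_iff c k x hj]
  by_cases hj' : j + 1 < c.length
  · rw [← not_lt, ← lt_level_iff c k x hj']
    omega
  · have h1 := level_le c k x
    have h2 : j + 1 = c.length := by omega
    rw [h2, c.sizeUpTo_length]
    push_cast
    omega

theorem level_mono (k : ℕ) {x y : ℤ} (hxy : x ≤ y) : level c k x ≤ level c k y :=
  Finset.card_le_card (Finset.monotone_filter_right _ fun _ _ h => lt_of_lt_of_le h hxy)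

theorem level_succ_eq_iff (k i : ℕ) :
    level c k (i : ℤ) = level c k ((i : ℤ) + 1) ↔ ¬ ∃ j < c.length, k + c.sizeUpTo j = i := by
  constructor
  · rintro h ⟨j, hj, hji⟩
    have h1 := lt_level_iff c k i hj
    have h2 := lt_level_iff c k (i + 1) hj
    omega
  · intro h
    unfold level
    congr 1
    refine Finset.filter_congr fun j hj => ?_
    have : k + c.sizeUpTo j ≠ i := fun h1 => h ⟨j, Finset.mem_range.mp hj, h1⟩
    omega

theorem level_eq_zero {k : ℕ} {x : ℤ} (hx : x ≤ k) : level c k x = 0 := by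
  rw [level, Finset.card_eq_zero, Finset.filter_eq_empty_iff]
  intro j _
  omega

theorem level_pos (hm : 0 < m) {x : ℤ} (hx : 0 < x) : 0 < level c 0 x := by
  rw [lt_level_iff c 0 x (c.length_pos_of_pos hm), c.sizeUpTo_zero]
  simpa using hx

theorem level_eq_one (hm : 0 < m) {x : ℤ} (hx : 0 < x) (h : x ≤ c.sizeUpTo 1) :
    level c 0 x = 1 := by
  have h1 := c.sizeUpTo_le 1
  rw [level_eq_iff c (by omega) (c.length_pos_of_pos hm), c.sizeUpTo_zero]
  simp only [zero_add]
  exact ⟨by simpa using hx, h⟩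

/-- A composition with a prescribed set of partial sums. -/
theorem exists_composition (B : Set ℕ) (hB : 0 < m → 0 ∈ B) :
    ∃ c : Composition m, ∀ i < m, (∃ j < c.length, c.sizeUpTo j = i) ↔ i ∈ B := by
  classical
  let d : CompositionAsSet m :=
    { boundaries := Finset.univ.filter fun i => (i : ℕ) ∈ B ∨ i = Fin.last m
      zero_mem := by
        rw [Finset.mem_filter]
        refine ⟨Finset.mem_univ _, ?_⟩
        rcases Nat.eq_zero_or_pos m with rfl | h
        · exact Or.inr rfl
        · exact Or.inl (hB h)
      getLast_mem := by simp }
  refine ⟨d.toComposition, fun i hi => ?_⟩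
  have h1 := d.toComposition_boundaries
  have h2 : (⟨i, by omega⟩ : Fin (m + 1)) ∈ d.toComposition.boundaries ↔ i ∈ B := by
    rw [h1]
    simp only [d, Finset.mem_filter, Finset.mem_univ, true_and, Fin.ext_iff, Fin.val_last]
    exact ⟨fun h => h.resolve_right hi.ne, Or.inl⟩
  rw [← h2, Composition.boundaries, Finset.mem_map]
  constructor
  · rintro ⟨j, hj, hji⟩
    exact ⟨⟨j, by omega⟩, Finset.mem_univ _, Fin.ext hji⟩
  · rintro ⟨j, -, hji⟩
    have hji : d.toComposition.sizeUpTo j = i := congrArg Fin.val hji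
    refine ⟨j, ?_, hji⟩
    by_contra h
    have : (j : ℕ) = d.toComposition.length := by have := j.2; omega
    rw [this, Composition.sizeUpTo_length] at hji
    omega

end Levels

/-! ### The vector of a composition -/

section Compositions

variable {n : ℕ} [hn : Fact (2 ≤ n)]

namespace DComposition

/-- The number of coordinates that do not belong to a component. -/
def offset : DComposition n → ℕ
  | below m _ _ => n - m
  | _ => 0

/-- The sum of the components. -/
def total : DComposition n → ℕ
  | below m _ _ => m
  | _ => n

/-- The underlying composition. -/
def composition : (κ : DComposition n) → Composition κ.total
  | below _ _ c => c
  | one c _ => c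
  | top c _ => c
  | dual c _ => c

theorem offset_add_total (κ : DComposition n) : κ.offset + κ.total = n := by
  cases κ <;> simp only [offset, total] <;> omega

theorem blocks_composition (κ : DComposition n) : κ.composition.blocks = κ.components := by
  cases κ <;> rfl

theorem length_composition (κ : DComposition n) : κ.composition.length = κ.components.length := by
  rw [← blocks_composition]

open Classical in
/-- The dominant vector of type `κ`. -/
noncomputable def vector (κ : DComposition n) (a : SignedPoint n) : ℤ :=
  (if κ.IsDual ∧ (a : ℤ).natAbs = 1 then -1 else 1) *
    ((a : ℤ).sign * level κ.composition κ.offset (a : ℤ).natAbs)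

theorem isOdd_vector (κ : DComposition n) : IsOdd κ.vector := fun a => by
  have e : ((-a : SignedPoint n) : ℤ).natAbs = (a : ℤ).natAbs := by rw [coe_neg, Int.natAbs_neg]
  unfold vector
  by_cases h : κ.IsDual ∧ (a : ℤ).natAbs = 1
  · rw [if_pos h, if_pos (by rwa [e]), e, coe_neg, Int.sign_neg]
    ring
  · rw [if_neg h, if_neg (by rwa [e]), e, coe_neg, Int.sign_neg]
    ring

theorem natAbs_vector (κ : DComposition n) (a : SignedPoint n) :
    (κ.vector a).natAbs = level κ.composition κ.offset (a : ℤ).natAbs := by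
  unfold vector
  rw [Int.natAbs_mul, Int.natAbs_mul, Int.natAbs_sign_of_ne_zero a.2.1]
  split_ifs <;> simp

theorem vector_of_pos (κ : DComposition n) {a : SignedPoint n} (ha : 0 < (a : ℤ))
    (h : ¬ (κ.IsDual ∧ (a : ℤ) = 1)) : κ.vector a = level κ.composition κ.offset a := by
  unfold vector
  rw [if_neg (fun h1 => h ⟨h1.1, by omega⟩), one_mul, Int.sign_eq_one_of_pos ha, one_mul,
    Int.natAbs_of_nonneg ha.le]

/-- The positive points of a given level are the integers in a half-open interval between
consecutive partial sums. -/
theorem hasParts_vector (κ : DComposition n) : HasParts κ.vector κ.components where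
  odd := κ.isOdd_vector
  pos x hx := by
    rw [← blocks_composition] at hx
    exact κ.composition.blocks_pos hx
  natAbs_le a := by
    rw [natAbs_vector, ← length_composition]
    exact level_le _ _ _
  fib_eq j := by
    have hj : (j : ℕ) < κ.composition.length := by
      rw [length_composition]
      exact j.2
    have hsum := κ.offset_add_total
    have h1 := κ.composition.sizeUpTo_succ hj
    have h2 := κ.composition.sizeUpTo_le ((j : ℕ) + 1)
    have h3 : κ.components.get j = κ.composition.blocks[(j : ℕ)] := by
      simp only [List.get_eq_getElem, blocks_composition]
    rw [← κ.isOdd_vector.card_pos_filter (Nat.succ_pos _), h3]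
    have h4 : κ.composition.blocks[(j : ℕ)] =
        (Finset.Ioc ((κ.offset + κ.composition.sizeUpTo j : ℕ) : ℤ)
          ((κ.offset + κ.composition.sizeUpTo (j + 1) : ℕ) : ℤ)).card := by
      rw [Int.card_Ioc]
      omega
    rw [h4]
    refine Finset.card_bij (fun a _ => (a : ℤ)) ?_ ?_ ?_
    · intro a ha
      obtain ⟨-, ha0, ha⟩ := Finset.mem_filter.mp ha
      have := a.2
      rw [natAbs_vector, level_eq_iff _ (by omega) hj] at ha
      rw [Finset.mem_Ioc]
      omega
    · intro a _ b _ h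
      exact Subtype.ext h
    · intro b hb
      rw [Finset.mem_Ioc] at hb
      refine ⟨⟨b, by omega⟩, ?_, rfl⟩
      rw [Finset.mem_filter, natAbs_vector, level_eq_iff _ (by simp only; omega) hj]
      simp only [Finset.mem_univ, true_and]
      omega

theorem sizeUpTo_one_ge {c : Composition n} (h : ∃ a ∈ c.blocks.head?, 2 ≤ a) :
    2 ≤ c.sizeUpTo 1 := by
  have h2 := hn.out
  rw [head?_blocks c (by omega)] at h
  obtain ⟨a, ha, h⟩ := h
  rw [Option.mem_some_iff] at ha
  omega

/-- The level jumps exactly at the partial sums, that is, at the generators in `κ.subset`. In the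
dual case the first component is at least 2, so negating the coordinate at 1 gives -1 and 1 at the
points 1 and 2; then `s_{1'}` fixes the vector and `s_1` does not. -/
theorem isFaceVector_vector (κ : DComposition n) : IsFaceVector κ.vector κ.subsetᶜ := by
  have h2 := hn.out
  have key : ∀ i, κ.vector (lo i) ≤ κ.vector (hi i) ∧
      (κ.vector (lo i) = κ.vector (hi i) ↔ i ∉ κ.subset) := by
    intro i
    have hhi : 0 < ((hi i : SignedPoint n) : ℤ) := by rw [coe_hi]; split_ifs <;> omega
    have hhi1 : ((hi i : SignedPoint n) : ℤ) ≠ 1 := by rw [coe_hi]; split_ifs <;> omega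
    rw [κ.vector_of_pos hhi fun h => hhi1 h.2]
    by_cases hi0 : (i : ℕ) = 0
    · have hl : ((lo i : SignedPoint n) : ℤ) = -1 := by rw [coe_lo, if_pos hi0]
      have hh : ((hi i : SignedPoint n) : ℤ) = 2 := by rw [coe_hi, if_pos hi0]
      have hv : κ.vector (lo i) = - κ.vector ⟨1, by omega⟩ := by
        rw [← κ.isOdd_vector]
        congr 1
        exact Subtype.ext hl
      rw [hh, hv]
      cases κ with
      | below m hm c =>
        rw [vector_of_pos _ Int.one_pos (by rintro ⟨h, -⟩; exact h)]
        simp only [offset, composition, total, subset, Set.mem_ofPred_eq]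
        rw [level_eq_zero c (by omega), level_eq_zero c (by omega)]
        simp only [Nat.cast_zero, neg_zero, le_refl, true_iff, true_and]
        rintro ⟨j, _, hj⟩
        omega
      | one c h =>
        rw [vector_of_pos _ Int.one_pos (by rintro ⟨h, -⟩; exact h)]
        have h3 := level_pos c (by omega) (x := 1) (by omega)
        have h4 := level_pos c (by omega) (x := 2) (by omega)
        simp only [offset, composition, total, subset, Set.mem_ofPred_eq, hi0, true_or, not_true,
          iff_false]
        omega
      | top c h =>
        rw [vector_of_pos _ Int.one_pos (by rintro ⟨h, -⟩; exact h)]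
        have h3 := level_pos c (by omega) (x := 1) (by omega)
        have h4 := level_pos c (by omega) (x := 2) (by omega)
        simp only [offset, composition, total, subset, Set.mem_ofPred_eq, hi0, true_or, not_true,
          iff_false]
        omega
      | dual c h =>
        have h5 := sizeUpTo_one_ge h
        have h3 := level_eq_one c (by omega) (x := 1) (by omega) (by omega)
        have h4 := level_eq_one c (by omega) (x := 2) (by omega) (by omega)
        have h6 : ¬ ∃ j, 1 ≤ j ∧ j < c.length ∧ 0 = c.sizeUpTo j := by
          rintro ⟨j, hj, _, hj0⟩
          have := c.monotone_sizeUpTo hj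
          omega
        simp [vector, offset, composition, total, subset, IsDual, hi0, h3, h4, h6]
    · have hl : ((lo i : SignedPoint n) : ℤ) = (i : ℤ) := by rw [coe_lo, if_neg hi0]
      have hh : ((hi i : SignedPoint n) : ℤ) = (i : ℤ) + 1 := by rw [coe_hi, if_neg hi0]
      have hlpos : 0 < ((lo i : SignedPoint n) : ℤ) := by omega
      have hmono := fun (m k : ℕ) (c : Composition m) =>
        level_mono c k (x := i) (y := (i : ℤ) + 1) (by omega)
      have hiff := fun (m k : ℕ) (c : Composition m) => level_succ_eq_iff c k i
      by_cases hd : κ.IsDual ∧ ((lo i : SignedPoint n) : ℤ) = 1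
      · cases κ with
        | below m hm c => exact hd.1.elim
        | one c h => exact hd.1.elim
        | top c h => exact hd.1.elim
        | dual c h =>
          have h5 := sizeUpTo_one_ge h
          have h3 := level_eq_one c (by omega) (x := 1) (by omega) (by omega)
          have h4 := level_eq_one c (by omega) (x := 2) (by omega) (by omega)
          have hi1 : (i : ℕ) = 1 := by omega
          simp [vector, offset, composition, total, subset, IsDual, hl, hh, hi1, h3, h4]
      · rw [vector_of_pos _ hlpos hd, hl, hh]
        refine ⟨by exact_mod_cast hmono _ _ _, ?_⟩
        rw [Nat.cast_inj, hiff]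
        apply not_congr
        cases κ with
        | below m hm c =>
          simp only [offset, composition, total, subset, Set.mem_ofPred_eq, eq_comm]
        | one c h =>
          simp only [offset, composition, total, subset, Set.mem_ofPred_eq, zero_add]
          rw [exists_sizeUpTo_iff c (by omega)]
        | top c h =>
          simp only [offset, composition, total, subset, Set.mem_ofPred_eq, zero_add]
          rw [exists_sizeUpTo_iff c (by omega)]
        | dual c h =>
          have hi1 : (i : ℕ) ≠ 1 := fun h1 => hd ⟨trivial, by omega⟩
          simp only [offset, composition, total, subset, Set.mem_ofPred_eq, zero_add]
          rw [← exists_sizeUpTo_iff c (by omega)]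
          simp only [hi0, hi1, false_or]
  exact ⟨κ.isOdd_vector, fun i => (key i).1, fun i => (key i).2⟩

theorem posSign_vector_below (m : ℕ) (hm : m + 2 ≤ n) (c : Composition m) :
    posSign (below m hm c).vector = 0 := by
  refine Finset.prod_eq_zero (i := ⟨1, by omega⟩) (by simp) ?_
  rw [Int.sign_eq_zero_iff_zero, ← Int.natAbs_eq_zero, natAbs_vector]
  exact level_eq_zero c (by simp only [offset]; omega)

theorem posSign_vector_of_not_isDual {κ : DComposition n} (h0 : κ.offset = 0)
    (h : ¬ κ.IsDual) : posSign κ.vector = 1 := by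
  have h2 := hn.out
  have h1 := κ.offset_add_total
  refine Finset.prod_eq_one fun a ha => ?_
  rw [Finset.mem_filter] at ha
  rw [κ.vector_of_pos ha.2 fun h' => h h'.1, h0]
  apply Int.sign_eq_one_of_pos
  exact_mod_cast level_pos κ.composition (by omega) ha.2

theorem posSign_vector_dual (c : Composition n) (h : ∃ a ∈ c.blocks.head?, 2 ≤ a) :
    posSign (dual c h).vector = -1 := by
  have h2 := hn.out
  unfold posSign
  rw [Finset.prod_eq_single (⟨1, by omega⟩ : SignedPoint n)]
  · have h3 := level_pos c (by omega) (x := 1) (by omega)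
    simp [vector, IsDual, offset, composition, total, h3]
  · intro a ha ha1
    rw [Finset.mem_filter] at ha
    rw [vector_of_pos _ ha.2 fun h' => ha1 (Subtype.ext h'.2)]
    apply Int.sign_eq_one_of_pos
    exact_mod_cast level_pos c (by omega) ha.2
  · simp

/-- Zeros occur only for compositions of some `m ≤ n - 2`, and then all of ±1 and ±2 are zeros. This
is the condition that `fixCount_eq` needs. -/
theorem exists_zero_of_vector_eq_zero (κ : DComposition n) (a : SignedPoint n)
    (ha : κ.vector a = 0) : ∃ b, b ≠ a ∧ b ≠ -a ∧ κ.vector b = 0 := by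
  have h2 := hn.out
  cases κ with
  | below m hm c =>
    have h : ∀ b : SignedPoint n, (b : ℤ).natAbs ≤ 2 → (below m hm c).vector b = 0 := by
      intro b hb
      rw [← Int.natAbs_eq_zero, natAbs_vector]
      exact level_eq_zero c (by simp only [offset]; omega)
    simp only [Ne, Subtype.ext_iff, coe_neg]
    by_cases h1 : (a : ℤ).natAbs = 1
    · exact ⟨⟨2, by omega⟩, by simp only; omega, by simp only; omega, h _ (by simp)⟩
    · exact ⟨⟨1, by omega⟩, by simp only; omega, by simp only; omega, h _ (by simp)⟩
  | one c h =>
    exact absurd ha (posSign_ne_zero (isOdd_vector _)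
      (by rw [posSign_vector_of_not_isDual rfl (by rintro ⟨⟩)]; exact one_ne_zero) a)
  | top c h =>
    exact absurd ha (posSign_ne_zero (isOdd_vector _)
      (by rw [posSign_vector_of_not_isDual rfl (by rintro ⟨⟩)]; exact one_ne_zero) a)
  | dual c h =>
    exact absurd ha (posSign_ne_zero (isOdd_vector _) (by rw [posSign_vector_dual]; decide) a)

/-- The kind of κ depends on which of the indices 0 and 1 lie in `K`: both give `one`, only 0 gives
`top`, only 1 gives `dual`, and neither gives `below`, where `m` is `n` minus the least element of
`K`, or 0 if `K` is empty. -/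
theorem exists_subset_eq (K : Set (Fin n)) : ∃ κ : DComposition n, κ.subset = K := by
  have h2 := hn.out
  have full : ∀ B : Set ℕ, 0 ∈ B → ∃ c : Composition n,
      (∀ i < n, (i = 0 ∨ ∃ j, 1 ≤ j ∧ j < c.length ∧ i = c.sizeUpTo j) ↔ i ∈ B) ∧
      (1 ∈ B → ∃ a ∈ c.blocks.head?, a = 1) ∧ (1 ∉ B → ∃ a ∈ c.blocks.head?, 2 ≤ a) := by
    intro B hB
    obtain ⟨c, hc⟩ := exists_composition (m := n) B fun _ => hB
    have hlen := c.length_pos_of_pos (by omega)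
    have hpos : 0 < c.sizeUpTo 1 := by
      have := sizeUpTo_lt c one_pos hlen
      omega
    refine ⟨c, fun i hi => by rw [exists_sizeUpTo_iff c (by omega), hc i hi], fun h1 => ?_,
      fun h1 => ?_⟩
    · rw [head?_blocks c (by omega)]
      refine ⟨_, rfl, ?_⟩
      obtain ⟨j, hj, hj1⟩ := (hc 1 (by omega)).mpr h1
      have hj0 : 1 ≤ j := by
        by_contra h
        rw [show j = 0 by omega, c.sizeUpTo_zero] at hj1
        omega
      have := c.monotone_sizeUpTo hj0
      omega
    · rw [head?_blocks c (by omega)]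
      refine ⟨_, rfl, ?_⟩
      by_contra h
      have h3 : c.sizeUpTo 1 = 1 := by omega
      refine h1 ((hc 1 (by omega)).mp ⟨1, ?_, h3⟩)
      by_contra h4
      have := c.sizeUpTo_ofLength_le 1 (not_lt.mp h4)
      omega
  by_cases h0 : (⟨0, by omega⟩ : Fin n) ∈ K
  · obtain ⟨c, hc, hc1, hc2⟩ := full (Fin.val '' K) ⟨_, h0, rfl⟩
    have hmem : ∀ i : Fin n, ((i : ℕ) = 0 ∨ ∃ j, 1 ≤ j ∧ j < c.length ∧ (i : ℕ) = c.sizeUpTo j) ↔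
        i ∈ K := fun i => by rw [hc i i.2, Fin.val_injective.mem_set_image]
    by_cases h1 : 1 ∈ Fin.val '' K
    · exact ⟨one c (hc1 h1), Set.ext hmem⟩
    · exact ⟨top c (hc2 h1), Set.ext hmem⟩
  · by_cases h1 : (⟨1, by omega⟩ : Fin n) ∈ K
    -- In the dual case the index 1 stands in for the initial partial sum 0, so it is exchanged for
    -- 0.
    · obtain ⟨c, hc, -, hc2⟩ := full (insert 0 (Fin.val '' (K \ {⟨1, by omega⟩})))
        (Set.mem_insert _ _)
      have h3 : 1 ∉ insert 0 (Fin.val '' (K \ {⟨1, by omega⟩})) := by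
        rw [Set.mem_insert_iff, not_or]
        refine ⟨one_ne_zero, ?_⟩
        rintro ⟨i, hi, hi1⟩
        exact hi.2 (Fin.ext hi1)
      refine ⟨dual c (hc2 h3), Set.ext fun i => ?_⟩
      have h4 := hc i i.2
      rw [Set.mem_insert_iff, Fin.val_injective.mem_set_image] at h4
      simp only [subset, Set.mem_ofPred_eq]
      by_cases hi1 : (i : ℕ) = 1
      · simp only [hi1, true_or, true_iff]
        rwa [show i = ⟨1, by omega⟩ from Fin.ext hi1]
      · by_cases hi0 : (i : ℕ) = 0
        · have h5 : i ∉ K := by rwa [show i = ⟨0, by omega⟩ from Fin.ext hi0]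
          have h6 := sizeUpTo_one_ge (hc2 h3)
          simp only [hi1, false_or, h5, iff_false]
          rintro ⟨j, hj, _, hj0⟩
          have := c.monotone_sizeUpTo hj
          omega
        · have h5 : i ∈ K \ {⟨1, by omega⟩} ↔ i ∈ K :=
            ⟨fun h => h.1, fun h => ⟨h, fun h' => hi1 (congrArg Fin.val h')⟩⟩
          simp only [hi1, false_or]
          simpa only [hi0, false_or, h5] using h4
    · by_cases hK : K = ∅
      · refine ⟨below 0 (by omega) (Composition.ones 0), ?_⟩
        rw [hK]
        ext i
        simp [subset]
      · obtain ⟨k, hk, hmin⟩ : ∃ k ∈ K, ∀ i ∈ K, k ≤ i := by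
          obtain ⟨k, hk⟩ := Set.nonempty_iff_ne_empty.mpr hK
          exact (Set.toFinite K).exists_minimal ⟨k, hk⟩ |>.imp fun x hx =>
            ⟨hx.1, fun i hi => by
              rcases le_total x i with h | h
              · exact h
              · exact hx.2 hi h⟩
        have hk2 : 2 ≤ (k : ℕ) := by
          by_contra h
          have : (k : ℕ) = 0 ∨ (k : ℕ) = 1 := by omega
          rcases this with h | h
          · exact h0 (by rwa [show (⟨0, by omega⟩ : Fin n) = k from Fin.ext h.symm])
          · exact h1 (by rwa [show (⟨1, by omega⟩ : Fin n) = k from Fin.ext h.symm])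
        have hkn := k.2
        obtain ⟨c, hc⟩ := exists_composition (m := n - k) {i | ∃ x ∈ K, (x : ℕ) = k + i}
          fun _ => ⟨k, hk, rfl⟩
        refine ⟨below (n - k) (by omega) c, Set.ext fun i => ?_⟩
        simp only [subset, Set.mem_ofPred_eq]
        rw [Nat.sub_sub_self hkn.le]
        constructor
        · rintro ⟨j, hj, hi⟩
          have hlt : c.sizeUpTo j < n - k := by
            have := i.2
            omega
          obtain ⟨x, hx, hxj⟩ := (hc _ hlt).mp ⟨j, hj, rfl⟩
          rwa [show i = x from Fin.ext (by omega)]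
        · intro hi
          have h3 : (k : ℕ) ≤ i := hmin i hi
          have h4 := i.2
          obtain ⟨j, hj, hj'⟩ := (hc (i - k) (by omega)).mpr ⟨i, hi, by omega⟩
          exact ⟨j, hj, by omega⟩

end DComposition

end Compositions

/-! ### The character table modulo p and the radical -/

section Radical

variable {n : ℕ} [hn : Fact (2 ≤ n)]

namespace DComposition

theorem sum_components (κ : DComposition n) : κ.components.sum = κ.total := by
  rw [← blocks_composition, Composition.blocks_sum]

theorem offset_ne_zero_or (κ : DComposition n) :
    κ.offset ≠ 0 ∧ posSign κ.vector = 0 ∨ κ.offset = 0 ∧ κ.IsDual ∧ posSign κ.vector = -1 ∨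
      κ.offset = 0 ∧ ¬ κ.IsDual ∧ posSign κ.vector = 1 := by
  cases κ with
  | below m hm c =>
    exact Or.inl ⟨by simp only [offset]; omega, posSign_vector_below m hm c⟩
  | one c h =>
    exact Or.inr (Or.inr ⟨rfl, id, posSign_vector_of_not_isDual rfl id⟩)
  | top c h =>
    exact Or.inr (Or.inr ⟨rfl, id, posSign_vector_of_not_isDual rfl id⟩)
  | dual c h =>
    exact Or.inr (Or.inl ⟨rfl, trivial, posSign_vector_dual c h⟩)

theorem isTop_of_even {κ : DComposition n} (h0 : κ.offset = 0) (hd : ¬ κ.IsDual)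
    (h : ∀ a ∈ κ.components, Even a) : κ.IsTop := by
  cases κ with
  | below m hm c =>
    simp only [offset] at h0
    omega
  | one c hc =>
    obtain ⟨a, ha, rfl⟩ := hc
    exact absurd (h 1 (List.mem_of_mem_head? ha)) (by decide)
  | top c hc => trivial
  | dual c hc => exact absurd trivial hd

namespace Equivalent

variable {κ ν : DComposition n}

theorem symm (h : κ.Equivalent ν) : ν.Equivalent κ :=
  ⟨h.1.symm, fun h' => h.2.2 ⟨h'.2.1, h'.1, fun a ha => h'.2.2 a (h.1.subset ha)⟩,
    fun h' => h.2.1 ⟨h'.2.1, h'.1, fun a ha => h'.2.2 a (h.1.subset ha)⟩⟩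

/-- Equal component sums give equal offsets, so the signs differ only if exactly one of κ, ν is
dual. Were all components even, the other would lie in 𝒞_n, as a first component 1 is odd, and this
pair is excluded from ≈. -/
theorem posSign (h : κ.Equivalent ν) : posSign κ.vector = posSign ν.vector ∨
    TypeD.posSign ν.vector = -TypeD.posSign κ.vector ∧ ∃ x ∈ κ.components, ¬ Even x := by
  have hoff : κ.offset = ν.offset := by
    have h1 := h.1.sum_eq
    rw [sum_components, sum_components] at h1
    have h2 := κ.offset_add_total
    have h3 := ν.offset_add_total
    omega
  rcases κ.offset_ne_zero_or with ⟨h1, h2⟩ | ⟨h1, h2, h3⟩ | ⟨h1, h2, h3⟩ <;>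
    rcases ν.offset_ne_zero_or with ⟨h4, h5⟩ | ⟨h4, h5, h6⟩ | ⟨h4, h5, h6⟩
  · exact Or.inl (h2.trans h5.symm)
  · exact absurd (hoff.trans h4) h1
  · exact absurd (hoff.trans h4) h1
  · exact absurd (hoff.symm.trans h1) h4
  · exact Or.inl (h3.trans h6.symm)
  · refine Or.inr ⟨by rw [h3, h6]; rfl, ?_⟩
    by_contra! h7
    exact h.2.2 ⟨h2, isTop_of_even h4 h5 fun a ha => h7 a (h.1.symm.subset ha), h7⟩
  · exact absurd (hoff.symm.trans h1) h4
  · refine Or.inr ⟨by rw [h3, h6], ?_⟩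
    by_contra! h7
    exact h.2.1 ⟨isTop_of_even h1 h2 h7, h5, h7⟩
  · exact Or.inl (h3.trans h6.symm)

theorem card_fixed (h : κ.Equivalent ν) (w : SignedPoint n → ℤ) :
    (fixed κ.vector w).card = (fixed ν.vector w).card :=
  le_antisymm (κ.hasParts_vector.card_fixed_le ν.hasParts_vector h.1 h.posSign w)
    (ν.hasParts_vector.card_fixed_le κ.hasParts_vector h.symm.1 h.symm.posSign w)

end Equivalent

/-- This makes the character table triangular with respect to the number of components. The
components agree by `HasParts.perm_of_mem_fixed`; if all are even, `posSign_eq_of_factor` forces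
equal product signs, which rules out the exceptional pairs. -/
theorem equivalent_of_card_fixed_ne_zero {κ ν : DComposition n}
    (hl : ν.components.length ≤ κ.components.length)
    (h : (fixed κ.vector ν.vector).card ≠ 0) : κ.Equivalent ν := by
  obtain ⟨u, hu⟩ := Finset.card_ne_zero.mp h
  have hperm := κ.hasParts_vector.perm_of_mem_fixed ν.hasParts_vector hu hl
  obtain ⟨hu, hfac⟩ := mem_fixed.mp hu
  obtain ⟨hodd, -, hs⟩ := (mem_orbit_iff κ.isOdd_vector).mp hu
  have key : (∀ a ∈ κ.components, Even a) → posSign κ.vector ≠ 0 → posSign ν.vector ≠ 0 →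
      posSign κ.vector = posSign ν.vector := by
    intro heven h1 h2
    rw [← hs]
    refine posSign_eq_of_factor hodd ν.isOdd_vector hfac (hs ▸ h1) h2 fun t ht => ?_
    by_cases htl : t ≤ ν.components.length
    · have h3 := ν.hasParts_vector.fib_eq ⟨t - 1, by omega⟩
      simp only [Nat.sub_add_cancel ht] at h3
      rw [h3]
      exact heven _ (hperm.symm.subset (List.get_mem _ _))
    · rw [ν.hasParts_vector.fib_eq_zero (not_le.mp htl)]
      exact Even.zero
  refine ⟨hperm, ?_, ?_⟩
  · rintro ⟨h1, h2, h3⟩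
    cases κ with
    | top c hc =>
      cases ν with
      | dual d hd =>
        have e1 := posSign_vector_of_not_isDual (κ := top c hc) rfl id
        have e2 := posSign_vector_dual d hd
        have := key h3 (by rw [e1]; decide) (by rw [e2]; decide)
        omega
      | _ => exact h2.elim
    | _ => exact h1.elim
  · rintro ⟨h1, h2, h3⟩
    cases κ with
    | dual c hc =>
      cases ν with
      | top d hd =>
        have e1 := posSign_vector_of_not_isDual (κ := top d hd) rfl id
        have e2 := posSign_vector_dual c hc
        have := key h3 (by rw [e2]; decide) (by rw [e1]; decide)
        omega
      | _ => exact h2.elim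
    | _ => exact h1.elim

theorem eq_empty_of_components_eq_nil {κ : DComposition n} (h : κ.components = []) :
    κ = empty hn.out := by
  have h2 := hn.out
  have hs := κ.sum_components
  rw [h, List.sum_nil] at hs
  cases κ with
  | below m hm c =>
    simp only [total] at hs
    subst hs
    rw [empty, show c = Composition.ones 0 from Composition.ext h]
  | one c hc => simp only [total] at hs; omega
  | top c hc => simp only [total] at hs; omega
  | dual c hc => simp only [total] at hs; omega

theorem components_empty : (empty hn.out : DComposition n).components = [] := rfl

theorem eq_single_or {κ : DComposition n} (h0 : κ.offset = 0) (h : κ.components.length = 1) :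
    κ = single hn.out ∨ κ = singleDual hn.out := by
  have h2 := hn.out
  obtain ⟨x, hx⟩ := List.length_eq_one_iff.mp h
  have hs := κ.sum_components
  rw [hx, List.sum_singleton] at hs
  cases κ with
  | below m hm c => simp only [offset] at h0; omega
  | one c hc =>
    simp only [components, total] at hx hs
    rw [hx] at hc
    obtain ⟨a, ha, ha1⟩ := hc
    simp only [List.head?_cons, Option.mem_some_iff] at ha
    omega
  | top c hc =>
    left
    simp only [components, total] at hx hs
    have hc' : c = Composition.single n (Nat.lt_of_lt_of_le two_pos hn.out) :=
      Composition.ext (hx.trans (congrArg (fun y => [y]) hs))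
    simp only [single, hc']
  | dual c hc =>
    right
    simp only [components, total] at hx hs
    have hc' : c = Composition.single n (Nat.lt_of_lt_of_le two_pos hn.out) :=
      Composition.ext (hx.trans (congrArg (fun y => [y]) hs))
    simp only [singleDual, hc']

theorem card_fixed_empty (w : SignedPoint n → ℤ) :
    (fixed (empty hn.out : DComposition n).vector w).card = 1 := by
  have h0 : (empty hn.out : DComposition n).vector = 0 := by
    funext a
    have h1 := (empty hn.out : DComposition n).hasParts_vector.natAbs_le a
    rw [components_empty, List.length_nil] at h1
    exact Int.natAbs_eq_zero.mp (Nat.le_zero.mp h1)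
  rw [h0, Finset.card_eq_one]
  refine ⟨0, Finset.eq_singleton_iff_unique_mem.mpr ⟨?_, ?_⟩⟩
  · exact mem_fixed.mpr ⟨mem_orbit.mpr ⟨1, rfl⟩, fun _ _ _ => rfl⟩
  · intro u hu
    obtain ⟨x, rfl⟩ := mem_orbit.mp (mem_fixed.mp hu).1
    rfl

theorem card_fixed_vector_empty {κ : DComposition n} (h : κ ≠ empty hn.out) :
    (fixed κ.vector (empty hn.out : DComposition n).vector).card = 0 := by
  by_contra h1
  have h2 := (equivalent_of_card_fixed_ne_zero (Nat.zero_le _) h1).1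
  rw [components_empty] at h2
  exact h (eq_empty_of_components_eq_nil h2.eq_nil)

theorem even_card_fixed {κ : DComposition n} (h : κ ≠ empty hn.out)
    (h' : Even n ∨ κ ≠ single hn.out ∧ κ ≠ singleDual hn.out) (w : SignedPoint n → ℤ) :
    2 ∣ (fixed κ.vector w).card := by
  refine κ.hasParts_vector.even_card_fixed (fun h1 => h (eq_empty_of_components_eq_nil h1)) ?_ w
  rcases κ.offset_ne_zero_or with ⟨-, h1⟩ | h1 | h1
  · exact Or.inl h1
  all_goals
    right
    by_cases h2 : κ.components.length = 1
    · right
      rcases h' with h' | ⟨h3, h4⟩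
      · obtain ⟨x, hx⟩ := List.length_eq_one_iff.mp h2
        have hs := κ.sum_components
        have hn' := κ.offset_add_total
        rw [hx, List.sum_singleton] at hs
        refine ⟨x, by simp [hx], ?_⟩
        rwa [hs, show κ.total = n by omega]
      · exact absurd (eq_single_or h1.1 h2) (by tauto)
    · exact Or.inl h2

theorem single_equivalent_singleDual (hodd : Odd n) :
    (single hn.out : DComposition n).Equivalent (singleDual hn.out) := by
  refine ⟨List.Perm.refl _, fun h => ?_, fun h => h.1⟩
  exact (Nat.not_even_iff_odd.mpr hodd) (h.2.2 n List.mem_cons_self)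

theorem card_fixed_single (hodd : Odd n) :
    (fixed (single hn.out : DComposition n).vector (single hn.out : DComposition n).vector).card
      = 1 := by
  refine HasParts.card_fixed_self_eq_one (m := n) (hasParts_vector _) ?_ hodd
  have e1 := posSign_vector_of_not_isDual (κ := (single hn.out : DComposition n)) rfl id
  rw [e1]
  decide

end DComposition

theorem span_range_B : Submodule.span ℤ (Set.range fun κ : DComposition n => B κ) = ⊤ := by
  rw [← span_rep]
  congr 1
  ext x
  constructor
  · rintro ⟨κ, rfl⟩
    exact ⟨κ.subsetᶜ, rfl⟩
  · rintro ⟨J, rfl⟩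
    obtain ⟨κ, hκ⟩ := DComposition.exists_subset_eq Jᶜ
    refine ⟨κ, ?_⟩
    change rep κ.subsetᶜ = rep J
    rw [hκ, compl_compl]

variable (p : ℕ) [hp : Fact p.Prime]

theorem character_Bbar (κ ν : DComposition n) :
    character p ν.subsetᶜ (Bbar p κ) = ((fixed κ.vector ν.vector).card : ZMod p) := by
  have h := diagonal_rep κ.isFaceVector_vector ν.subsetᶜ
  rw [fixCount_eq ν.isFaceVector_vector ν.exists_zero_of_vector_eq_zero κ.isOdd_vector] at h
  change ((isTriangular_descentBasis.diagonal ν.subsetᶜ (rep κ.subsetᶜ) : ℤ) : ZMod p) = _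
  rw [h, Int.cast_natCast]

theorem mem_radical_iff_forall_DComposition {x : ModularDescentAlgebra n p} :
    x ∈ radical n p ↔ ∀ ν : DComposition n, character p ν.subsetᶜ x = 0 := by
  rw [mem_radical_iff]
  refine ⟨fun h ν => h _, fun h J => ?_⟩
  obtain ⟨ν, hν⟩ := DComposition.exists_subset_eq Jᶜ
  rw [← compl_compl J, ← hν]
  exact h ν

theorem exists_linearCombination (x : ModularDescentAlgebra n p) :
    ∃ c : DComposition n →₀ ZMod p, Finsupp.linearCombination (ZMod p) (Bbar p) c = x := by
  obtain ⟨y, rfl⟩ := Ideal.Quotient.mk_surjective x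
  rw [← LinearMap.mem_range, Finsupp.range_linearCombination]
  have hy : y ∈ Submodule.span ℤ (Set.range fun κ : DComposition n => B κ) := by
    rw [span_range_B]
    trivial
  induction hy using Submodule.span_induction with
  | mem y hy =>
    obtain ⟨κ, rfl⟩ := hy
    exact Submodule.subset_span ⟨κ, rfl⟩
  | zero => rw [RingHom.map_zero]; exact zero_mem _
  | add y z _ _ h1 h2 => rw [RingHom.map_add]; exact add_mem h1 h2
  | smul a y _ h =>
    have e := (Ideal.Quotient.mk (multiples n p)).toAddMonoidHom.map_zsmul a y
    exact e ▸ zsmul_mem h a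

theorem character_linearCombination (ν : DComposition n) (c : DComposition n →₀ ZMod p) :
    character p ν.subsetᶜ (Finsupp.linearCombination (ZMod p) (Bbar p) c) =
      ∑ κ ∈ c.support, c κ * ((fixed κ.vector ν.vector).card : ZMod p) := by
  rw [Finsupp.linearCombination_apply, Finsupp.sum]
  refine (map_sum (character p ν.subsetᶜ).toAddMonoidHom _ _).trans
    (Finset.sum_congr rfl fun κ _ => ?_)
  change character p ν.subsetᶜ (c κ • Bbar p κ) = _
  rw [character_smul, character_Bbar]

theorem span_subset_radical {S : Set (ModularDescentAlgebra n p)}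
    (hS : ∀ x ∈ S, x ∈ radical n p) {x : ModularDescentAlgebra n p}
    (hx : x ∈ Submodule.span (ZMod p) S) : x ∈ radical n p := by
  induction hx using Submodule.span_induction with
  | mem x hx => exact hS x hx
  | zero => exact zero_mem _
  | add x y _ _ h1 h2 => exact add_mem h1 h2
  | smul a x _ h =>
    rw [mem_radical_iff] at h ⊢
    intro J
    rw [character_smul, h, mul_zero]

theorem Bbar_sub_mem_radical {κ ν : DComposition n} (h : κ.Equivalent ν) :
    Bbar p κ - Bbar p ν ∈ radical n p := by
  rw [mem_radical_iff_forall_DComposition]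
  intro w
  rw [RingHom.map_sub, character_Bbar, character_Bbar, h.card_fixed, sub_self]

theorem Bbar_mem_radical_of_multiplicity {κ : DComposition n} (h : κ.HasMultiplicityAtLeast p) :
    Bbar p κ ∈ radical n p := by
  rw [mem_radical_iff_forall_DComposition]
  intro w
  obtain ⟨a, -, ha⟩ := h
  rw [character_Bbar, ZMod.natCast_eq_zero_iff]
  exact κ.hasParts_vector.dvd_card_fixed ha w.vector

theorem Bbar_mem_radical_of_two {κ : DComposition n} (h : κ ≠ DComposition.empty hn.out)
    (h' : Even n ∨ κ ≠ DComposition.single hn.out ∧ κ ≠ DComposition.singleDual hn.out) :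
    Bbar 2 κ ∈ radical n 2 := by
  rw [mem_radical_iff_forall_DComposition]
  intro w
  rw [character_Bbar, ZMod.natCast_eq_zero_iff]
  exact κ.even_card_fixed h h' w.vector

/-- The elements that span the radical if `p` is odd. -/
def oddGenerators (n p : ℕ) : Set (ModularDescentAlgebra n p) :=
  {x | ∃ κ ν : DComposition n, κ.Equivalent ν ∧ x = Bbar p κ - Bbar p ν} ∪
    {x | ∃ κ : DComposition n, κ.HasMultiplicityAtLeast p ∧ x = Bbar p κ}

theorem oddGenerators_subset_radical {x : ModularDescentAlgebra n p}
    (hx : x ∈ oddGenerators n p) : x ∈ radical n p := by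
  rcases hx with ⟨κ, ν, h, rfl⟩ | ⟨κ, h, rfl⟩
  · exact Bbar_sub_mem_radical p h
  · exact Bbar_mem_radical_of_multiplicity p h

/-- Subtracting multiples of generators shrinks the support as long as a term ν with the fewest
components has a part of multiplicity at least `p` or an equivalent partner. Otherwise the character
at ν sees only the term of ν, with a factor prime to `p`, so the combination cannot lie in the
radical. -/
theorem mem_span_oddGenerators (hp2 : p ≠ 2) (c : DComposition n →₀ ZMod p)
    (hc : Finsupp.linearCombination (ZMod p) (Bbar p) c ∈ radical n p) :
    Finsupp.linearCombination (ZMod p) (Bbar p) c ∈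
      Submodule.span (ZMod p) (oddGenerators n p) := by
  classical
  induction hk : c.support.card using Nat.strong_induction_on generalizing c with
  | _ k ih =>
    subst hk
    have reduce : ∀ (c' : DComposition n →₀ ZMod p), ∀ e ∈ Submodule.span (ZMod p) (oddGenerators n p),
        Finsupp.linearCombination (ZMod p) (Bbar p) c =
          Finsupp.linearCombination (ZMod p) (Bbar p) c' + e →
        c'.support.card < c.support.card → Finsupp.linearCombination (ZMod p) (Bbar p) c ∈
          Submodule.span (ZMod p) (oddGenerators n p) := by
      intro c' e he hce hcard
      have he' := span_subset_radical p (fun x hx => oddGenerators_subset_radical p hx) he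
      rw [hce]
      refine add_mem (ih _ hcard c' ?_ rfl) he
      rw [hce] at hc
      exact (add_mem_cancel_right he').mp hc
    by_cases h0 : c.support = ∅
    · rw [Finsupp.support_eq_empty.mp h0, map_zero]
      exact zero_mem _
    -- Minimality makes `equivalent_of_card_fixed_ne_zero` applicable to every other term.
    obtain ⟨ν, hν, hmin⟩ := Finset.exists_min_image c.support
      (fun κ => κ.components.length) (Finset.nonempty_iff_ne_empty.mpr h0)
    by_cases hmult : ν.HasMultiplicityAtLeast p
    · refine reduce (c.erase ν) (c ν • Bbar p ν)
        (Submodule.smul_mem _ _ (Submodule.subset_span (Or.inr ⟨ν, hmult, rfl⟩))) ?_ ?_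
      · conv_lhs => rw [← Finsupp.erase_add_single ν c, map_add, Finsupp.linearCombination_single]
      · rw [Finsupp.support_erase]
        exact Finset.card_erase_lt_of_mem hν
    by_cases heq : ∃ κ ∈ c.support, κ ≠ ν ∧ κ.Equivalent ν
    · obtain ⟨κ, hκ, hne, heq⟩ := heq
      refine reduce (c.erase κ + Finsupp.single ν (c κ)) (c κ • (Bbar p κ - Bbar p ν))
        (Submodule.smul_mem _ _ (Submodule.subset_span (Or.inl ⟨κ, ν, heq, rfl⟩))) ?_ ?_
      · conv_lhs => rw [← Finsupp.erase_add_single κ c]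
        rw [map_add, map_add, Finsupp.linearCombination_single, Finsupp.linearCombination_single,
          smul_sub]
        abel
      · refine lt_of_le_of_lt (Finset.card_le_card ?_) (Finset.card_erase_lt_of_mem hκ)
        refine Finsupp.support_add.trans (Finset.union_subset (Finsupp.support_erase).le ?_)
        refine Finsupp.support_single_subset.trans ?_
        rw [Finset.singleton_subset_iff, Finset.mem_erase]
        exact ⟨hne.symm, hν⟩
    · exfalso
      have h1 := (mem_radical_iff_forall_DComposition p).mp hc ν
      rw [character_linearCombination, Finset.sum_eq_single ν] at h1
      · rcases mul_eq_zero.mp h1 with h2 | h2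
        · exact Finsupp.mem_support_iff.mp hν h2
        · rw [ZMod.natCast_eq_zero_iff] at h2
          obtain ⟨a, ha, ha'⟩ := ν.hasParts_vector.exists_le_count hp2 h2
          exact hmult ⟨a, ha, ha'⟩
      · intro κ hκ hne
        have h2 : (fixed κ.vector ν.vector).card = 0 := by
          by_contra h2
          exact heq ⟨κ, hκ, hne,
            DComposition.equivalent_of_card_fixed_ne_zero (hmin κ hκ) h2⟩
        rw [h2, Nat.cast_zero, mul_zero]
      · exact fun h => absurd hν h

/-- The character at [ ] is 1 on the basis element of [ ] and 0 on all others. -/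
theorem apply_empty_eq_zero {c : DComposition n →₀ ZMod p}
    (hc : Finsupp.linearCombination (ZMod p) (Bbar p) c ∈ radical n p) :
    c (DComposition.empty hn.out) = 0 := by
  have h1 := (mem_radical_iff_forall_DComposition p).mp hc (DComposition.empty hn.out)
  rw [character_linearCombination, Finset.sum_eq_single (DComposition.empty hn.out)] at h1
  · rwa [DComposition.card_fixed_empty, Nat.cast_one, mul_one] at h1
  · intro κ _ hne
    rw [DComposition.card_fixed_vector_empty hne, Nat.cast_zero, mul_zero]
  · intro h
    rw [Finsupp.notMem_support_iff.mp h, zero_mul]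

/-- Modulo 2, the character at [n] is 1 on the basis elements of [n] and [n]^∨ and kills all others
except that of [ ], whose coefficient is already known to be 0. -/
theorem apply_single_add_apply_singleDual (hodd : Odd n) {c : DComposition n →₀ ZMod 2}
    (hc : Finsupp.linearCombination (ZMod 2) (Bbar 2) c ∈ radical n 2) :
    c (DComposition.single hn.out) + c (DComposition.singleDual hn.out) = 0 := by
  classical
  have h0 := apply_empty_eq_zero 2 hc
  have h1 := (mem_radical_iff_forall_DComposition 2).mp hc (DComposition.single hn.out)
  have hne : (DComposition.single hn.out : DComposition n) ≠ DComposition.singleDual hn.out := by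
    intro h
    cases h
  -- The support may miss [n] or [n]^∨, so the sum is extended to a union before it is cut down to
  -- these two.
  rw [character_linearCombination,
    Finset.sum_subset (Finset.subset_union_left (s₂ := {DComposition.single hn.out,
      DComposition.singleDual hn.out})),
    ← Finset.sum_subset (Finset.subset_union_right (s₁ := c.support)), Finset.sum_pair hne,
    ← (DComposition.single_equivalent_singleDual hodd).card_fixed,
    DComposition.card_fixed_single hodd, Nat.cast_one, mul_one, mul_one] at h1
  · exact h1
  · intro κ _ hκ
    rw [Finset.mem_insert, Finset.mem_singleton, not_or] at hκ
    by_cases hκ0 : κ = DComposition.empty hn.out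
    · rw [hκ0, h0, zero_mul]
    · rw [(ZMod.natCast_eq_zero_iff _ 2).mpr (κ.even_card_fixed hκ0 (Or.inr hκ) _), mul_zero]
  · intro κ _ hκ
    rw [Finsupp.notMem_support_iff.mp hκ, zero_mul]

end Radical

end TypeD

/-! ### Assembly of the three cases -/

open TypeD

theorem theorem3p1 (n : ℕ) (hn : 2 ≤ n) (p : ℕ) [Fact p.Prime] :
    -- the integral descent ring is the `ℤ`-span of the `B_κ`
    Submodule.span ℤ (Set.range fun κ : DComposition n => B κ) = ⊤ ∧
    (p ≠ 2 →
      (radical n p : Set (ModularDescentAlgebra n p)) =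
        Submodule.span (ZMod p)
          ({x | ∃ κ ν : DComposition n, κ.Equivalent ν ∧ x = Bbar p κ - Bbar p ν} ∪
            {x | ∃ κ : DComposition n, κ.HasMultiplicityAtLeast p ∧ x = Bbar p κ})) ∧
    (p = 2 → Even n →
      (radical n p : Set (ModularDescentAlgebra n p)) =
        Submodule.span (ZMod p)
          {x | ∃ κ : DComposition n, κ ≠ DComposition.empty hn ∧ x = Bbar p κ}) ∧
    (p = 2 → Odd n →
      (radical n p : Set (ModularDescentAlgebra n p)) =
        Submodule.span (ZMod p)
          ({x | ∃ κ : DComposition n, κ ≠ DComposition.empty hn ∧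
              κ ≠ DComposition.single hn ∧ κ ≠ DComposition.singleDual hn ∧ x = Bbar p κ} ∪
            {Bbar p (DComposition.single hn) - Bbar p (DComposition.singleDual hn)})) := by
  classical
  have : Fact (2 ≤ n) := ⟨hn⟩
  refine ⟨span_range_B, fun hp2 => ?_, ?_, ?_⟩
  · ext x
    constructor
    · intro hx
      obtain ⟨c, rfl⟩ := exists_linearCombination p x
      exact mem_span_oddGenerators p hp2 c hx
    · exact fun hx => span_subset_radical p (fun y hy => oddGenerators_subset_radical p hy) hx
  · rintro rfl heven
    ext x
    constructor
    · intro hx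
      obtain ⟨c, rfl⟩ := exists_linearCombination 2 x
      have h0 := apply_empty_eq_zero 2 hx
      rw [Finsupp.linearCombination_apply]
      refine Submodule.sum_mem _ fun κ hκ => Submodule.smul_mem _ _ (Submodule.subset_span ?_)
      refine ⟨κ, ?_, rfl⟩
      rintro rfl
      exact Finsupp.mem_support_iff.mp hκ h0
    · intro hx
      refine span_subset_radical 2 ?_ hx
      rintro _ ⟨κ, hκ, rfl⟩
      exact Bbar_mem_radical_of_two hκ (Or.inl heven)
  · rintro rfl hodd
    ext x
    constructor
    · intro hx
      obtain ⟨c, rfl⟩ := exists_linearCombination 2 x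
      have h0 := apply_empty_eq_zero 2 hx
      have h1 := apply_single_add_apply_singleDual hodd hx
      have h2 : c (DComposition.singleDual hn) = -c (DComposition.single hn) :=
        eq_neg_of_add_eq_zero_right h1
      have hne : (DComposition.singleDual hn : DComposition n) ≠ DComposition.single hn := by
        intro h
        cases h
      have hc : c = (c.erase (DComposition.single hn)).erase (DComposition.singleDual hn) +
          Finsupp.single (DComposition.singleDual hn) (c (DComposition.singleDual hn)) +
          Finsupp.single (DComposition.single hn) (c (DComposition.single hn)) := by
        conv_lhs => rw [← Finsupp.erase_add_single (DComposition.single hn) c,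
          ← Finsupp.erase_add_single (DComposition.singleDual hn)
            (c.erase (DComposition.single hn)), Finsupp.erase_ne hne]
      -- The coefficients at [n] and [n]^∨ are opposite, so these two terms combine to a multiple of
      -- the difference of their basis elements.
      rw [hc, map_add, map_add, Finsupp.linearCombination_single,
        Finsupp.linearCombination_single, h2, add_assoc, neg_smul, neg_add_eq_sub, ← smul_sub]
      refine add_mem ?_ (Submodule.smul_mem _ _ (Submodule.subset_span (Or.inr rfl)))
      rw [Finsupp.linearCombination_apply]
      refine Submodule.sum_mem _ fun κ hκ => Submodule.smul_mem _ _ (Submodule.subset_span ?_)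
      rw [Finsupp.support_erase, Finsupp.support_erase, Finset.mem_erase, Finset.mem_erase] at hκ
      refine Or.inl ⟨κ, ?_, hκ.2.1, hκ.1, rfl⟩
      rintro rfl
      exact Finsupp.mem_support_iff.mp hκ.2.2 h0
    · intro hx
      refine span_subset_radical 2 ?_ hx
      rintro _ (⟨κ, hκ, h1, h2, rfl⟩ | rfl)
      · exact Bbar_mem_radical_of_two hκ (Or.inr ⟨h1, h2⟩)
      · exact Bbar_sub_mem_radical 2 (DComposition.single_equivalent_singleDual hodd)
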